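/- **Proposition.** Let $C$ be a compact connected Riemann surface of genus $\ge 2$. Let $D\to C$ be a holomorphic disc bundle, given by local trivializations whose transition maps are locally constant with values in $\operatorname{Aut}\mathbb D$, $\mathbb D=\{|\zeta|<1\}$, and let $P\to C$ be the associated $\mathbb P^1$-bundle, obtained from $\operatorname{Aut}\mathbb D\hookrightarrow\operatorname{Aut}\mathbb P^1$, so that $D$ is a domain in the compact complex surface $P$. Suppose that $D\to C$ has a harmonic section $s$ with only finitely many critical points. (In a local flat trivialization, $s$ is given by a $\mathcal C^2$ map $h$ into $\mathbb D$. *Harmonic* means that $h$ is harmonic for the Poincaré metric on $\mathbb D$, i.e. $h_{z\bar z}+\frac{2\bar h}{1-|h|^2}h_zh_{\bar z}=0$; a *critical point* of $s$ is a point where the real differential $dh$ is not surjective.) Let $\varphi$ be a real-analytic diffeomorphism from an open neighbourhood $U$ of $\partial D$ in $P$ onto an open neighbourhood of the zero section (for instance all) of the normal bundle of $\partial D$ in $P$, which identifies $\partial D$ with the zero section; and fix a $\mathcal C^2$-norm on the sections of the normal bundle. Then there is $\delta>0$ such that the following holds for every real-analytic section $\sigma$ of the normal bundle with $\|\sigma\|_{\mathcal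 C^2}<\delta$. If the hypersurface $S=\{p\in U:\varphi(p)\in\sigma(\partial D)\}$ (a *displacement* of $\partial D$) is Levi-flat, then $S=\partial\Omega'$ for a Takeuchi $1$-convex domain $\Omega'\subset P$ with $\Omega'\setminus U=D\setminus U$. Here a real hypersurface $S$ is *Levi-flat* if locally it has a $\mathcal C^2$ defining function whose Levi form, restricted to the holomorphic tangent spaces of $S$, vanishes identically. A relatively compact domain $\Omega$ with $\mathcal C^2$ boundary in an $n$-dimensional complex manifold $X$ is *Takeuchi $q$-convex* if it has a $\mathcal C^2$ defining function $r$ ($\Omega=\{r<0\}$, $dr\ne0$ on $\partial\Omega$) such that, with respect to some Hermitian metric on $X$, at least $n-q+1$ eigenvalues of the Levi form of $-\log(-r)$ are greater than $1$ outside a compact subset of $\Omega$. -/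

import Mathlib

open Set Filter Topology Manifold ContDiff Bundle

/-! ### The Riemann sphere -/

namespace RiemannSphere

/-- The inversion `ζ ↦ 1/ζ` of the sphere `ℙ¹ = ℂ ∪ {∞}`. -/
noncomputable def inv (p : OnePoint ℂ) : OnePoint ℂ :=
  p.elim ((0 : ℂ) : OnePoint ℂ)
    (fun z => if z = 0 then OnePoint.infty else ((z⁻¹ : ℂ) : OnePoint ℂ))

/-- The affine coordinate of a point of the sphere (with the value `0` at `∞`). -/
noncomputable def toComplex (p : OnePoint ℂ) : ℂ := p.elim 0 id

lemma inv_coe {z : ℂ} (hz : z ≠ 0) : inv (z : OnePoint ℂ) = ((z⁻¹ : ℂ) : OnePoint ℂ) := by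
  simp [inv, hz]

lemma inv_zero : inv ((0 : ℂ) : OnePoint ℂ) = OnePoint.infty := by simp [inv]

lemma inv_infty : inv (OnePoint.infty : OnePoint ℂ) = ((0 : ℂ) : OnePoint ℂ) := rfl

lemma inv_inv (p : OnePoint ℂ) : inv (inv p) = p := by
  induction p using OnePoint.rec with
  | infty => rw [inv_infty, inv_zero]
  | coe z =>
    by_cases hz : z = 0
    · subst hz; rw [inv_zero, inv_infty]
    · rw [inv_coe hz, inv_coe (inv_ne_zero hz), _root_.inv_inv]

lemma continuous_inv : Continuous inv := by
  have hinf : Tendsto ((↑) : ℂ → OnePoint ℂ) (Bornology.cobounded ℂ) (𝓝 OnePoint.infty) := by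
    rw [Metric.cobounded_eq_cocompact, ← Filter.coclosedCompact_eq_cocompact]
    exact OnePoint.tendsto_coe_infty
  rw [OnePoint.continuous_iff]
  constructor
  · rw [inv_infty, Filter.coclosedCompact_eq_cocompact, ← Metric.cobounded_eq_cocompact]
    have h1 : Tendsto (fun z : ℂ => ((z⁻¹ : ℂ) : OnePoint ℂ)) (Bornology.cobounded ℂ)
        (𝓝 ((0 : ℂ) : OnePoint ℂ)) :=
      (OnePoint.continuous_coe.tendsto 0).comp Filter.tendsto_inv₀_cobounded
    refine h1.congr' ?_
    filter_upwards [Bornology.eventually_ne_cobounded (0 : ℂ)] with z hz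
    rw [inv_coe hz]
  · rw [continuous_iff_continuousAt]
    intro z
    by_cases hz : z = 0
    · subst hz
      rw [continuousAt_iff_punctured_nhds, inv_zero]
      refine (hinf.comp Filter.tendsto_inv₀_nhdsNE_zero).congr' ?_
      filter_upwards [self_mem_nhdsWithin] with w hw
      simp only [Function.comp_apply]
      rw [inv_coe hw]
    · have h1 : ContinuousAt (fun w : ℂ => ((w⁻¹ : ℂ) : OnePoint ℂ)) z :=
        OnePoint.continuous_coe.continuousAt.comp (continuousAt_inv₀ hz)
      refine h1.congr ?_
      filter_upwards [isOpen_ne.mem_nhds hz] with w hw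
      rw [inv_coe hw]

/-- The inversion as a homeomorphism. -/
noncomputable def invHomeo : OnePoint ℂ ≃ₜ OnePoint ℂ where
  toFun := inv
  invFun := inv
  left_inv := inv_inv
  right_inv := inv_inv
  continuous_toFun := continuous_inv
  continuous_invFun := continuous_inv

/-- The affine chart `ζ` on `ℙ¹ ∖ {∞}`. -/
noncomputable def chartZero : OpenPartialHomeomorph (OnePoint ℂ) ℂ :=
  (OnePoint.isOpenEmbedding_coe (X := ℂ)).toOpenPartialHomeomorph.symm

/-- The affine chart `1/ζ` on `ℙ¹ ∖ {0}`. -/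
noncomputable def chartInfty : OpenPartialHomeomorph (OnePoint ℂ) ℂ :=
  invHomeo.toOpenPartialHomeomorph.trans chartZero

lemma mem_chartZero_source {p : OnePoint ℂ} :
    p ∈ chartZero.source ↔ p ∈ range ((↑) : ℂ → OnePoint ℂ) := by
  simp [chartZero]

lemma mem_chartInfty_source {p : OnePoint ℂ} :
    p ∈ chartInfty.source ↔ inv p ∈ range ((↑) : ℂ → OnePoint ℂ) := by
  simp [chartInfty, chartZero, invHomeo]

lemma chartZero_coe (z : ℂ) : chartZero (z : OnePoint ℂ) = z :=
  (OnePoint.isOpenEmbedding_coe (X := ℂ)).toOpenPartialHomeomorph.left_inv (x := z) (by simp)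

lemma chartZero_symm (z : ℂ) : chartZero.symm z = (z : OnePoint ℂ) := rfl

lemma chartInfty_symm (z : ℂ) : chartInfty.symm z = inv (z : OnePoint ℂ) := rfl

lemma chartInfty_apply (p : OnePoint ℂ) : chartInfty p = chartZero (inv p) := rfl

open Classical in
/-- `ℙ¹` as a complex curve, with the two charts `ζ` and `1/ζ`. -/
noncomputable instance instChartedSpace : ChartedSpace ℂ (OnePoint ℂ) where
  atlas := {chartZero, chartInfty}
  chartAt p := if p = OnePoint.infty then chartInfty else chartZero
  mem_chart_source p := by
    induction p using OnePoint.rec with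
    | infty => simp [mem_chartInfty_source, inv_infty]
    | coe z => simp [mem_chartZero_source]
  chart_mem_atlas p := by
    by_cases h : p = OnePoint.infty <;> simp [h]

instance instIsManifold : IsManifold 𝓘(ℂ) ω (OnePoint ℂ) := by
  have key : ∀ e : OpenPartialHomeomorph ℂ ℂ, (∀ z ∈ e.source, z ≠ 0) →
      (∀ z ∈ e.source, e z = z⁻¹) → ContDiffOn ℂ ω e e.source := by
    intro e h0 he
    exact ContDiffOn.congr (fun z hz => (contDiffAt_inv ℂ (h0 z hz)).contDiffWithinAt) he
  refine isManifold_of_contDiffOn 𝓘(ℂ) ω (OnePoint ℂ) ?_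
  intro e e' he he'
  simp only [modelWithCornersSelf_coe, modelWithCornersSelf_coe_symm, Function.id_comp,
    Function.comp_id, preimage_id, range_id, inter_univ]
  rcases he with rfl | he <;> rcases he' with rfl | he'
  · refine contDiffOn_id.congr fun z hz => ?_
    rw [OpenPartialHomeomorph.trans_apply, chartZero_symm, chartZero_coe]; rfl
  · rw [mem_singleton_iff] at he'; subst he'
    have h0 : ∀ z ∈ (chartZero.symm.trans chartInfty).source, z ≠ 0 := by
      rintro z hz rfl
      rw [OpenPartialHomeomorph.trans_source] at hz
      have := hz.2
      rw [mem_preimage, chartZero_symm, mem_chartInfty_source, inv_zero] at this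
      simp at this
    refine key _ h0 fun z hz => ?_
    rw [OpenPartialHomeomorph.trans_apply, chartZero_symm, chartInfty_apply, inv_coe (h0 z hz),
      chartZero_coe]
  · rw [mem_singleton_iff] at he; subst he
    have h0 : ∀ z ∈ (chartInfty.symm.trans chartZero).source, z ≠ 0 := by
      rintro z hz rfl
      rw [OpenPartialHomeomorph.trans_source] at hz
      have := hz.2
      rw [mem_preimage, chartInfty_symm, mem_chartZero_source, inv_zero] at this
      simp at this
    refine key _ h0 fun z hz => ?_
    rw [OpenPartialHomeomorph.trans_apply, chartInfty_symm, inv_coe (h0 z hz), chartZero_coe]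
  · rw [mem_singleton_iff] at he he'; subst he he'
    refine contDiffOn_id.congr fun z hz => ?_
    rw [OpenPartialHomeomorph.trans_apply, chartInfty_symm, chartInfty_apply, inv_inv,
      chartZero_coe]; rfl

/-- The unit disc `{|ζ| < 1}` as a subset of `ℙ¹`. -/
def unitDisc : Set (OnePoint ℂ) := (↑) '' Metric.ball (0 : ℂ) 1

/-- A Möbius transformation of `ℙ¹` that maps the unit disc onto itself. The restrictions of these
to the disc are exactly its biholomorphic automorphisms. -/
def IsDiscAut (g : GL (Fin 2) ℂ) : Prop := (fun ζ : OnePoint ℂ => g • ζ) '' unitDisc = unitDisc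

end RiemannSphere

/-! ### Compact Riemann surfaces and disc bundles over them -/

/-- The genus of a compact Riemann surface: the dimension of its space of holomorphic 1-forms. -/
noncomputable def genus (C : Type*) [TopologicalSpace C] [ChartedSpace ℂ C]
    [IsManifold 𝓘(ℂ) ω C] : ℕ :=
  Module.finrank ℂ
    Cₛ^ω⟮𝓘(ℂ); ℂ →L[ℂ] ℂ, fun x : C => TangentSpace 𝓘(ℂ) x →L[ℂ] Bundle.Trivial C ℂ x⟯

/-- A holomorphic disc bundle `D → C` together with its associated `ℙ¹`-bundle `P → C`: the total
space `P` is a complex surface that carries biholomorphic local trivializations `π⁻¹(V) ≃ V × ℙ¹`,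
and any two of these differ by a locally constant function with values in `Aut 𝔻 ⊆ Aut ℙ¹`. -/
structure DiscBundle (C P : Type*) [TopologicalSpace C] [ChartedSpace ℂ C]
    [TopologicalSpace P] [ChartedSpace (ℂ × ℂ) P] where
  /-- the bundle projection -/
  proj : P → C
  /-- the flat local trivializations -/
  trivs : Set (Trivialization (OnePoint ℂ) proj)
  cover : ∀ x : C, ∃ e ∈ trivs, x ∈ e.baseSet
  holomorphic : ∀ e ∈ trivs, ContMDiffOn 𝓘(ℂ, ℂ × ℂ) (𝓘(ℂ).prod 𝓘(ℂ)) ω e e.source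
  holomorphic_symm : ∀ e ∈ trivs,
    ContMDiffOn (𝓘(ℂ).prod 𝓘(ℂ)) 𝓘(ℂ, ℂ × ℂ) ω e.toOpenPartialHomeomorph.symm e.target
  transition : ∀ e ∈ trivs, ∀ e' ∈ trivs, ∀ x ∈ e.baseSet ∩ e'.baseSet,
    ∃ g : GL (Fin 2) ℂ, RiemannSphere.IsDiscAut g ∧
      ∀ᶠ y in 𝓝 x, ∀ ζ : OnePoint ℂ, e' (e.toOpenPartialHomeomorph.symm (y, ζ)) = (y, g • ζ)

/-- The Wirtinger derivative `∂f/∂z`. -/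
noncomputable def wirtinger (f : ℂ → ℂ) (z : ℂ) : ℂ :=
  (fderiv ℝ f z 1 - Complex.I * fderiv ℝ f z Complex.I) / 2

/-- The Wirtinger derivative `∂f/∂z̄`. -/
noncomputable def wirtingerBar (f : ℂ → ℂ) (z : ℂ) : ℂ :=
  (fderiv ℝ f z 1 + Complex.I * fderiv ℝ f z Complex.I) / 2

/-- The equation of harmonic maps into the disc with the Poincaré metric `|dw|² / (1 - |w|²)²`:
`h_{z z̄} + 2 h̄ h_z h_z̄ / (1 - |h|²) = 0` at the point `z`. -/
def IsHarmonicDiscMapAt (h : ℂ → ℂ) (z : ℂ) : Prop :=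
  ContDiffAt ℝ 2 h z ∧
    wirtinger (wirtingerBar h) z +
      2 * (starRingEnd ℂ) (h z) / (1 - (‖h z‖ : ℂ) ^ 2) * wirtinger h z * wirtingerBar h z = 0

namespace DiscBundle

variable {C P : Type*} [TopologicalSpace C] [ChartedSpace ℂ C]
    [TopologicalSpace P] [ChartedSpace (ℂ × ℂ) P]

/-- The disc bundle `D`, as a subset of the `ℙ¹`-bundle `P`. -/
def disc (B : DiscBundle C P) : Set P :=
  {p | ∃ e ∈ B.trivs, B.proj p ∈ e.baseSet ∧ (e p).2 ∈ RiemannSphere.unitDisc}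

/-- The fibre coordinate `ζ ∘ s` of a section `s` in a flat trivialization `e`, read in the
holomorphic chart of the base at `x`. -/
noncomputable def localSection (B : DiscBundle C P) (s : C → P)
    (e : Trivialization (OnePoint ℂ) B.proj) (x : C) (z : ℂ) : ℂ :=
  RiemannSphere.toComplex (e (s ((chartAt ℂ x).symm z))).2

/-- `s` is a section of `D → C` which is harmonic: in the flat trivializations it is given by
harmonic maps into the unit disc with the Poincaré metric. -/
def IsHarmonicSection (B : DiscBundle C P) (s : C → P) : Prop :=
  (∀ x, B.proj (s x) = x) ∧ (∀ x, s x ∈ B.disc) ∧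
    ∀ e ∈ B.trivs, ∀ x ∈ e.baseSet, IsHarmonicDiscMapAt (B.localSection s e x) (chartAt ℂ x x)

/-- The critical points of a section `s` of `D → C`: the points of `C` at which the differential of
the disc-valued map that represents `s` in a flat trivialization is not onto. -/
def criticalPoints (B : DiscBundle C P) (s : C → P) : Set C :=
  {x | ∃ e ∈ B.trivs, x ∈ e.baseSet ∧
    ¬ Function.Surjective (fderiv ℝ (B.localSection s e x) (chartAt ℂ x x))}

end DiscBundle

/-! ### Complex manifolds: Levi form, Takeuchi convexity, Levi-flat hypersurfaces

In what follows `X` is a complex manifold modelled on `E`. As everywhere in Mathlib, the tangent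
space at `x` is `E`, through the preferred chart at `x`. -/

section ComplexManifold

variable (E : Type*) [NormedAddCommGroup E] [NormedSpace ℂ E]
  {X : Type*} [TopologicalSpace X] [ChartedSpace E X]

/-- The differential at `x` of a real function. -/
noncomputable def differential (f : X → ℝ) (x : X) : E →L[ℝ] ℝ :=
  fderiv ℝ (f ∘ (chartAt E x).symm) (chartAt E x x)

/-- The second derivative, in the chart at `a`, of a real function at a point `x`. -/
noncomputable def secondDerivative (a : X) (f : X → ℝ) (x : X) : E →L[ℝ] E →L[ℝ] ℝ :=
  fderiv ℝ (fderiv ℝ (f ∘ (chartAt E a).symm)) (chartAt E a x)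

/-- The Levi form `∂∂̄ f` at `x` as a sesquilinear form on the tangent space, conjugate linear in
`v` and linear in `w`: in coordinates, `∑ f_{z_j z̄_k} w_j v̄_k`. -/
noncomputable def leviForm (f : X → ℝ) (x : X) (v w : E) : ℂ :=
  let b := secondDerivative E x f x
  (((b v w + b (Complex.I • v) (Complex.I • w) : ℝ) : ℂ) +
    ((b (Complex.I • v) w - b v (Complex.I • w) : ℝ) : ℂ) * Complex.I) / 4

variable (X) in
/-- A smooth Hermitian metric on `X`. -/
structure HermitianMetric where
  /-- the Hermitian inner product on the tangent space at a point -/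
  form : X → E →ₗ⋆[ℂ] E →ₗ[ℂ] ℂ
  conj_symm : ∀ x v w, (starRingEnd ℂ) (form x v w) = form x w v
  pos : ∀ x v, v ≠ 0 → 0 < (form x v v).re
  /-- in every preferred chart, the coefficients of the metric are smooth -/
  smooth : ∀ (a : X) (v w : E), ContDiffOn ℝ ∞
    (fun y : E => form ((chartAt E a).symm y)
      (mfderiv 𝓘(ℂ, E) 𝓘(ℂ, E) (chartAt E a).symm y v)
      (mfderiv 𝓘(ℂ, E) 𝓘(ℂ, E) (chartAt E a).symm y w)) (chartAt E a).target

/-- At least `k` eigenvalues, counted with multiplicity, of the Levi form of `f` at `x` with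
respect to the Hermitian metric `g` are greater than `1`: there are `k` pairwise orthogonal unit
eigenvectors with such eigenvalues. -/
def HasEigenvaluesGtOne (g : HermitianMetric E X) (f : X → ℝ) (x : X) (k : ℕ) : Prop :=
  ∃ (v : Fin k → E) (μ : Fin k → ℝ),
    (∀ i j, g.form x (v i) (v j) = if i = j then 1 else 0) ∧
    ∀ i, 1 < μ i ∧ ∀ w, leviForm E f x (v i) w = μ i * g.form x (v i) w

/-- `Ω` is a Takeuchi `q`-convex domain in `X`: a relatively compact domain with a `C²` defining
function `r` such that, for some Hermitian metric, at least `n - q + 1` eigenvalues of the Levi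
form of `-log (-r)` are greater than `1` outside a compact subset of `Ω`, where `n = dim X`. -/
structure IsTakeuchiConvex (q : ℕ) (Ω : Set X) : Prop where
  isOpen : IsOpen Ω
  isConnected : IsConnected Ω
  isCompact_closure : IsCompact (closure Ω)
  exists_defining : ∃ r : X → ℝ, ContMDiff 𝓘(ℝ, E) 𝓘(ℝ, ℝ) 2 r ∧
    Ω = {x | r x < 0} ∧ (∀ x ∈ frontier Ω, differential E r x ≠ 0) ∧
    ∃ (g : HermitianMetric E X) (K : Set X), IsCompact K ∧ K ⊆ Ω ∧
      ∀ x ∈ Ω \ K, HasEigenvaluesGtOne E g (fun y => -Real.log (-r y)) x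
        (Module.finrank ℂ E + 1 - q)

/-- `S` is a Levi-flat real hypersurface of class `C²`: near each of its points it has a `C²`
defining function whose Levi form vanishes on the holomorphic tangent spaces of `S`. -/
def IsLeviFlat (S : Set X) : Prop :=
  ∀ p ∈ S, ∃ (V : Set X) (r : X → ℝ), IsOpen V ∧ p ∈ V ∧
    ContMDiffOn 𝓘(ℝ, E) 𝓘(ℝ, ℝ) 2 r V ∧ S ∩ V = {x ∈ V | r x = 0} ∧
    ∀ x ∈ S ∩ V, differential E r x ≠ 0 ∧
      ∀ v w : E, differential E r x v = 0 → differential E r x (Complex.I • v) = 0 →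
        differential E r x w = 0 → differential E r x (Complex.I • w) = 0 →
        leviForm E r x v w = 0

/-- A real-analytic tubular neighbourhood `U` of the boundary `S` of a domain, with a real-analytic
diffeomorphism `φ = (base, height)` of `U` onto an open neighbourhood of the zero section (possibly
all) of the normal bundle of `S`, which identifies `S` with the zero section. A boundary hypersurface
is two-sided, so its normal bundle is trivial, and it is written here as `S × ℝ`. As `U` and `S × ℝ`
have the same dimension, `φ` is such a diffeomorphism if it is an injective real-analytic
immersion. -/
structure TubularNbhd (S : Set X) where
  /-- the neighbourhood `U` -/
  carrier : Set X
  /-- the component of `φ` in `S` -/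
  base : X → X
  /-- the component of `φ` in the fibre `ℝ` of the normal bundle -/
  height : X → ℝ
  isOpen : IsOpen carrier
  subset : S ⊆ carrier
  analytic_base : ContMDiffOn 𝓘(ℝ, E) 𝓘(ℝ, E) ω base carrier
  analytic_height : ContMDiffOn 𝓘(ℝ, E) 𝓘(ℝ, ℝ) ω height carrier
  mapsTo : MapsTo base carrier S
  zero_section : ∀ p ∈ S, base p = p ∧ height p = 0
  injOn : InjOn (fun p => (base p, height p)) carrier
  immersion : ∀ p ∈ carrier, ∀ v : E,
    mfderiv 𝓘(ℝ, E) 𝓘(ℝ, E) base p v = 0 → differential E height p v = 0 → v = 0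

variable {E}

namespace TubularNbhd

variable {S : Set X} (T : TubularNbhd E S)

/-- A section of the normal bundle is given by a function `σ` on `S` (the values of `σ` off `S` are
irrelevant). It is real-analytic if `σ ∘ base` is, because `base` is a real-analytic retraction. -/
def IsAnalyticSection (σ : X → ℝ) : Prop :=
  ContMDiffOn 𝓘(ℝ, E) 𝓘(ℝ, ℝ) ω (σ ∘ T.base) T.carrier

/-- The displacement of `S` given by a section `σ`: the set that `φ` identifies with the graph
of `σ` in the normal bundle. -/
def displacement (σ : X → ℝ) : Set X :=
  {p ∈ T.carrier | T.height p = σ (T.base p)}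

end TubularNbhd

variable (E) in
/-- A decomposition of a compact set `S` into finitely many compact pieces, each in the domain of a
chart of `X`. It serves to define a `C²`-norm for functions on `S`; all these norms are
equivalent. -/
structure ChartCover (S : Set X) where
  /-- the centres of the charts -/
  centers : Finset X
  /-- the pieces -/
  piece : X → Set X
  isCompact_piece : ∀ a ∈ centers, IsCompact (piece a)
  piece_subset : ∀ a ∈ centers, piece a ⊆ (chartAt E a).source
  iUnion_piece : ⋃ a ∈ centers, piece a = S

/-- The `C²`-norm on `S` of the section `σ` of the normal bundle is less than `δ`. The derivatives
up to order two are those of the extension `σ ∘ base` of `σ` to a neighbourhood of `S`, in the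
charts of the cover. -/
def TubularNbhd.C2NormLT {S : Set X} (T : TubularNbhd E S) (A : ChartCover E S) (σ : X → ℝ)
    (δ : ℝ) : Prop :=
  ∀ a ∈ A.centers, ∀ x ∈ A.piece a,
    |σ x| < δ ∧
    ‖fderiv ℝ ((σ ∘ T.base) ∘ (chartAt E a).symm) (chartAt E a x)‖ < δ ∧
    ‖secondDerivative E a (σ ∘ T.base) x‖ < δ

end ComplexManifold

/-! Let `ρ` be a real-analytic defining function of the Levi-flat hypersurface `S`, negative inside,
in flat coordinates `(z, ζ)`, and let `v = ρ_ζ ∂_z - ρ_z ∂_ζ` span the complex tangent spaces of its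
level sets. The Levi form of `-log(-ρ)` is large transversally to `S`. In the direction `v` it is
`-L_ρ(v,v)/ρ`, which stays bounded because `L_ρ(v,v)` vanishes on `S`; its limit is `-b`, where
`d(L_ρ(v,v)) = b dρ` on `S`. Differentiating `L_ρ(v,v) = 0` across `S` gives (`levi_flat_identity`)
`(L_{log|ρ_ζ|}(v,v) - b) |ρ_ζ|² = |L_ρ(v, ∂_ζ)|²`. Hence, after adding `log|ρ_ζ|`, the limit at `S`
of the rescaled Levi determinant is exactly `0`. If a function `g` with `L_g(v,v) > 0` is also
added, the limit becomes `L_g(v,v) |ρ_ζ|² > 0`, and the Levi form of `g + log|ρ_ζ| - log(-ρ)` is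
bounded below by a positive multiple of the Euclidean metric (`levi_lower_bound`).

The harmonic section supplies `g`. For a harmonic map `h` into the disc and fixed `|ζ| = 1`, the
function `-log` of the Poisson kernel `p(h(z), ζ)` has a Levi form in `z` of at least `(|h_z| -
|h_z̄|)² / (1 - |h|²)²`. It is nonnegative, and positive where `dh` is onto (`leviE_poisson_lower`).
The finitely many critical points are repaired by a small function `ψ` on the base that is strictly
subharmonic there, so `g = -log p + ψ` is strictly plurisubharmonic along the leaves `ζ = const` of
`∂D` (`exists_logWeight_pos`). This is an open condition on the point and on `dρ`, so it persists
for all small displacements (`eventually_isAdapted`).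

The function whose `-log(-·)` has this form is `p e^{-ψ} ρ / |ρ_ζ|`. Neither `p` nor `|ρ_ζ|` is
globally defined, but a disc automorphism multiplies both by the same factor, so their quotient is
global (`fibreWeight_eq`). The remaining work is to see `S` as the boundary of a domain
(`exists_displaced_domain`), to extend the defining function to `P`, and to convert the lower bound
into eigenvalues with respect to a Hermitian metric scaled by a small constant
(`isTakeuchiConvex_one_of_local`). -/

/-! ### Wirtinger calculus and the Levi form on a complex vector space. -/

section Wirtinger

variable {E F : Type*} [NormedAddCommGroup E] [NormedSpace ℂ E] [NormedAddCommGroup F]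
  [NormedSpace ℂ F]

/-- The Wirtinger derivative `∂_u f`, complex linear in the direction `u`. -/
noncomputable def dz (u : E) (f : E → ℂ) (x : E) : ℂ :=
  (fderiv ℝ f x u - Complex.I * fderiv ℝ f x (Complex.I • u)) / 2

/-- The Wirtinger derivative `∂̄_u f`, conjugate linear in the direction `u`. -/
noncomputable def dzb (u : E) (f : E → ℂ) (x : E) : ℂ :=
  (fderiv ℝ f x u + Complex.I * fderiv ℝ f x (Complex.I • u)) / 2

/-- The Levi form of a real function on a complex vector space. -/
noncomputable def leviE (f : E → ℝ) (x : E) (v w : E) : ℂ :=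
  let b := fderiv ℝ (fderiv ℝ f) x
  (((b v w + b (Complex.I • v) (Complex.I • w) : ℝ) : ℂ) +
    ((b (Complex.I • v) w - b v (Complex.I • w) : ℝ) : ℂ) * Complex.I) / 4

lemma leviForm_eq_leviE {X : Type*} [TopologicalSpace X] [ChartedSpace E X] (f : X → ℝ) (x : X) :
    leviForm E f x = leviE (f ∘ (chartAt E x).symm) (chartAt E x x) := rfl

variable {f g : E → ℂ} {x u v w : E}

lemma fderiv_decomp (f : E → ℂ) (x u : E) : fderiv ℝ f x u = dz u f x + dzb u f x := by
  simp only [dz, dzb]; ring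

lemma smul_eq_re_im (c : ℂ) (u : E) : c • u = c.re • u + c.im • (Complex.I • u) := by
  conv_lhs => rw [← Complex.re_add_im c, add_smul, mul_smul]
  simp [Complex.coe_smul]

lemma dz_smul (c : ℂ) (u : E) (f : E → ℂ) (x : E) : dz (c • u) f x = c * dz u f x := by
  have h1 : Complex.I • c • u = (-c.im) • u + c.re • (Complex.I • u) := by
    rw [smul_smul, smul_eq_re_im]; simp
  simp only [dz]
  rw [h1, smul_eq_re_im c u]
  simp only [map_add, map_smul, Complex.real_smul]
  conv_rhs => rw [← Complex.re_add_im c]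
  push_cast
  linear_combination (fderiv ℝ f x (Complex.I • u) * c.im / 2) * Complex.I_sq

lemma dz_add_dir (u v : E) (f : E → ℂ) (x : E) : dz (u + v) f x = dz u f x + dz v f x := by
  simp only [dz, smul_add, map_add]; ring

lemma dzb_smul (c : ℂ) (u : E) (f : E → ℂ) (x : E) :
    dzb (c • u) f x = (starRingEnd ℂ) c * dzb u f x := by
  have h1 : Complex.I • c • u = (-c.im) • u + c.re • (Complex.I • u) := by
    rw [smul_smul, smul_eq_re_im]; simp
  simp only [dzb]
  rw [h1, smul_eq_re_im c u]
  simp only [map_add, map_smul, Complex.real_smul]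
  have h2 : (starRingEnd ℂ) c = c.re - c.im * Complex.I := by
    apply Complex.ext <;> simp
  rw [h2]
  push_cast
  linear_combination (fderiv ℝ f x (Complex.I • u) * c.im / 2) * Complex.I_sq

lemma dz_add (hf : DifferentiableAt ℝ f x) (hg : DifferentiableAt ℝ g x) (u : E) :
    dz u (fun y => f y + g y) x = dz u f x + dz u g x := by
  simp only [dz]; rw [fderiv_fun_add hf hg]; simp; ring

lemma dz_sub (hf : DifferentiableAt ℝ f x) (hg : DifferentiableAt ℝ g x) (u : E) :
    dz u (fun y => f y - g y) x = dz u f x - dz u g x := by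
  simp only [dz]; rw [fderiv_fun_sub hf hg]; simp; ring

lemma dzb_sub (hf : DifferentiableAt ℝ f x) (hg : DifferentiableAt ℝ g x) (u : E) :
    dzb u (fun y => f y - g y) x = dzb u f x - dzb u g x := by
  simp only [dzb]; rw [fderiv_fun_sub hf hg]; simp; ring

lemma dz_mul (hf : DifferentiableAt ℝ f x) (hg : DifferentiableAt ℝ g x) (u : E) :
    dz u (fun y => f y * g y) x = f x * dz u g x + g x * dz u f x := by
  simp only [dz]; rw [fderiv_fun_mul hf hg]; simp; ring

lemma dzb_mul (hf : DifferentiableAt ℝ f x) (hg : DifferentiableAt ℝ g x) (u : E) :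
    dzb u (fun y => f y * g y) x = f x * dzb u g x + g x * dzb u f x := by
  simp only [dzb]; rw [fderiv_fun_mul hf hg]; simp; ring

lemma dz_const (c : ℂ) (u x : E) : dz u (fun _ => c) x = 0 := by simp [dz]

lemma dzb_const (c : ℂ) (u x : E) : dzb u (fun _ => c) x = 0 := by simp [dzb]

lemma dz_conj (u : E) (f : E → ℂ) (x : E) :
    dz u (fun y => (starRingEnd ℂ) (f y)) x = (starRingEnd ℂ) (dzb u f x) := by
  have : fderiv ℝ (fun y => (starRingEnd ℂ) (f y)) x
      = (Complex.conjCLE : ℂ →L[ℝ] ℂ).comp (fderiv ℝ f x) := by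
    exact Complex.conjCLE.comp_fderiv (f := f) (x := x)
  have h2 : (starRingEnd ℂ) (2 : ℂ) = 2 := Complex.conj_ofNat 2
  simp only [dz, dzb, this]
  simp [sub_eq_add_neg, h2]

lemma dzb_conj (u : E) (f : E → ℂ) (x : E) :
    dzb u (fun y => (starRingEnd ℂ) (f y)) x = (starRingEnd ℂ) (dz u f x) := by
  have : fderiv ℝ (fun y => (starRingEnd ℂ) (f y)) x
      = (Complex.conjCLE : ℂ →L[ℝ] ℂ).comp (fderiv ℝ f x) := by
    exact Complex.conjCLE.comp_fderiv (f := f) (x := x)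
  have h2 : (starRingEnd ℂ) (2 : ℂ) = 2 := Complex.conj_ofNat 2
  simp only [dz, dzb, this]
  simp [sub_eq_add_neg, h2]

lemma dz_congr {f g : E → ℂ} (h : f =ᶠ[𝓝 x] g) (u : E) : dz u f x = dz u g x := by
  simp only [dz, h.fderiv_eq]

lemma fderiv_ofReal {f : E → ℝ} (hf : DifferentiableAt ℝ f x) (u : E) :
    fderiv ℝ (fun y => (f y : ℂ)) x u = (fderiv ℝ f x u : ℂ) := by
  have := (Complex.ofRealCLM.hasFDerivAt.comp x hf.hasFDerivAt).fderiv
  simp only [Function.comp_def, Complex.ofRealCLM_apply] at this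
  rw [this]; simp

lemma conj_dz_ofReal (f : E → ℝ) (u x : E) :
    (starRingEnd ℂ) (dz u (fun y => (f y : ℂ)) x) = dzb u (fun y => (f y : ℂ)) x := by
  rw [← dzb_conj]; simp

lemma conj_dzb_ofReal (f : E → ℝ) (u x : E) :
    (starRingEnd ℂ) (dzb u (fun y => (f y : ℂ)) x) = dz u (fun y => (f y : ℂ)) x := by
  rw [← dz_conj]; simp

lemma ContDiffAt.fderiv_apply_const {n m : WithTop ℕ∞} {G : Type*} [NormedAddCommGroup G]
    [NormedSpace ℝ G] {f : E → G} (hf : ContDiffAt ℝ n f x) (h : m + 1 ≤ n) (u : E) :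
    ContDiffAt ℝ m (fun y => fderiv ℝ f y u) x :=
  (hf.fderiv_right h).clm_apply contDiffAt_const

lemma ContDiffAt.dz {n m : WithTop ℕ∞} (hf : ContDiffAt ℝ n f x) (h : m + 1 ≤ n) (u : E) :
    ContDiffAt ℝ m (dz u f) x :=
  ((hf.fderiv_apply_const h u).sub (contDiffAt_const.mul (hf.fderiv_apply_const h _))).div_const 2

lemma ContDiffAt.dzb {n m : WithTop ℕ∞} (hf : ContDiffAt ℝ n f x) (h : m + 1 ≤ n) (u : E) :
    ContDiffAt ℝ m (dzb u f) x :=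
  ((hf.fderiv_apply_const h u).add (contDiffAt_const.mul (hf.fderiv_apply_const h _))).div_const 2

lemma ContDiffAt.ofReal {n : WithTop ℕ∞} {f : E → ℝ} (hf : ContDiffAt ℝ n f x) :
    ContDiffAt ℝ n (fun y => (f y : ℂ)) x :=
  Complex.ofRealCLM.contDiff.contDiffAt.comp x hf

lemma ContDiffAt.conj {n : WithTop ℕ∞} (hf : ContDiffAt ℝ n f x) :
    ContDiffAt ℝ n (fun y => (starRingEnd ℂ) (f y)) x :=
  Complex.conjCLE.contDiff.contDiffAt.comp x hf

lemma fderiv_fderiv_apply {G : Type*} [NormedAddCommGroup G] [NormedSpace ℝ G] {f : E → G}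
    (hf : ContDiffAt ℝ 2 f x) (u v : E) :
    fderiv ℝ (fun y => fderiv ℝ f y u) x v = fderiv ℝ (fderiv ℝ f) x v u := by
  have h1 : DifferentiableAt ℝ (fderiv ℝ f) x :=
    (hf.fderiv_right (m := 1) (by norm_num)).differentiableAt (by norm_num)
  rw [fderiv_clm_apply h1 (by fun_prop)]
  simp

lemma second_symm {G : Type*} [NormedAddCommGroup G] [NormedSpace ℝ G] {f : E → G}
    (hf : ContDiffAt ℝ 2 f x) (u v : E) :
    fderiv ℝ (fderiv ℝ f) x u v = fderiv ℝ (fderiv ℝ f) x v u :=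
  (hf.isSymmSndFDerivAt (by simp)) u v

lemma fderiv_dzb (hf : ContDiffAt ℝ 2 f x) (u v : E) :
    fderiv ℝ (dzb u f) x v = (fderiv ℝ (fderiv ℝ f) x v u
      + Complex.I * fderiv ℝ (fderiv ℝ f) x v (Complex.I • u)) / 2 := by
  have h (u) : DifferentiableAt ℝ (fun y => fderiv ℝ f y u) x :=
    (hf.fderiv_apply_const (m := 1) (by norm_num) u).differentiableAt (by norm_num)
  have : dzb u f = fun y => (2 : ℂ)⁻¹ * (fderiv ℝ f y u + Complex.I * fderiv ℝ f y (Complex.I • u)) := by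
    ext y; simp only [dzb]; ring
  rw [this, fderiv_const_mul ((h _).fun_add ((h _).const_mul _)),
    fderiv_fun_add (h _) ((h _).const_mul _), fderiv_const_mul (h _)]
  simp only [_root_.smul_apply, _root_.add_apply, smul_eq_mul,
    fderiv_fderiv_apply hf]
  ring

lemma fderiv_dz (hf : ContDiffAt ℝ 2 f x) (u v : E) :
    fderiv ℝ (dz u f) x v = (fderiv ℝ (fderiv ℝ f) x v u
      - Complex.I * fderiv ℝ (fderiv ℝ f) x v (Complex.I • u)) / 2 := by
  have h (u) : DifferentiableAt ℝ (fun y => fderiv ℝ f y u) x :=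
    (hf.fderiv_apply_const (m := 1) (by norm_num) u).differentiableAt (by norm_num)
  have : dz u f = fun y => (2 : ℂ)⁻¹ * (fderiv ℝ f y u - Complex.I * fderiv ℝ f y (Complex.I • u)) := by
    ext y; simp only [dz]; ring
  rw [this, fderiv_const_mul ((h _).fun_sub ((h _).const_mul _)),
    fderiv_fun_sub (h _) ((h _).const_mul _), fderiv_const_mul (h _)]
  simp only [_root_.smul_apply, _root_.sub_apply, smul_eq_mul,
    fderiv_fderiv_apply hf]
  ring

lemma dz_dzb_comm (hf : ContDiffAt ℝ 2 f x) (u v : E) :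
    dz u (dzb v f) x = dzb v (dz u f) x := by
  rw [dz.eq_1 u (dzb v f), dzb.eq_1 v (dz u f)]
  simp only [fderiv_dzb hf, fderiv_dz hf]
  rw [second_symm hf v u, second_symm hf (Complex.I • v) u, second_symm hf v (Complex.I • u),
    second_symm hf (Complex.I • v) (Complex.I • u)]
  ring

lemma dz_dz_comm (hf : ContDiffAt ℝ 2 f x) (u v : E) :
    dz u (dz v f) x = dz v (dz u f) x := by
  rw [dz.eq_1 u (dz v f), dz.eq_1 v (dz u f)]
  simp only [fderiv_dz hf]
  rw [second_symm hf v u, second_symm hf (Complex.I • v) u, second_symm hf v (Complex.I • u),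
    second_symm hf (Complex.I • v) (Complex.I • u)]
  ring

lemma fderiv_fderiv_ofReal {f : E → ℝ} (hf : ContDiffAt ℝ 2 f x) (u v : E) :
    fderiv ℝ (fderiv ℝ (fun y => (f y : ℂ))) x u v = (fderiv ℝ (fderiv ℝ f) x u v : ℂ) := by
  rw [← fderiv_fderiv_apply hf.ofReal, ← fderiv_fderiv_apply hf]
  have h1 : (fun y => fderiv ℝ (fun y => (f y : ℂ)) y v) =ᶠ[𝓝 x] fun y => (fderiv ℝ f y v : ℂ) := by
    filter_upwards [hf.eventually (by simp)] with y hy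
    exact fderiv_ofReal (hy.differentiableAt (by norm_num)) v
  rw [h1.fderiv_eq, fderiv_ofReal]
  exact (hf.fderiv_apply_const (m := 1) (by norm_num) v).differentiableAt (by norm_num)

/-- This form of the Levi form makes it computable by the product and quotient rules for `dz` and
`dzb`, instead of through the real Hessian. -/
lemma leviE_eq_dz_dzb {f : E → ℝ} (hf : ContDiffAt ℝ 2 f x) (v w : E) :
    leviE f x v w = dz w (dzb v (fun y => (f y : ℂ))) x := by
  rw [dz]
  simp only [fderiv_dzb hf.ofReal, fderiv_fderiv_ofReal hf]
  simp only [leviE]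
  rw [second_symm hf w v, second_symm hf w (Complex.I • v), second_symm hf (Complex.I • w) v,
    second_symm hf (Complex.I • w) (Complex.I • v)]
  push_cast
  linear_combination ((1 / 4) * (fderiv ℝ (fderiv ℝ f) x (Complex.I • v) (Complex.I • w) : ℂ))
    * Complex.I_sq

lemma leviE_congr {f g : E → ℝ} (h : f =ᶠ[𝓝 x] g) : leviE f x = leviE g x := by
  ext v w
  simp only [leviE, h.fderiv.fderiv_eq]

lemma leviE_add_left (f : E → ℝ) (x u v w : E) :
    leviE f x (u + v) w = leviE f x u w + leviE f x v w := by
  simp only [leviE, smul_add, map_add, _root_.add_apply]; push_cast; ring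

lemma leviE_add_right (f : E → ℝ) (x u v w : E) :
    leviE f x u (v + w) = leviE f x u v + leviE f x u w := by
  simp only [leviE, smul_add, map_add]; push_cast; ring

lemma leviE_smul_right (f : E → ℝ) (x u v : E) (c : ℂ) :
    leviE f x u (c • v) = c * leviE f x u v := by
  have h1 : Complex.I • c • v = (-c.im) • v + c.re • (Complex.I • v) := by
    rw [smul_smul, smul_eq_re_im]; simp
  simp only [leviE]
  rw [h1, smul_eq_re_im c v]
  simp only [map_add, map_smul, smul_eq_mul]
  conv_rhs => rw [← Complex.re_add_im c]
  push_cast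
  ring_nf
  simp only [Complex.I_sq]
  ring

lemma leviE_smul_left (f : E → ℝ) (x u v : E) (c : ℂ) :
    leviE f x (c • u) v = (starRingEnd ℂ) c * leviE f x u v := by
  have h1 : Complex.I • c • u = (-c.im) • u + c.re • (Complex.I • u) := by
    rw [smul_smul, smul_eq_re_im]; simp
  have h2 : (starRingEnd ℂ) c = c.re - c.im * Complex.I := by
    apply Complex.ext <;> simp
  simp only [leviE]
  rw [h1, smul_eq_re_im c u, h2]
  simp only [map_add, map_smul, smul_eq_mul, _root_.add_apply,
    _root_.smul_apply]
  push_cast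
  ring_nf
  simp only [Complex.I_sq]
  ring

lemma leviE_conj {f : E → ℝ} (hf : ContDiffAt ℝ 2 f x) (u v : E) :
    (starRingEnd ℂ) (leviE f x u v) = leviE f x v u := by
  simp only [leviE]
  rw [second_symm hf v u, second_symm hf (Complex.I • v) u, second_symm hf v (Complex.I • u),
    second_symm hf (Complex.I • v) (Complex.I • u)]
  simp only [map_div₀, map_add, map_mul, Complex.conj_ofReal, Complex.conj_I]
  have : (starRingEnd ℂ) 4 = 4 := Complex.conj_ofNat 4
  rw [this]; push_cast; ring

lemma leviE_self_im {f : E → ℝ} (hf : ContDiffAt ℝ 2 f x) (u : E) :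
    ((leviE f x u u).re : ℂ) = leviE f x u u :=
  Complex.conj_eq_iff_re.mp (leviE_conj hf u u)

lemma leviE_add {f g : E → ℝ} (hf : ContDiffAt ℝ 2 f x) (hg : ContDiffAt ℝ 2 g x) (v w : E) :
    leviE (fun y => f y + g y) x v w = leviE f x v w + leviE g x v w := by
  have h1 : fderiv ℝ (fun y => f y + g y) =ᶠ[𝓝 x] fun y => fderiv ℝ f y + fderiv ℝ g y := by
    filter_upwards [hf.eventually (by simp), hg.eventually (by simp)] with y hy hy'
    exact fderiv_fun_add (hy.differentiableAt (by norm_num)) (hy'.differentiableAt (by norm_num))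
  have hf' : DifferentiableAt ℝ (fderiv ℝ f) x :=
    (hf.fderiv_right (m := 1) (by norm_num)).differentiableAt (by norm_num)
  have hg' : DifferentiableAt ℝ (fderiv ℝ g) x :=
    (hg.fderiv_right (m := 1) (by norm_num)).differentiableAt (by norm_num)
  simp only [leviE]
  rw [h1.fderiv_eq, fderiv_fun_add hf' hg']
  simp only [_root_.add_apply]
  push_cast; ring

lemma leviE_const_mul {f : E → ℝ} (c : ℝ) (hf : ContDiffAt ℝ 2 f x) (v w : E) :
    leviE (fun y => c * f y) x v w = c * leviE f x v w := by
  have h1 : fderiv ℝ (fun y => c * f y) =ᶠ[𝓝 x] fun y => c • fderiv ℝ f y := by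
    filter_upwards [hf.eventually (by simp)] with y hy
    exact fderiv_const_mul (hy.differentiableAt (by norm_num)) c
  have hf' : DifferentiableAt ℝ (fderiv ℝ f) x :=
    (hf.fderiv_right (m := 1) (by norm_num)).differentiableAt (by norm_num)
  simp only [leviE]
  rw [h1.fderiv_eq, fderiv_fun_const_smul hf']
  simp only [_root_.smul_apply, smul_eq_mul]
  push_cast; ring

/-- The Levi form depends continuously on the point. -/
lemma continuousAt_leviE {f : E → ℝ} (hf : ContDiffAt ℝ 2 f x) {v w : E → E}
    (hv : ContinuousAt v x) (hw : ContinuousAt w x) :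
    ContinuousAt (fun y => leviE f y (v y) (w y)) x := by
  have h : ContinuousAt (fderiv ℝ (fderiv ℝ f)) x :=
    ((hf.fderiv_right (m := 1) (by norm_num)).fderiv_right (m := 0) (by norm_num)).continuousAt
  have key {a b : E → E} (ha : ContinuousAt a x) (hb : ContinuousAt b x) :
      ContinuousAt (fun y => fderiv ℝ (fderiv ℝ f) y (a y) (b y)) x :=
    (h.clm_apply ha).clm_apply hb
  have hv' : ContinuousAt (fun y => Complex.I • v y) x := hv.const_smul _
  have hw' : ContinuousAt (fun y => Complex.I • w y) x := hw.const_smul _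
  simp only [leviE]
  exact ((Complex.continuous_ofReal.continuousAt.comp ((key hv hw).add (key hv' hw'))).add
    ((Complex.continuous_ofReal.continuousAt.comp ((key hv' hw).sub (key hv hw'))).mul
      continuousAt_const)).div_const 4

/-- The Levi form is invariant under holomorphic maps. -/
lemma leviE_comp {Ψ : E → F} {f : F → ℝ} (hΨ : ContDiffAt ℂ 2 Ψ x)
    (hf : ContDiffAt ℝ 2 f (Ψ x)) (v w : E) :
    leviE (f ∘ Ψ) x v w = leviE f (Ψ x) (fderiv ℂ Ψ x v) (fderiv ℂ Ψ x w) := by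
  have hΨd : ∀ᶠ y in 𝓝 x, DifferentiableAt ℂ Ψ y := by
    filter_upwards [hΨ.eventually (by simp)] with y hy using hy.differentiableAt (by norm_num)
  have hΨc : ContinuousAt Ψ x := hΨ.continuousAt
  have h1 : fderiv ℝ (f ∘ Ψ) =ᶠ[𝓝 x]
      fun y => (fderiv ℝ f (Ψ y)).comp ((fderiv ℂ Ψ y).restrictScalars ℝ) := by
    filter_upwards [hΨd, hΨc.eventually (hf.eventually (by simp))] with y hy hy'
    have hy' : ContDiffAt ℝ 2 f (Ψ y) := hy'
    exact ((hy'.differentiableAt (by norm_num)).hasFDerivAt.comp y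
      (hy.hasFDerivAt.restrictScalars ℝ)).fderiv
  have hD : DifferentiableAt ℝ (fun y => fderiv ℝ f (Ψ y)) x :=
    ((hf.fderiv_right (m := 1) (by norm_num)).differentiableAt (by norm_num)).comp x
      ((hΨ.differentiableAt (by norm_num)).restrictScalars ℝ)
  have hΨ' : DifferentiableAt ℂ (fderiv ℂ Ψ) x :=
    (hΨ.fderiv_right (m := 1) (by norm_num)).differentiableAt (by norm_num)
  have key (a b : E) : fderiv ℝ (fderiv ℝ (f ∘ Ψ)) x a b =
      fderiv ℝ (fderiv ℝ f) (Ψ x) (fderiv ℂ Ψ x a) (fderiv ℂ Ψ x b)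
        + fderiv ℝ f (Ψ x) (fderiv ℂ (fderiv ℂ Ψ) x a b) := by
    rw [h1.fderiv_eq]
    have h2 : HasFDerivAt (fun y => (fderiv ℂ Ψ y b))
        ((ContinuousLinearMap.apply ℂ F b).comp (fderiv ℂ (fderiv ℂ Ψ) x)) x :=
      (ContinuousLinearMap.apply ℂ F b).hasFDerivAt.comp x hΨ'.hasFDerivAt
    have h3 := h2.restrictScalars ℝ
    have hR : DifferentiableAt ℝ (fun y => (fderiv ℂ Ψ y).restrictScalars ℝ) x :=
      ((ContinuousLinearMap.restrictScalarsL ℂ E F ℝ ℝ).differentiableAt).comp x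
        (hΨ'.restrictScalars ℝ)
    have h4 : fderiv ℝ (fun y => (fderiv ℝ f (Ψ y)).comp ((fderiv ℂ Ψ y).restrictScalars ℝ)) x a b
        = fderiv ℝ (fun y => (fderiv ℝ f (Ψ y)) (fderiv ℂ Ψ y b)) x a := by
      have hc := (hD.clm_comp hR)
      have := ((ContinuousLinearMap.apply ℝ ℝ b).hasFDerivAt.comp x hc.hasFDerivAt).fderiv
      simp only [Function.comp_def, ContinuousLinearMap.apply_apply, ContinuousLinearMap.comp_apply,
        ContinuousLinearMap.coe_restrictScalars'] at this
      rw [this]; rfl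
    rw [h4, fderiv_clm_apply hD h3.differentiableAt, h3.fderiv]
    have h5 : fderiv ℝ (fun y => fderiv ℝ f (Ψ y)) x a
        = fderiv ℝ (fderiv ℝ f) (Ψ x) (fderiv ℂ Ψ x a) := by
      have := (((hf.fderiv_right (m := 1) (by norm_num)).differentiableAt
        (by norm_num)).hasFDerivAt.comp x
        ((hΨ.differentiableAt (by norm_num)).hasFDerivAt.restrictScalars ℝ)).fderiv
      simp only [Function.comp_def] at this
      rw [this]; rfl
    simp only [_root_.add_apply, ContinuousLinearMap.comp_apply,
      ContinuousLinearMap.flip_apply, h5]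
    simp only [ContinuousLinearMap.coe_restrictScalars', ContinuousLinearMap.comp_apply,
      ContinuousLinearMap.apply_apply]
    ring
  -- The chain rule produces an extra term `df(D²Ψ(v,w))`. As `D²Ψ` is complex bilinear, `D²Ψ(iv,iw)
  -- = -D²Ψ(v,w)` and `D²Ψ(iv,w) = D²Ψ(v,iw)`, so these terms cancel.
  simp only [leviE, key, map_smul, _root_.smul_apply, smul_smul, Complex.I_mul_I,
    neg_smul, one_smul, map_neg]
  push_cast
  ring

end Wirtinger

/-! ### The Levi form of `-log(-ρ)` near a Levi-flat hypersurface `ρ = 0`. -/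

section Core

variable {E : Type*} [NormedAddCommGroup E] [NormedSpace ℂ E]

/-- Two `C¹` functions, the first of which vanishes on the regular zero set of the second: their
quotient extends continuously. -/
lemma tendsto_div_of_vanish_on_zero {B ρ : E → ℝ} {p X : E}
    (hB : ContDiffAt ℝ 1 B p) (hρ : ContDiffAt ℝ 1 ρ p) (h0 : ρ p = 0)
    (hX : fderiv ℝ ρ p X ≠ 0) (hv : ∀ᶠ y in 𝓝 p, ρ y = 0 → B y = 0) :
    Tendsto (fun y => B y / ρ y) (𝓝[{y | ρ y ≠ 0}] p) (𝓝 (fderiv ℝ B p X / fderiv ℝ ρ p X)) := by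
  -- Replacing `X` by `-X` does not change the quotient of the derivatives.
  wlog hpos : 0 < fderiv ℝ ρ p X generalizing X
  · have := this (X := -X) (by simpa using hX)
      (by rw [map_neg]; exact neg_pos.2 (lt_of_le_of_ne (not_lt.1 hpos) hX))
    simpa using this
  set d := fderiv ℝ ρ p X with hd
  have cB : ContinuousAt (fun y => fderiv ℝ B y X) p :=
    (hB.fderiv_right (m := 0) (by norm_num)).continuousAt.clm_apply continuousAt_const
  have cρ : ContinuousAt (fun y => fderiv ℝ ρ y X) p :=
    (hρ.fderiv_right (m := 0) (by norm_num)).continuousAt.clm_apply continuousAt_const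
  rw [Metric.tendsto_nhds]
  intro ε hε
  have c1 : ∀ᶠ y in 𝓝 p, dist (fderiv ℝ B y X / fderiv ℝ ρ y X) (fderiv ℝ B p X / d) < ε :=
    (cB.div cρ hX).eventually (Metric.ball_mem_nhds _ hε)
  have c2 : ∀ᶠ y in 𝓝 p, d / 2 < fderiv ℝ ρ y X :=
    cρ.eventually (lt_mem_nhds (show d / 2 < fderiv ℝ ρ p X by rw [← hd]; linarith))
  obtain ⟨R, hR, hball⟩ := Metric.eventually_nhds_iff_ball.1
    (c1.and (c2.and (hv.and ((hB.eventually (by simp)).and (hρ.eventually (by simp))))))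
  obtain ⟨δ, hδ, hδR⟩ : ∃ δ > 0, δ * ‖X‖ < R / 2 := by
    refine ⟨R / 2 / (‖X‖ + 1), by positivity, ?_⟩
    have : 0 ≤ ‖X‖ := norm_nonneg X
    rw [div_mul_eq_mul_div, div_lt_iff₀ (by positivity)]
    nlinarith
  -- Along `X` the function `ρ` grows at least at rate `d / 2`, so from such a `y` its zero set is
  -- reached within parameter distance `δ`.
  have hsmall : ∀ᶠ y in 𝓝 p, |ρ y| < δ * d / 2 := by
    have : Tendsto (fun y => |ρ y|) (𝓝 p) (𝓝 |ρ p|) := hρ.continuousAt.abs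
    rw [h0, abs_zero] at this
    exact this.eventually (gt_mem_nhds (by positivity))
  rw [eventually_nhdsWithin_iff]
  filter_upwards [hsmall, Metric.ball_mem_nhds p (half_pos hR)] with y hy hyR hne
  have hin : ∀ s ∈ Icc (-δ) δ, y + s • X ∈ Metric.ball p R := by
    intro s hs
    rw [mem_ball_iff_norm] at hyR ⊢
    have h1 : ‖s • X‖ ≤ δ * ‖X‖ := by
      rw [norm_smul]; gcongr; exact abs_le.2 hs
    calc ‖y + s • X - p‖ = ‖(y - p) + s • X‖ := by congr 1; abel
      _ ≤ ‖y - p‖ + ‖s • X‖ := norm_add_le _ _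
      _ < R := by linarith
  have hline (s : ℝ) : HasDerivAt (fun s : ℝ => y + s • X) X s := by
    simpa using ((hasDerivAt_id s).smul_const X).const_add y
  have dρ : ∀ s ∈ Icc (-δ) δ, HasDerivAt (fun s : ℝ => ρ (y + s • X))
      (fderiv ℝ ρ (y + s • X) X) s := fun s hs =>
    (((hball _ (hin s hs)).2.2.2.2.differentiableAt (by norm_num)).hasFDerivAt).comp_hasDerivAt s
      (hline s)
  have dB : ∀ s ∈ Icc (-δ) δ, HasDerivAt (fun s : ℝ => B (y + s • X))
      (fderiv ℝ B (y + s • X) X) s := fun s hs =>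
    (((hball _ (hin s hs)).2.2.2.1.differentiableAt (by norm_num)).hasFDerivAt).comp_hasDerivAt s
      (hline s)
  have hgrow : ∀ s ∈ Icc (-δ) δ, ∀ t ∈ Icc (-δ) δ, s ≤ t →
      d / 2 * (t - s) ≤ ρ (y + t • X) - ρ (y + s • X) := by
    intro s hs t ht hst
    refine (convex_Icc (-δ) δ).mul_sub_le_image_sub_of_le_deriv (f := fun s : ℝ => ρ (y + s • X))
      (fun u hu => (dρ u hu).continuousAt.continuousWithinAt) ?_ ?_ s hs t ht hst
    · exact fun u hu => (dρ u (interior_subset hu)).differentiableAt.differentiableWithinAt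
    · intro u hu
      have hu := interior_subset hu
      rw [(dρ u hu).deriv]
      exact (hball _ (hin u hu)).2.1.le
  have hm : (0 : ℝ) ∈ Icc (-δ) δ := ⟨by linarith, hδ.le⟩
  have hl : (-δ : ℝ) ∈ Icc (-δ) δ := ⟨le_refl _, by linarith⟩
  have hr : (δ : ℝ) ∈ Icc (-δ) δ := ⟨by linarith, le_refl _⟩
  have g1 := hgrow 0 hm δ hr hδ.le
  have g2 := hgrow _ hl 0 hm (by linarith)
  simp only [zero_smul, add_zero] at g1 g2
  rw [abs_lt] at hy
  obtain ⟨s, hs, hs0⟩ : ∃ s ∈ Icc (-δ) δ, ρ (y + s • X) = 0 := by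
    have := intermediate_value_Icc (a := -δ) (b := δ) (by linarith)
      (f := fun s : ℝ => ρ (y + s • X)) (fun u hu => (dρ u hu).continuousAt.continuousWithinAt)
    exact this ⟨by nlinarith, by nlinarith⟩
  have hsB : B (y + s • X) = 0 := (hball _ (hin s hs)).2.2.1 hs0
  have hsne : s ≠ 0 := by
    rintro rfl
    simp only [zero_smul, add_zero] at hs0
    exact hne hs0
  -- Both functions vanish at parameter `s`, so Cauchy's mean value theorem between `s` and `0`
  -- turns `B y / ρ y` into a quotient of derivatives at a nearby point.
  obtain ⟨c, hc, hcq⟩ : ∃ c ∈ Icc (-δ) δ,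
      B y * fderiv ℝ ρ (y + c • X) X = ρ y * fderiv ℝ B (y + c • X) X := by
    rcases lt_or_gt_of_ne hsne with h | h
    · have hsub : Icc s 0 ⊆ Icc (-δ) δ := Icc_subset_Icc hs.1 hδ.le
      obtain ⟨c, hc, h⟩ := exists_ratio_hasDerivAt_eq_ratio_slope (fun s : ℝ => B (y + s • X))
        (fun s => fderiv ℝ B (y + s • X) X) h
        (fun u hu => (dB u (hsub hu)).continuousAt.continuousWithinAt)
        (fun u hu => dB u (hsub (Ioo_subset_Icc_self hu)))
        (fun s : ℝ => ρ (y + s • X)) (fun s => fderiv ℝ ρ (y + s • X) X)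
        (fun u hu => (dρ u (hsub hu)).continuousAt.continuousWithinAt)
        (fun u hu => dρ u (hsub (Ioo_subset_Icc_self hu)))
      refine ⟨c, hsub (Ioo_subset_Icc_self hc), ?_⟩
      simp only [hs0, hsB, zero_smul, add_zero, sub_zero] at h
      linarith
    · have hsub : Icc 0 s ⊆ Icc (-δ) δ := Icc_subset_Icc (by linarith) hs.2
      obtain ⟨c, hc, h⟩ := exists_ratio_hasDerivAt_eq_ratio_slope (fun s : ℝ => B (y + s • X))
        (fun s => fderiv ℝ B (y + s • X) X) h
        (fun u hu => (dB u (hsub hu)).continuousAt.continuousWithinAt)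
        (fun u hu => dB u (hsub (Ioo_subset_Icc_self hu)))
        (fun s : ℝ => ρ (y + s • X)) (fun s => fderiv ℝ ρ (y + s • X) X)
        (fun u hu => (dρ u (hsub hu)).continuousAt.continuousWithinAt)
        (fun u hu => dρ u (hsub (Ioo_subset_Icc_self hu)))
      refine ⟨c, hsub (Ioo_subset_Icc_self hc), ?_⟩
      simp only [hs0, hsB, zero_smul, add_zero, zero_sub] at h
      linarith
  have hb := hball _ (hin c hc)
  have hne' : fderiv ℝ ρ (y + c • X) X ≠ 0 := by
    have := hb.2.1; intro h; rw [h] at this; linarith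
  have : B y / ρ y = fderiv ℝ B (y + c • X) X / fderiv ℝ ρ (y + c • X) X := by
    rw [div_eq_div_iff hne hne']; linarith
  rw [this]
  exact hb.1

/-- A `C¹` function that vanishes on the regular zero set of another one has proportional
differential there, and the factor is the limit of the quotient. -/
lemma exists_fderiv_eq_mul_of_vanish {B ρ : E → ℝ} {p : E}
    (hB : ContDiffAt ℝ 1 B p) (hρ : ContDiffAt ℝ 1 ρ p) (h0 : ρ p = 0)
    (hX : fderiv ℝ ρ p ≠ 0) (hv : ∀ᶠ y in 𝓝 p, ρ y = 0 → B y = 0) :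
    ∃ b : ℝ, (∀ u, fderiv ℝ B p u = b * fderiv ℝ ρ p u) ∧
      Tendsto (fun y => B y / ρ y) (𝓝[{y | ρ y ≠ 0}] p) (𝓝 b) := by
  obtain ⟨X, hX⟩ : ∃ X, fderiv ℝ ρ p X ≠ 0 := by
    by_contra! h; exact hX (ContinuousLinearMap.ext h)
  -- The zero set of `ρ` has no interior near `p`, because `ρ` has nonzero derivative along the line
  -- through `p` in direction `X`. Hence limits of the quotient are unique, and every transversal
  -- direction gives the same one.
  have hne : (𝓝[{y | ρ y ≠ 0}] p).NeBot := by
    rw [← mem_closure_iff_nhdsWithin_neBot]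
    have hline : HasDerivAt (fun s : ℝ => p + s • X) X 0 := by
      simpa using ((hasDerivAt_id (0 : ℝ)).smul_const X).const_add p
    have hd : HasDerivAt (fun s : ℝ => ρ (p + s • X)) (fderiv ℝ ρ p X) 0 := by
      have h1 : HasFDerivAt ρ (fderiv ℝ ρ p) (p + (0 : ℝ) • X) := by
        simpa using (hρ.differentiableAt (by norm_num)).hasFDerivAt
      exact h1.comp_hasDerivAt (0 : ℝ) hline
    have h1 := hd.eventually_ne hX (c := 0)
    have h2 : Tendsto (fun s : ℝ => p + s • X) (𝓝[≠] 0) (𝓝 p) := by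
      have := hline.continuousAt.tendsto
      simp only [zero_smul, add_zero] at this
      exact this.mono_left nhdsWithin_le_nhds
    exact mem_closure_of_tendsto h2 h1
  have T := tendsto_div_of_vanish_on_zero hB hρ h0 hX hv
  refine ⟨_, fun u => ?_, T⟩
  have main : ∀ u, fderiv ℝ ρ p u ≠ 0 →
      fderiv ℝ B p u = fderiv ℝ B p X / fderiv ℝ ρ p X * fderiv ℝ ρ p u := by
    intro u hu
    have := tendsto_nhds_unique (tendsto_div_of_vanish_on_zero hB hρ h0 hu hv) T
    field_simp at this ⊢
    linarith
  by_cases hu : fderiv ℝ ρ p u = 0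
  -- A direction in the kernel of `dρ` becomes transversal after adding `X`.
  · have := main (u + X) (by simpa [hu] using hX)
    rw [map_add, map_add, hu] at this
    field_simp at this
    rw [hu]
    have : fderiv ℝ B p u * fderiv ℝ ρ p X = 0 := by linarith
    simpa [hX] using this
  · exact main u hu

/-- A lower bound for a positive definite Hermitian form in two variables. -/
lemma hermitian_two_lower_bound {A N d t : ℝ} {M : ℂ} (hA : 0 < A) (hN : 0 < N) (hd : 0 < d)
    (hdet : d ≤ A * N - Complex.normSq M) (ht : A + N ≤ t) (α β : ℂ) :
    d / t * (Complex.normSq α + Complex.normSq β) ≤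
      A * Complex.normSq α + N * Complex.normSq β
        + 2 * ((starRingEnd ℂ) α * β * M).re := by
  have ht0 : 0 < t := by linarith
  set l := d / t with hl
  have hl0 : 0 < l := by positivity
  have hlt : l * t = d := by rw [hl]; field_simp
  have hM0 : 0 ≤ Complex.normSq M := Complex.normSq_nonneg M
  have hAl : 0 < A - l := by
    have : l * (A + N) ≤ A * N := by nlinarith
    nlinarith
  -- As `l (A + N) ≤ l t = d`, subtracting `l` from both diagonal entries lowers the determinant by
  -- at most `d`, so the form stays nonnegative. The rest is completing the square.
  have hkey : Complex.normSq M ≤ (A - l) * (N - l) := by nlinarith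
  have h1 : 0 ≤ Complex.normSq ((A - l : ℝ) * α + (starRingEnd ℂ) ((starRingEnd ℂ) β * (starRingEnd ℂ) M)) :=
    Complex.normSq_nonneg _
  have h2 : Complex.normSq ((A - l : ℝ) * α + (starRingEnd ℂ) ((starRingEnd ℂ) β * (starRingEnd ℂ) M))
      = (A - l) ^ 2 * Complex.normSq α + Complex.normSq β * Complex.normSq M
        + 2 * (A - l) * ((starRingEnd ℂ) α * β * M).re := by
    simp [Complex.normSq_apply]; ring
  rw [h2] at h1
  have h3 := mul_le_mul_of_nonneg_left hkey (Complex.normSq_nonneg β)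
  have h4 : 0 ≤ (A - l) * ((A - l) * Complex.normSq α + (N - l) * Complex.normSq β
      + 2 * ((starRingEnd ℂ) α * β * M).re) := by nlinarith
  have h5 := nonneg_of_mul_nonneg_right h4 hAl
  linarith

lemma dz_inv {f : E → ℂ} {x : E} (hf : DifferentiableAt ℝ f x) (h : f x ≠ 0) (u : E) :
    dz u (fun y => (f y)⁻¹) x = - dz u f x / f x ^ 2 := by
  have h1 : HasFDerivAt (fun y => (f y)⁻¹) (-(f x ^ 2)⁻¹ • fderiv ℝ f x) x := by
    have := (hasDerivAt_inv h).hasFDerivAt.restrictScalars ℝ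
    have := this.comp x hf.hasFDerivAt
    refine (this.congr_fderiv ?_ : _)
    ext u; simp; ring
  simp only [dz, h1.fderiv]
  simp; ring

lemma dz_div {f g : E → ℂ} {x : E} (hf : DifferentiableAt ℝ f x) (hg : DifferentiableAt ℝ g x)
    (h : g x ≠ 0) (u : E) :
    dz u (fun y => f y / g y) x = dz u f x / g x - f x * dz u g x / g x ^ 2 := by
  have h1 : DifferentiableAt ℝ (fun y => (g y)⁻¹) x := hg.inv h
  simp only [div_eq_mul_inv]
  rw [dz_mul hf h1, dz_inv hg h]
  field_simp
  ring

lemma dzb_log {f : E → ℝ} {x : E} (hf : DifferentiableAt ℝ f x) (h : f x ≠ 0) (u : E) :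
    dzb u (fun y => (Real.log (f y) : ℂ)) x = dzb u (fun y => (f y : ℂ)) x / f x := by
  have hl : DifferentiableAt ℝ (fun y => Real.log (f y)) x := hf.log h
  simp only [dzb]
  rw [fderiv_ofReal hl, fderiv_ofReal hl, fderiv_ofReal hf, fderiv_ofReal hf, fderiv.log hf h]
  simp only [_root_.smul_apply, smul_eq_mul]
  push_cast
  field_simp

lemma leviE_log {f : E → ℝ} {x : E} (hf : ContDiffAt ℝ 2 f x) (h : f x ≠ 0) (v w : E) :
    leviE (fun y => Real.log (f y)) x v w = leviE f x v w / f x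
      - dzb v (fun y => (f y : ℂ)) x * dz w (fun y => (f y : ℂ)) x / (f x : ℂ) ^ 2 := by
  have hl : ContDiffAt ℝ 2 (fun y => Real.log (f y)) x := hf.log h
  rw [leviE_eq_dz_dzb hl, leviE_eq_dz_dzb hf]
  have h1 : dzb v (fun y => (Real.log (f y) : ℂ)) =ᶠ[𝓝 x]
      fun y => dzb v (fun y => (f y : ℂ)) y / f y := by
    filter_upwards [hf.eventually (by simp), hf.continuousAt.eventually_ne h] with y hy hne
    exact dzb_log (hy.differentiableAt (by norm_num)) hne v
  rw [dz_congr h1, dz_div ((hf.ofReal.dzb (m := 1) (by norm_num) v).differentiableAt (by norm_num))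
    (hf.ofReal.differentiableAt (by norm_num)) (by exact_mod_cast h)]

/-- The algebraic core of `levi_flat_identity`. Here `a, q` are the first derivatives `ρ_1, ρ_2`;
`Ljk = ∂_k ∂̄_j ρ`; `Sjk` are the pure second derivatives; `Tjk = ∂_2 Ljk`; `ab, qb, R, U` are the
conjugates. The hypotheses say that the Levi form on the complex tangent vector vanishes and that
its `∂_2` derivative `D` equals `b q`. The relations for `D` and `Db` eliminate the third
derivatives, and the pure second derivatives then occur only as a multiple of the vanishing Levi
form. -/
lemma bordered_identity {q qb a ab b L11 L12 L21 L22 S22 S12 R22 R12 T11 T12 T21 T22 U11 U12 U21 U22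
    D Db : ℂ} (hq : q ≠ 0) (hqb : qb ≠ 0)
    (hB : qb * q * L11 - qb * a * L12 - ab * q * L21 + ab * a * L22 = 0)
    (hD : D = L22 * q * L11 + qb * S22 * L11 + qb * q * T11
      - (L22 * a * L12 + qb * S12 * L12 + qb * a * T12)
      - (L12 * q * L21 + ab * S22 * L21 + ab * q * T21)
      + (L12 * a * L22 + ab * S12 * L22 + ab * a * T22))
    (hDb : Db = L22 * qb * L11 + q * R22 * L11 + q * qb * U11
      - (L22 * ab * L21 + q * R12 * L21 + q * ab * U12)
      - (L21 * qb * L12 + a * R22 * L12 + a * qb * U21)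
      + (L21 * ab * L22 + a * R12 * L22 + a * ab * U22))
    (h1 : D = b * q) (h2 : Db = b * qb) :
    (qb * q * ((T11 / q - L12 * S12 / q ^ 2 + U11 / qb - R12 * L21 / qb ^ 2) / 2)
      - qb * a * ((T12 / q - L12 * S22 / q ^ 2 + U21 / qb - R12 * L22 / qb ^ 2) / 2)
      - ab * q * ((T21 / q - L22 * S12 / q ^ 2 + U12 / qb - R22 * L21 / qb ^ 2) / 2)
      + ab * a * ((T22 / q - L22 * S22 / q ^ 2 + U22 / qb - R22 * L22 / qb ^ 2) / 2) - b) * (q * qb)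
      = (qb * L12 - ab * L22) * (q * L21 - a * L22) := by
  rw [hD] at h1
  rw [hDb] at h2
  field_simp
  linear_combination (q * qb) * (qb * h1 + q * h2)
    - (qb ^ 2 * S22 + q ^ 2 * R22 + 2 * q * qb * L22) * hB

/-- The vector field `ρ_{e₂} e₁ - ρ_{e₁} e₂`, which is tangent to the level sets of `ρ`. -/
noncomputable def complexTangent (e₁ e₂ : E) (ρ : E → ℝ) (y : E) : E :=
  dz e₂ (fun y => (ρ y : ℂ)) y • e₁ - dz e₁ (fun y => (ρ y : ℂ)) y • e₂

lemma dz_complexTangent (e₁ e₂ : E) (ρ : E → ℝ) (y : E) :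
    dz (complexTangent e₁ e₂ ρ y) (fun y => (ρ y : ℂ)) y = 0 := by
  rw [complexTangent, sub_eq_add_neg, ← neg_smul, dz_add_dir, dz_smul, dz_smul]; ring

lemma leviE_combo (f : E → ℝ) (x e₁ e₂ : E) (a b c d : ℂ) :
    leviE f x (a • e₁ - b • e₂) (c • e₁ - d • e₂) =
      (starRingEnd ℂ) a * c * leviE f x e₁ e₁ - (starRingEnd ℂ) a * d * leviE f x e₁ e₂
      - (starRingEnd ℂ) b * c * leviE f x e₂ e₁ + (starRingEnd ℂ) b * d * leviE f x e₂ e₂ := by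
  simp only [sub_eq_add_neg, ← neg_smul, leviE_add_left, leviE_add_right, leviE_smul_left,
    leviE_smul_right, map_neg]
  ring

/-- The Levi form of the logarithm of the modulus of `∂_{e} ρ`. -/
lemma leviE_log_norm_dz {ρ : E → ℝ} {p : E} (hρ : ContDiffAt ℝ 3 ρ p) (e : E)
    (hq : dz e (fun y => (ρ y : ℂ)) p ≠ 0) (u v : E) :
    leviE (fun y => Real.log ‖dz e (fun y => (ρ y : ℂ)) y‖) p u v =
      (dz e (dz v (dzb u (fun y => (ρ y : ℂ)))) p / dz e (fun y => (ρ y : ℂ)) p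
        - dz e (dzb u (fun y => (ρ y : ℂ))) p * dz v (dz e (fun y => (ρ y : ℂ))) p
          / dz e (fun y => (ρ y : ℂ)) p ^ 2
        + (starRingEnd ℂ) (dz e (dz u (dzb v (fun y => (ρ y : ℂ)))) p)
          / (starRingEnd ℂ) (dz e (fun y => (ρ y : ℂ)) p)
        - (starRingEnd ℂ) (dz u (dz e (fun y => (ρ y : ℂ))) p)
          * dz v (dzb e (fun y => (ρ y : ℂ))) p
          / (starRingEnd ℂ) (dz e (fun y => (ρ y : ℂ)) p) ^ 2) / 2 := by
  set R : E → ℂ := fun y => (ρ y : ℂ) with hR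
  have hRc : ContDiffAt ℝ 3 R p := hρ.ofReal
  set Q := dz e R with hQ
  have hQc : ContDiffAt ℝ 2 Q p := hRc.dz (by norm_num) e
  have hlogc : ContDiffAt ℝ 2 (fun y => Real.log ‖Q y‖) p := (hQc.norm ℝ hq).log (by simpa using hq)
  rw [leviE_eq_dz_dzb hlogc]
  have h1 : dzb u (fun y => ((Real.log ‖Q y‖ : ℝ) : ℂ)) =ᶠ[𝓝 p]
      fun y => (dzb u Q y / Q y + (starRingEnd ℂ) (dz u Q y) / (starRingEnd ℂ) (Q y)) * (2 : ℂ)⁻¹ := by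
    filter_upwards [hQc.eventually (by simp), hQc.continuousAt.eventually_ne hq] with y hy hne
    have hyd : DifferentiableAt ℝ Q y := hy.differentiableAt (by norm_num)
    have hyc : DifferentiableAt ℝ (fun y => (starRingEnd ℂ) (Q y)) y :=
      hy.conj.differentiableAt (by norm_num)
    -- With `log |Q| = ½ log(Q Q̄)`, only the product rule and derivatives of `Q` and `Q̄` are
    -- needed.
    have e1 : (fun y => ((Real.log ‖Q y‖ : ℝ) : ℂ)) =
        fun y => ((Real.log (Complex.normSq (Q y)) : ℝ) : ℂ) * (2 : ℂ)⁻¹ := by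
      ext y
      rw [Complex.normSq_eq_norm_sq, Real.log_pow]; push_cast; ring
    have e2 : (fun y => (Complex.normSq (Q y) : ℂ)) = fun y => Q y * (starRingEnd ℂ) (Q y) := by
      ext y; rw [Complex.mul_conj]
    have hns : DifferentiableAt ℝ (fun y => Complex.normSq (Q y)) y := by
      have := Complex.reCLM.differentiableAt.comp y (hyd.mul hyc)
      refine this.congr_of_eventuallyEq (Eventually.of_forall fun y => ?_)
      simp [Complex.mul_conj]
    have hns0 : Complex.normSq (Q y) ≠ 0 := by simpa using hne
    have hl := hns.log hns0
    have hl' : DifferentiableAt ℝ (fun y => ((Real.log (Complex.normSq (Q y)) : ℝ) : ℂ)) y :=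
      Complex.ofRealCLM.differentiableAt.comp y hl
    rw [e1, dzb_mul hl' (by fun_prop), dzb_const, dzb_log hns hns0, e2, dzb_mul hyd hyc, dzb_conj,
      ← Complex.mul_conj]
    have : (starRingEnd ℂ) (Q y) ≠ 0 := by simpa using hne
    field_simp
    ring
  rw [dz_congr h1]
  have d1 : DifferentiableAt ℝ (dzb u Q) p :=
    (hQc.dzb (m := 1) (by norm_num) u).differentiableAt (by norm_num)
  have d2 : DifferentiableAt ℝ (fun y => (starRingEnd ℂ) (dz u Q y)) p :=
    (hQc.dz (m := 1) (by norm_num) u).conj.differentiableAt (by norm_num)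
  have d3 : DifferentiableAt ℝ Q p := hQc.differentiableAt (by norm_num)
  have d4 : DifferentiableAt ℝ (fun y => (starRingEnd ℂ) (Q y)) p :=
    hQc.conj.differentiableAt (by norm_num)
  have hqc : (starRingEnd ℂ) (Q p) ≠ 0 := by simpa using hq
  have d5 : DifferentiableAt ℝ (fun y => dzb u Q y / Q y) p := by
    simp only [div_eq_mul_inv]
    exact d1.fun_mul (d3.inv hq)
  have d6 : DifferentiableAt ℝ (fun y => (starRingEnd ℂ) (dz u Q y) / (starRingEnd ℂ) (Q y)) p := by
    simp only [div_eq_mul_inv]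
    exact d2.fun_mul (d4.inv hqc)
  rw [dz_mul (d5.fun_add d6) (by fun_prop), dz_const, dz_add d5 d6, dz_div d1 d3 hq, dz_div d2 d4 hqc, dz_conj, dz_conj]
  -- The derivative along `e` is moved to the outermost place, so that the third derivatives appear
  -- as derivatives of Levi coefficients of `ρ`.
  have s1 : dz v (dzb u Q) p = dz e (dz v (dzb u R)) p := by
    have : dzb u Q =ᶠ[𝓝 p] dz e (dzb u R) := by
      filter_upwards [hRc.eventually (by simp)] with y hy
      exact (dz_dzb_comm (hy.of_le (by norm_num)) e u).symm
    rw [dz_congr this, dz_dz_comm (hRc.dzb (by norm_num) u)]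
  have s2 : dzb v (dz u Q) p = dz e (dz u (dzb v R)) p := by
    rw [← dz_dzb_comm hQc]
    have : dzb v Q =ᶠ[𝓝 p] dz e (dzb v R) := by
      filter_upwards [hRc.eventually (by simp)] with y hy
      exact (dz_dzb_comm (hy.of_le (by norm_num)) e v).symm
    rw [dz_congr this, dz_dz_comm (hRc.dzb (by norm_num) v)]
  have s3 : dzb u Q p = dz e (dzb u R) p := (dz_dzb_comm (hRc.of_le (by norm_num)) e u).symm
  have s4 : (starRingEnd ℂ) (dzb v Q p) = dz v (dzb e R) p := by
    rw [← dz_conj]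
    congr 1
    ext y
    exact conj_dz_ofReal ρ e y
  rw [s1, s2, s3, s4]
  field_simp
  ring

lemma dz_mul_mul {f g h : E → ℂ} {x : E} (hf : DifferentiableAt ℝ f x)
    (hg : DifferentiableAt ℝ g x) (hh : DifferentiableAt ℝ h x) (u : E) :
    dz u (fun y => f y * g y * h y) x =
      dz u f x * g x * h x + f x * dz u g x * h x + f x * g x * dz u h x := by
  rw [dz_mul (hf.fun_mul hg) hh, dz_mul hf hg]; ring

lemma leviE_neg_log {f : E → ℝ} {x : E} (hf : ContDiffAt ℝ 2 f x) (h : f x ≠ 0) (v w : E) :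
    leviE (fun y => -Real.log (-f y)) x v w = - leviE f x v w / f x
      + dzb v (fun y => (f y : ℂ)) x * dz w (fun y => (f y : ℂ)) x / (f x : ℂ) ^ 2 := by
  have h1 : (fun y => -Real.log (-f y)) = fun y => (-1) * Real.log (f y) := by
    ext y; rw [Real.log_neg_eq_log]; ring
  rw [h1, leviE_const_mul _ (hf.log h), leviE_log hf h]
  push_cast; ring

/-- The transversal derivative of the Levi form of a defining function of a Levi-flat
hypersurface. -/
lemma levi_flat_identity {ρ : E → ℝ} {p e₁ e₂ : E} (hρ : ContDiffAt ℝ 3 ρ p)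
    (hq : dz e₂ (fun y => (ρ y : ℂ)) p ≠ 0) {b : ℝ}
    (hB : leviE ρ p (complexTangent e₁ e₂ ρ p) (complexTangent e₁ e₂ ρ p) = 0)
    (hb : ∀ u, fderiv ℝ (fun y => (leviE ρ y (complexTangent e₁ e₂ ρ y)
      (complexTangent e₁ e₂ ρ y)).re) p u = b * fderiv ℝ ρ p u) :
    (leviE (fun y => Real.log ‖dz e₂ (fun y => (ρ y : ℂ)) y‖) p (complexTangent e₁ e₂ ρ p)
      (complexTangent e₁ e₂ ρ p) - b) * (Complex.normSq (dz e₂ (fun y => (ρ y : ℂ)) p) : ℂ) =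
      (Complex.normSq (leviE ρ p (complexTangent e₁ e₂ ρ p) e₂) : ℂ) := by
  set R : E → ℂ := fun y => (ρ y : ℂ) with hR
  have hRc : ContDiffAt ℝ 3 R p := hρ.ofReal
  have hcq (e y) : (starRingEnd ℂ) (dz e R y) = dzb e R y := conj_dz_ofReal ρ e y
  have hcq' (e y) : (starRingEnd ℂ) (dzb e R y) = dz e R y := conj_dzb_ofReal ρ e y
  have hL {y} (hy : ContDiffAt ℝ 3 ρ y) (u v) : leviE ρ y u v = dz v (dzb u R) y :=
    leviE_eq_dz_dzb (hy.of_le (by norm_num)) u v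
  have hLc {y} (hy : ContDiffAt ℝ 3 ρ y) (u v) :
      (starRingEnd ℂ) (dz v (dzb u R) y) = dz u (dzb v R) y := by
    rw [← hL hy, ← hL hy, leviE_conj (hy.of_le (by norm_num))]
  have hexp : (fun y => ((leviE ρ y (complexTangent e₁ e₂ ρ y) (complexTangent e₁ e₂ ρ y)).re : ℂ))
      =ᶠ[𝓝 p] fun y => ((dzb e₂ R y * dz e₂ R y * dz e₁ (dzb e₁ R) y
        - dzb e₂ R y * dz e₁ R y * dz e₂ (dzb e₁ R) y)
        - dzb e₁ R y * dz e₂ R y * dz e₁ (dzb e₂ R) y)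
        + dzb e₁ R y * dz e₁ R y * dz e₂ (dzb e₂ R) y := by
    filter_upwards [hρ.eventually (by simp)] with y hy
    rw [leviE_self_im (hy.of_le (by norm_num)), complexTangent, leviE_combo]
    simp only [hL hy, ← hR, hcq]
  have dA (e) : DifferentiableAt ℝ (dz e R) p :=
    (hRc.dz (m := 1) (by norm_num) e).differentiableAt (by norm_num)
  have dAb (e) : DifferentiableAt ℝ (dzb e R) p :=
    (hRc.dzb (m := 1) (by norm_num) e).differentiableAt (by norm_num)
  have dL (e e') : DifferentiableAt ℝ (dz e (dzb e' R)) p :=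
    ((hRc.dzb (m := 2) (by norm_num) e').dz (m := 1) (by norm_num) e).differentiableAt (by norm_num)
  have t (e f e' f') : DifferentiableAt ℝ
      (fun y => dzb e R y * dz f R y * dz e' (dzb f' R) y) p :=
    ((dAb e).fun_mul (dA f)).fun_mul (dL _ _)
  have hBd : DifferentiableAt ℝ (fun y => (leviE ρ y (complexTangent e₁ e₂ ρ y)
      (complexTangent e₁ e₂ ρ y)).re) p := by
    have h1 := ((((t e₂ e₂ e₁ e₁).fun_sub (t e₂ e₁ e₂ e₁)).fun_sub (t e₁ e₂ e₁ e₂)).fun_add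
      (t e₁ e₁ e₂ e₂)).congr_of_eventuallyEq hexp
    have h2 := Complex.reCLM.differentiableAt.comp p h1
    exact h2
  -- The real proportionality of differentials passes to their `(1,0)` parts; since `b` is real,
  -- conjugation below gives the second relation.
  have hD : dz e₂ (fun y => ((leviE ρ y (complexTangent e₁ e₂ ρ y)
      (complexTangent e₁ e₂ ρ y)).re : ℂ)) p = b * dz e₂ R p := by
    simp only [dz, fderiv_ofReal hBd, hb, hR, fderiv_ofReal (hρ.differentiableAt (by norm_num))]
    push_cast; ring
  set D := dz e₂ (fun y => ((leviE ρ y (complexTangent e₁ e₂ ρ y)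
      (complexTangent e₁ e₂ ρ y)).re : ℂ)) p with hDdef
  have hD1 := hDdef
  rw [dz_congr hexp, dz_add (((t e₂ e₂ e₁ e₁).fun_sub (t e₂ e₁ e₂ e₁)).fun_sub (t e₁ e₂ e₁ e₂))
      (t e₁ e₁ e₂ e₂), dz_sub ((t e₂ e₂ e₁ e₁).fun_sub (t e₂ e₁ e₂ e₁)) (t e₁ e₂ e₁ e₂),
      dz_sub (t e₂ e₂ e₁ e₁) (t e₂ e₁ e₂ e₁)] at hD1
  simp only [dz_mul_mul (dAb _) (dA _) (dL _ _)] at hD1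
  have hBp := hexp.self_of_nhds
  beta_reduce at hBp
  rw [hB] at hBp
  simp only [complexTangent] at *
  rw [leviE_combo]
  have hlog := leviE_log_norm_dz hρ e₂ hq
  simp only [← hR] at hlog
  simp only [hlog]
  have hM : leviE ρ p (dz e₂ R p • e₁ - dz e₁ R p • e₂) e₂ =
      dzb e₂ R p * dz e₂ (dzb e₁ R) p - dzb e₁ R p * dz e₂ (dzb e₂ R) p := by
    have := leviE_combo ρ p e₁ e₂ (dz e₂ R p) (dz e₁ R p) 0 (-1)
    simp only [zero_smul, neg_smul, one_smul, zero_sub, neg_neg] at this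
    rw [this]; simp only [hL hρ, hcq]; ring
  rw [hM, ← Complex.mul_conj, ← Complex.mul_conj, map_sub, map_mul, map_mul, hcq', hcq', hcq,
    hLc hρ, hLc hρ]
  simp only [← hR, hcq]
  rw [dz_dz_comm (hRc.of_le (by norm_num)) e₁ e₂]
  have hDb := congrArg (starRingEnd ℂ) hD1
  simp only [map_add, map_sub, map_mul, hcq, hcq', hLc hρ] at hDb
  have hDc := congrArg (starRingEnd ℂ) hD
  rw [map_mul, Complex.conj_ofReal, hcq] at hDc
  have hq' : dzb e₂ R p ≠ 0 := by rw [← hcq]; simpa using hq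
  rw [bordered_identity (T11 := dz e₂ (dz e₁ (dzb e₁ R)) p) (T12 := dz e₂ (dz e₂ (dzb e₁ R)) p)
    (T21 := dz e₂ (dz e₁ (dzb e₂ R)) p) (T22 := dz e₂ (dz e₂ (dzb e₂ R)) p) hq hq'
    (by simpa using hBp.symm) ?_ ?_ hD hDc]
  · rw [hD1]
  · rw [hDb]

/-- If `g` is strictly plurisubharmonic along the leaves of the Levi-flat hypersurface `ρ = 0`, then
the Levi form of `g + log |∂_{e₂} ρ| - log (-ρ)` is bounded below near the hypersurface. -/
theorem levi_lower_bound {ρ g : E → ℝ} {p e₁ e₂ : E}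
    (hspan : ∀ u : E, ∃ x y : ℂ, u = x • e₁ + y • e₂)
    (hρ : ContDiffAt ℝ 3 ρ p) (hg : ContDiffAt ℝ 2 g p) (h0 : ρ p = 0)
    (hq : dz e₂ (fun y => (ρ y : ℂ)) p ≠ 0)
    (hflat : ∀ᶠ y in 𝓝 p, ρ y = 0 →
      leviE ρ y (complexTangent e₁ e₂ ρ y) (complexTangent e₁ e₂ ρ y) = 0)
    (hpos : 0 < (leviE g p (complexTangent e₁ e₂ ρ p) (complexTangent e₁ e₂ ρ p)).re) :
    ∃ c > 0, ∀ᶠ y in 𝓝 p, ρ y < 0 → ∀ u, c * ‖u‖ ^ 2 ≤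
      (leviE (fun y => (g y + Real.log ‖dz e₂ (fun y => (ρ y : ℂ)) y‖) + -Real.log (-ρ y)) y u u).re
      := by
  set R : E → ℂ := fun y => (ρ y : ℂ) with hR
  set v : E → E := complexTangent e₁ e₂ ρ with hv
  have hRc : ContDiffAt ℝ 3 R p := hρ.ofReal
  have hQc : ContDiffAt ℝ 2 (dz e₂ R) p := hRc.dz (by norm_num) e₂
  have hlogc : ContDiffAt ℝ 2 (fun y => Real.log ‖dz e₂ R y‖) p :=
    (hQc.norm ℝ hq).log (by simpa using hq)
  set f : E → ℝ := fun y => g y + Real.log ‖dz e₂ R y‖ with hf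
  have hfc : ContDiffAt ℝ 2 f p := hg.add hlogc
  have hρ2 : ContDiffAt ℝ 2 ρ p := hρ.of_le (by norm_num)
  have hvc1 : ContDiffAt ℝ 1 v p :=
    ((hRc.dz (m := 1) (by norm_num) e₂).smul contDiffAt_const).sub
      ((hRc.dz (m := 1) (by norm_num) e₁).smul contDiffAt_const)
  have hvc : ContinuousAt v p := hvc1.continuousAt
  have hLc {y} (hy : ContDiffAt ℝ 3 ρ y) (a b) : leviE ρ y a b = dz b (dzb a R) y :=
    leviE_eq_dz_dzb (hy.of_le (by norm_num)) a b
  have hBc : ContDiffAt ℝ 1 (fun y => (leviE ρ y (v y) (v y)).re) p := by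
    have hd (a b) : ContDiffAt ℝ 1 (dz a (dzb b R)) p :=
      (hRc.dzb (m := 2) (by norm_num) b).dz (by norm_num) a
    have ha (a) : ContDiffAt ℝ 1 (dz a R) p := hRc.dz (by norm_num) a
    have h1 : ContDiffAt ℝ 1 (fun y => (leviE ρ y (v y) (v y))) p := by
      have : (fun y => leviE ρ y (v y) (v y)) =ᶠ[𝓝 p] fun y =>
          (starRingEnd ℂ) (dz e₂ R y) * dz e₂ R y * dz e₁ (dzb e₁ R) y
          - (starRingEnd ℂ) (dz e₂ R y) * dz e₁ R y * dz e₂ (dzb e₁ R) y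
          - (starRingEnd ℂ) (dz e₁ R y) * dz e₂ R y * dz e₁ (dzb e₂ R) y
          + (starRingEnd ℂ) (dz e₁ R y) * dz e₁ R y * dz e₂ (dzb e₂ R) y := by
        filter_upwards [hρ.eventually (by simp)] with y hy
        rw [hv, complexTangent, leviE_combo]
        simp only [hLc hy, ← hR]
      refine ContDiffAt.congr_of_eventuallyEq ?_ this
      exact ((((((ha _).conj.mul (ha _)).mul (hd _ _)).sub
        (((ha _).conj.mul (ha _)).mul (hd _ _))).sub
        (((ha _).conj.mul (ha _)).mul (hd _ _))).add
        (((ha _).conj.mul (ha _)).mul (hd _ _)))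
    exact Complex.reCLM.contDiff.contDiffAt.comp p h1
  have hdρ : fderiv ℝ ρ p ≠ 0 := by
    intro h
    apply hq
    simp only [dz, hR, fderiv_ofReal (hρ.differentiableAt (by norm_num)), h]
    simp
  obtain ⟨b, hb, hlim⟩ := exists_fderiv_eq_mul_of_vanish hBc (hρ.of_le (by norm_num)) h0 hdρ
    (hflat.mono fun y hy h => by rw [hy h]; simp)
  have hid := levi_flat_identity hρ hq (hflat.self_of_nhds h0) hb
  set l := 𝓝[{y | ρ y ≠ 0}] p
  have hl : l ≤ 𝓝 p := nhdsWithin_le_nhds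
  -- `A, M, N` are the entries of the Levi form of `f - log(-ρ)` in the basis `v, -ρ e₂`. Shrinking
  -- the transversal vector by the factor `ρ` absorbs the pole, so all three have limits at the
  -- hypersurface.
  set A : E → ℝ := fun y => (leviE f y (v y) (v y)).re - (leviE ρ y (v y) (v y)).re / ρ y with hA
  set M : E → ℂ := fun y => -ρ y * leviE f y (v y) e₂ + leviE ρ y (v y) e₂ with hM
  set N : E → ℝ := fun y => ρ y ^ 2 * (leviE f y e₂ e₂).re - ρ y * (leviE ρ y e₂ e₂).re
    + Complex.normSq (dz e₂ R y) with hN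
  have tρ : Tendsto ρ l (𝓝 0) := by
    have := hρ.continuousAt.tendsto.mono_left hl
    rwa [h0] at this
  have tρC : Tendsto (fun y => (ρ y : ℂ)) l (𝓝 0) := by
    have := (Complex.continuous_ofReal.tendsto 0).comp tρ
    rwa [Complex.ofReal_zero] at this
  have cre {F : E → ℂ} (h : ContinuousAt F p) : Tendsto (fun y => (F y).re) l (𝓝 (F p).re) :=
    (Complex.continuous_re.continuousAt.tendsto.comp h).mono_left hl
  have tA : Tendsto A l (𝓝 ((leviE f p (v p) (v p)).re - b)) :=
    (cre (continuousAt_leviE hfc hvc hvc)).sub hlim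
  have tM : Tendsto M l (𝓝 (leviE ρ p (v p) e₂)) := by
    have := (tρC.neg.mul ((continuousAt_leviE hfc hvc
      (continuousAt_const (y := e₂))).tendsto.mono_left hl)).add
      ((continuousAt_leviE hρ2 hvc (continuousAt_const (y := e₂))).tendsto.mono_left hl)
    rwa [neg_zero, zero_mul, zero_add] at this
  have tN : Tendsto N l (𝓝 (Complex.normSq (dz e₂ R p))) := by
    have := (((tρ.pow 2).mul (cre (continuousAt_leviE hfc (continuousAt_const (y := e₂))
      (continuousAt_const (y := e₂))))).sub (tρ.mul (cre (continuousAt_leviE hρ2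
      (continuousAt_const (y := e₂)) (continuousAt_const (y := e₂)))))).add
      ((Complex.continuous_normSq.continuousAt.tendsto.comp hQc.continuousAt).mono_left hl)
    simpa using this
  set A0 := (leviE f p (v p) (v p)).re - b with hA0
  set N0 := Complex.normSq (dz e₂ R p) with hN0
  set M0 := leviE ρ p (v p) e₂ with hM0
  have hN0pos : 0 < N0 := Complex.normSq_pos.2 hq
  -- `levi_flat_identity` cancels everything in the limiting determinant except the contribution of
  -- `g`.
  have hdet : A0 * N0 - Complex.normSq M0 = (leviE g p (v p) (v p)).re * N0 := by
    have h1 : leviE f p (v p) (v p) = leviE g p (v p) (v p) +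
      leviE (fun y => Real.log ‖dz e₂ R y‖) p (v p) (v p) := leviE_add hg hlogc _ _
    have h2 := congrArg Complex.re hid
    rw [Complex.ofReal_re, Complex.re_mul_ofReal, Complex.sub_re, Complex.ofReal_re] at h2
    rw [← h2, hA0, h1, Complex.add_re]; ring
  have hdetpos : 0 < A0 * N0 - Complex.normSq M0 := by rw [hdet]; positivity
  have hA0pos : 0 < A0 := by
    have : 0 ≤ Complex.normSq M0 := Complex.normSq_nonneg _
    by_contra! h
    nlinarith
  set d := (A0 * N0 - Complex.normSq M0) / 2 with hd
  set t := A0 + N0 + 1 with ht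
  have ev1 : ∀ᶠ y in l, 0 < A y := tA.eventually (lt_mem_nhds hA0pos)
  have ev2 : ∀ᶠ y in l, 0 < N y := tN.eventually (lt_mem_nhds hN0pos)
  have ev3 : ∀ᶠ y in l, d < A y * N y - Complex.normSq (M y) :=
    ((tA.mul tN).sub ((Complex.continuous_normSq.tendsto _).comp tM)).eventually
      (lt_mem_nhds (by rw [hd]; linarith))
  have ev4 : ∀ᶠ y in l, A y + N y < t :=
    (tA.add tN).eventually (gt_mem_nhds (by rw [ht]; linarith))
  -- A common bound near `p` for the vectors `v` and `ρ e₂`, by which the bound in the coefficients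
  -- `α, β` becomes one in `‖u‖`.
  set k := ‖v p‖ + ‖e₂‖ + 1 with hk
  have hkpos : 0 < k := by positivity
  have ev5 : ∀ᶠ y in 𝓝 p, ‖v y‖ < k :=
    hvc.norm.eventually (gt_mem_nhds (by
      show ‖v p‖ < k
      have := norm_nonneg e₂; rw [hk]; linarith))
  have ev6 : ∀ᶠ y in 𝓝 p, |ρ y| < 1 :=
    hρ.continuousAt.abs.eventually (gt_mem_nhds (by simp [h0]))
  have hdpos : 0 < d := by rw [hd]; linarith
  have htpos : 0 < t := by rw [ht]; linarith
  refine ⟨d / t / (2 * k ^ 2), by positivity, ?_⟩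
  have ev := eventually_nhdsWithin_iff.1 (ev1.and (ev2.and (ev3.and ev4)))
  filter_upwards [ev, ev5, ev6, hρ.eventually (by simp), hfc.eventually (by simp),
    hQc.continuousAt.eventually_ne hq] with y hy h5 h6 hρy hfy hqy hneg u
  obtain ⟨h1, h2, h3, h4⟩ := hy hneg.ne
  have hρy2 : ContDiffAt ℝ 2 ρ y := hρy.of_le (by norm_num)
  have hFc : ContDiffAt ℝ 2 (fun y => -Real.log (-ρ y)) y := (hρy2.neg.log (by simpa using hneg.ne)).neg
  have hρC : (ρ y : ℂ) ≠ 0 := by exact_mod_cast hneg.ne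
  have hF (a b) : leviE (fun y => f y + -Real.log (-ρ y)) y a b = leviE f y a b
      + (- leviE ρ y a b / ρ y + dzb a R y * dz b R y / (ρ y : ℂ) ^ 2) := by
    rw [leviE_add hfy hFc, leviE_neg_log hρy2 hneg.ne]
  have hv0 : dz (v y) R y = 0 := dz_complexTangent e₁ e₂ ρ y
  have hv0' : dzb (v y) R y = 0 := by rw [← conj_dz_ofReal, hv0, map_zero]
  have hFvv : leviE (fun y => f y + -Real.log (-ρ y)) y (v y) (v y) = (A y : ℂ) := by
    rw [hF, hv0, hv0', hA]; push_cast
    rw [leviE_self_im hfy, leviE_self_im hρy2]; ring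
  have hFv2 : -ρ y * leviE (fun y => f y + -Real.log (-ρ y)) y (v y) e₂ = M y := by
    rw [hF, hv0', hM]; field_simp; ring
  have hF22 : (ρ y : ℂ) ^ 2 * leviE (fun y => f y + -Real.log (-ρ y)) y e₂ e₂ = (N y : ℂ) := by
    rw [hF, hN]; push_cast
    rw [leviE_self_im hfy, leviE_self_im hρy2, ← Complex.mul_conj, conj_dz_ofReal]
    field_simp; ring
  have hF2v : leviE (fun y => f y + -Real.log (-ρ y)) y e₂ (v y) = (starRingEnd ℂ)
      (leviE (fun y => f y + -Real.log (-ρ y)) y (v y) e₂) := (leviE_conj (hfy.add hFc) _ _).symm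
  obtain ⟨a, c, rfl⟩ := hspan u
  -- The coefficients of `u` in the basis `v, -ρ e₂`.
  set α := a / dz e₂ R y with hα
  set β := -(c + α * dz e₁ R y) / ρ y with hβ
  have hu : a • e₁ + c • e₂ = α • v y - (β * ρ y) • e₂ := by
    rw [hv, complexTangent, smul_sub, smul_smul, smul_smul, hα, div_mul_cancel₀ _ hqy, ← hα, hβ,
      div_mul_cancel₀ _ hρC]
    module
  rw [hu]
  have hval : (leviE (fun y => f y + -Real.log (-ρ y)) y (α • v y - (β * ρ y) • e₂)
      (α • v y - (β * ρ y) • e₂)).re = A y * Complex.normSq α + N y * Complex.normSq β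
        + 2 * ((starRingEnd ℂ) α * β * M y).re := by
    rw [leviE_combo, hF2v, hFvv]
    have e1 : (starRingEnd ℂ) α * α * (A y : ℂ) = ((A y * Complex.normSq α : ℝ) : ℂ) := by
      push_cast; rw [← Complex.mul_conj]; ring
    have e2 : (starRingEnd ℂ) (β * ρ y) * (β * ρ y)
        * leviE (fun y => f y + -Real.log (-ρ y)) y e₂ e₂ = ((N y * Complex.normSq β : ℝ) : ℂ) := by
      push_cast; rw [← Complex.mul_conj, ← hF22, map_mul, Complex.conj_ofReal]; ring
    have e3 : -((starRingEnd ℂ) α * (β * ρ y) * leviE (fun y => f y + -Real.log (-ρ y)) y (v y) e₂)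
        = (starRingEnd ℂ) α * β * M y := by rw [← hFv2]; ring
    have e4 : -((starRingEnd ℂ) (β * ρ y) * α * (starRingEnd ℂ)
        (leviE (fun y => f y + -Real.log (-ρ y)) y (v y) e₂))
        = (starRingEnd ℂ) ((starRingEnd ℂ) α * β * M y) := by
      rw [← e3]
      simp only [map_neg, map_mul, Complex.conj_conj, Complex.conj_ofReal]
      ring
    have e34 := congrArg Complex.re e3
    have e44 := congrArg Complex.re e4
    rw [Complex.neg_re] at e34 e44
    rw [Complex.conj_re] at e44
    rw [e1, e2, Complex.add_re, Complex.sub_re, Complex.sub_re, Complex.ofReal_re, Complex.ofReal_re]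
    linarith
  rw [hval]
  refine le_trans ?_ (hermitian_two_lower_bound h1 h2 hdpos h3.le h4.le α β)
  rw [div_mul_eq_mul_div, mul_div_assoc]
  have hdt : 0 < d / t := by positivity
  refine mul_le_mul_of_nonneg_left ?_ hdt.le
  rw [div_le_iff₀ (by positivity)]
  have hnorm : ‖α • v y - (β * ρ y) • e₂‖ ≤ k * (‖α‖ + ‖β‖) := by
    refine (norm_sub_le _ _).trans ?_
    rw [norm_smul, norm_smul, norm_mul, Complex.norm_real, Real.norm_eq_abs]
    have i1 : ‖α‖ * ‖v y‖ ≤ ‖α‖ * k := by gcongr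
    have i2 : ‖β‖ * |ρ y| * ‖e₂‖ ≤ ‖β‖ * 1 * k := by
      gcongr
      have := norm_nonneg (v p); rw [hk]; linarith
    linarith
  rw [Complex.normSq_eq_norm_sq, Complex.normSq_eq_norm_sq]
  have i3 : ‖α • v y - (β * ρ y) • e₂‖ ^ 2 ≤ (k * (‖α‖ + ‖β‖)) ^ 2 := by gcongr
  nlinarith [sq_nonneg (‖α‖ - ‖β‖), mul_nonneg (sq_nonneg k) (sq_nonneg (‖α‖ - ‖β‖))]

end Core

/-! ### Independence of Levi-flatness from the defining function. -/

section LeviFlat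

variable {E : Type*} [NormedAddCommGroup E] [NormedSpace ℂ E]

/-- The real differential is the sum of the `(1,0)` part and its conjugate, and the `(1,0)` part
kills the vector. Arbitrary complex multiples are allowed, so that `v` and `iv` are both covered. -/
lemma fderiv_complexTangent {e₁ e₂ y : E} {ρ : E → ℝ} (hρ : DifferentiableAt ℝ ρ y) (c : ℂ) :
    fderiv ℝ ρ y (c • complexTangent e₁ e₂ ρ y) = 0 := by
  have h := fderiv_decomp (fun y => (ρ y : ℂ)) y (c • complexTangent e₁ e₂ ρ y)
  rw [dz_smul, dzb_smul, ← conj_dz_ofReal, dz_complexTangent, fderiv_ofReal hρ] at h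
  simpa using h

/-- The vanishing of the Levi form on the complex tangent vectors of a hypersurface does not depend
on the defining function. -/
lemma leviE_eq_zero_of_defining {e₁ e₂ p : E} {r ρ : E → ℝ} (hr : ContDiffAt ℝ 2 r p)
    (hρ : ContDiffAt ℝ 2 ρ p) (hdr : fderiv ℝ r p ≠ 0) (hdρ : fderiv ℝ ρ p ≠ 0) (h0 : ρ p = 0)
    (hv : ∀ᶠ y in 𝓝 p, ρ y = 0 → r y = 0)
    (hL : leviE r p (complexTangent e₁ e₂ ρ p) (complexTangent e₁ e₂ ρ p) = 0) :
    leviE ρ p (complexTangent e₁ e₂ ρ p) (complexTangent e₁ e₂ ρ p) = 0 := by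
  obtain ⟨k, hk, -⟩ := exists_fderiv_eq_mul_of_vanish (hr.of_le (by norm_num))
    (hρ.of_le (by norm_num)) h0 hdρ hv
  have hk0 : k ≠ 0 := by
    rintro rfl
    exact hdr (ContinuousLinearMap.ext fun u => by rw [hk]; simp)
  -- Subtracting the multiple of `ρ` with the same differential at `p` gives a function that
  -- vanishes on the hypersurface and is critical at `p`.
  set f : E → ℝ := fun y => r y + (-k) * ρ y with hf
  have hfc : ContDiffAt ℝ 2 f p := hr.add (contDiffAt_const.mul hρ)
  have hfp : fderiv ℝ f p = 0 := by
    ext u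
    rw [hf, fderiv_fun_add (hr.differentiableAt (by norm_num))
      ((hρ.differentiableAt (by norm_num)).const_mul _), fderiv_const_mul
      (hρ.differentiableAt (by norm_num))]
    simp [hk]
  have hdρc : ContinuousAt (fderiv ℝ ρ) p :=
    (hρ.fderiv_right (m := 0) (by norm_num)).continuousAt
  -- For a tangential field `V`, `df(V) = 0` on the hypersurface. A tangential derivative of this at
  -- `p`, where `df = 0`, leaves only the Hessian, since the term with the derivative of `V` drops
  -- out.
  have key (c d : ℂ) : fderiv ℝ (fderiv ℝ f) p (d • complexTangent e₁ e₂ ρ p)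
      (c • complexTangent e₁ e₂ ρ p) = 0 := by
    set V : E → E := fun y => c • complexTangent e₁ e₂ ρ y with hV
    have hVc : ContDiffAt ℝ 1 V p :=
      (((hρ.ofReal.dz (m := 1) (by norm_num) e₂).smul contDiffAt_const).sub
        ((hρ.ofReal.dz (m := 1) (by norm_num) e₁).smul contDiffAt_const)).const_smul c
    have hBc : ContDiffAt ℝ 1 (fun y => fderiv ℝ f y (V y)) p :=
      (hfc.fderiv_right (by norm_num)).clm_apply hVc
    have hB : ∀ᶠ y in 𝓝 p, ρ y = 0 → fderiv ℝ f y (V y) = 0 := by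
      filter_upwards [hv.eventually_nhds, hfc.eventually (by simp), hρ.eventually (by simp),
        hdρc.eventually_ne hdρ] with y hy hfy hρy hdy hy0
      obtain ⟨b, hb, -⟩ := exists_fderiv_eq_mul_of_vanish (B := f) (hfy.of_le (by norm_num))
        (hρy.of_le (by norm_num)) hy0 hdy (hy.mono fun z hz hz0 => by simp [hf, hz hz0, hz0])
      rw [hb, hV, fderiv_complexTangent (hρy.differentiableAt (by norm_num)), mul_zero]
    obtain ⟨b, hb, -⟩ := exists_fderiv_eq_mul_of_vanish hBc (hρ.of_le (by norm_num)) h0 hdρ hB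
    have h1 := hb (d • complexTangent e₁ e₂ ρ p)
    rw [fderiv_complexTangent (hρ.differentiableAt (by norm_num)), mul_zero, fderiv_clm_apply
      ((hfc.fderiv_right (m := 1) (by norm_num)).differentiableAt (by norm_num))
      (hVc.differentiableAt (by norm_num)), hfp] at h1
    simpa using h1
  have hz : leviE f p (complexTangent e₁ e₂ ρ p) (complexTangent e₁ e₂ ρ p) = 0 := by
    have h11 := key 1 1
    have h1I := key 1 Complex.I
    have hI1 := key Complex.I 1
    have hII := key Complex.I Complex.I
    rw [one_smul] at h11 h1I hI1
    simp only [leviE]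
    rw [h11, h1I, hI1, hII]; simp
  rw [hf, leviE_add hr (contDiffAt_const.mul hρ), leviE_const_mul _ hρ, hL] at hz
  simpa [hk0] using hz

end LeviFlat

/-! ### The Poisson kernel along a harmonic map into the disc. -/

section Harmonic

/-- The Poisson kernel of the unit disc, extended to all `ζ`. -/
noncomputable def poisson (h ζ : ℂ) : ℝ := (1 - ‖h‖ ^ 2) / ‖1 - (starRingEnd ℂ) h * ζ‖ ^ 2

lemma one_sub_conj_mul_ne_zero {h ζ : ℂ} (hh : ‖h‖ < 1) (hζ : ‖ζ‖ ≤ 1) :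
    1 - (starRingEnd ℂ) h * ζ ≠ 0 := by
  intro h0
  have h1 : ‖(starRingEnd ℂ) h * ζ‖ < 1 := by
    rw [norm_mul, RCLike.norm_conj]; nlinarith [norm_nonneg h, norm_nonneg ζ]
  rw [← sub_eq_zero.1 h0] at h1
  simp at h1

/-- The differential is `u ↦ u h_z + ū h_z̄`. If the coefficients have equal modulus, a square root
`s` of `-h_z̄ / h_z` is unimodular and lies in the kernel. -/
lemma fderiv_not_surjective_of_norm_eq {h : ℂ → ℂ} {z : ℂ} (he : ‖dz 1 h z‖ = ‖dzb 1 h z‖) :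
    ¬ Function.Surjective (fderiv ℝ h z) := by
  intro hs
  have hinj : Function.Injective (fderiv ℝ h z : ℂ →ₗ[ℝ] ℂ) :=
    LinearMap.injective_iff_surjective.2 hs
  have hform (u : ℂ) : fderiv ℝ h z u = u * dz 1 h z + (starRingEnd ℂ) u * dzb 1 h z := by
    have := fderiv_decomp h z (u • 1)
    rw [dz_smul, dzb_smul] at this
    simpa using this
  by_cases h0 : dz 1 h z = 0
  · have hb : dzb 1 h z = 0 := by rw [h0, norm_zero] at he; exact norm_eq_zero.1 he.symm
    have h1 : fderiv ℝ h z 1 = fderiv ℝ h z 0 := by rw [hform, hform, h0, hb]; simp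
    exact one_ne_zero (hinj h1)
  · obtain ⟨s, hs⟩ := IsAlgClosed.exists_pow_nat_eq (-dzb 1 h z / dz 1 h z) (n := 2) (by norm_num)
    have hn : ‖s‖ ^ 2 = 1 := by
      rw [← norm_pow, hs, norm_div, norm_neg, ← he, div_self (by simpa using h0)]
    have hs0 : s ≠ 0 := by rintro rfl; simp at hn
    have hsc : s * (starRingEnd ℂ) s = 1 := by
      rw [Complex.mul_conj, Complex.normSq_eq_norm_sq, hn]; simp
    have h1 : fderiv ℝ h z s = fderiv ℝ h z 0 := by
      rw [hform, map_zero]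
      have h2 : s ^ 2 * dz 1 h z = -dzb 1 h z := by rw [hs]; field_simp
      have : s * (s * dz 1 h z + (starRingEnd ℂ) s * dzb 1 h z) = 0 := by
        linear_combination h2 + hsc * dzb 1 h z
      simpa [hs0] using this
    exact hs0 (hinj h1)

/-- The letters `k, ζb, ab, bb, Hb` stand for the conjugates of `h, ζ, a, b, H`, with `a = h_z`, `b
= h_z̄`, `H = h_{zz̄}`. The left side is the Levi form of `log |1 - h̄ζ|² - log(1 - |h|²)`. The
harmonic map equation eliminates `H`, and `ζ ζ̄ = 1` collects the mixed terms `ab` into squares of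
unimodular factors. -/
lemma poisson_levi_identity {h k ζ ζb a b ab bb H Hb : ℂ} (hζ : ζ * ζb = 1) (h1 : 1 - h * k ≠ 0)
    (h2 : 1 - k * ζ ≠ 0) (h3 : 1 - h * ζb ≠ 0) (hH : H = -(2 * k / (1 - h * k) * a * b))
    (hHb : Hb = -(2 * h / (1 - h * k) * ab * bb)) :
    (-(Hb * ζ) * (1 - h * ζb) + ab * ζ * (a * ζb) + bb * ζ * (b * ζb) - (1 - k * ζ) * (H * ζb))
        / ((1 - k * ζ) * (1 - h * ζb))
      - (-(ab * ζ) * (1 - h * ζb) - (1 - k * ζ) * (b * ζb))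
        * (-(bb * ζ) * (1 - h * ζb) - (1 - k * ζ) * (a * ζb)) / ((1 - k * ζ) * (1 - h * ζb)) ^ 2
      - (-(H * k + b * bb + a * ab + h * Hb) / (1 - h * k)
        - (-(b * k + h * ab)) * (-(a * k + h * bb)) / (1 - h * k) ^ 2)
      = (a * ab + b * bb - ((ζb - k) / (1 - h * ζb)) ^ 2 * (a * b)
        - ((ζ - h) / (1 - k * ζ)) ^ 2 * (ab * bb)) / (1 - h * k) ^ 2 := by
  have hζ0 : ζ ≠ 0 := by rintro rfl; simp at hζ
  obtain rfl : ζb = ζ⁻¹ := by field_simp; linear_combination hζ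
  have h4 : ζ - h ≠ 0 := by
    intro h4; apply h3; field_simp; simpa using h4
  rw [show 1 - h * ζ⁻¹ = (ζ - h) / ζ by field_simp] at *
  subst hH hHb
  field_simp
  ring

lemma wirtinger_eq_dz (f : ℂ → ℂ) : wirtinger f = dz 1 f := by
  ext z; simp [wirtinger, dz]

lemma wirtingerBar_eq_dzb (f : ℂ → ℂ) : wirtingerBar f = dzb 1 f := by
  ext z; simp [wirtingerBar, dzb]

lemma contDiffAt_normSq {E : Type*} [NormedAddCommGroup E] [NormedSpace ℂ E] {n : WithTop ℕ∞}
    {f : E → ℂ} {x : E} (hf : ContDiffAt ℝ n f x) :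
    ContDiffAt ℝ n (fun y => Complex.normSq (f y)) x := by
  have : (fun y => Complex.normSq (f y)) = fun y => (f y * (starRingEnd ℂ) (f y)).re := by
    ext y; rw [Complex.mul_conj]; simp
  rw [this]
  exact Complex.reCLM.contDiff.contDiffAt.comp x (hf.mul hf.conj)

lemma contDiffAt_log_poisson {E : Type*} [NormedAddCommGroup E] [NormedSpace ℂ E]
    {n : WithTop ℕ∞} {h ζ : E → ℂ} {x : E} (hh : ContDiffAt ℝ n h x) (hζ : ContDiffAt ℝ n ζ x)
    (h1 : ‖h x‖ < 1) (h2 : 1 - (starRingEnd ℂ) (h x) * ζ x ≠ 0) :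
    ContDiffAt ℝ n (fun y => -Real.log (poisson (h y) (ζ y))) x := by
  have e : (fun y => -Real.log (poisson (h y) (ζ y))) = fun y => -Real.log
      ((1 - Complex.normSq (h y)) / Complex.normSq (1 - (starRingEnd ℂ) (h y) * ζ y)) := by
    ext y; rw [poisson, Complex.normSq_eq_norm_sq, Complex.normSq_eq_norm_sq]
  rw [e]
  have h3 : 0 < 1 - Complex.normSq (h x) := by
    rw [Complex.normSq_eq_norm_sq]; nlinarith [norm_nonneg (h x)]
  have h4 : 0 < Complex.normSq (1 - (starRingEnd ℂ) (h x) * ζ x) := Complex.normSq_pos.2 h2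
  refine (((contDiffAt_const.sub (contDiffAt_normSq hh)).div
    (contDiffAt_normSq (contDiffAt_const.sub (hh.conj.mul hζ))) h4.ne').log ?_).neg
  exact (div_pos h3 h4).ne'

/-- The Levi form of `-log` of the Poisson kernel along a harmonic map. -/
lemma leviE_poisson {h : ℂ → ℂ} {z ζ : ℂ} (hh : IsHarmonicDiscMapAt h z) (hlt : ‖h z‖ < 1)
    (hζ : ‖ζ‖ = 1) :
    ∃ w : ℂ, ‖w‖ = 1 ∧ leviE (fun z => -Real.log (poisson (h z) ζ)) z 1 1 =
      (dz 1 h z * (starRingEnd ℂ) (dz 1 h z) + dzb 1 h z * (starRingEnd ℂ) (dzb 1 h z)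
        - (w ^ 2 * (dz 1 h z * dzb 1 h z) + (starRingEnd ℂ) (w ^ 2 * (dz 1 h z * dzb 1 h z))))
        / ((1 - ‖h z‖ ^ 2 : ℝ) : ℂ) ^ 2 := by
  obtain ⟨hc, heq⟩ := hh
  simp only [wirtinger_eq_dz, wirtingerBar_eq_dzb] at heq
  have hne1 : 1 - (starRingEnd ℂ) (h z) * ζ ≠ 0 := one_sub_conj_mul_ne_zero hlt hζ.le
  have hne2 : 1 - h z * (starRingEnd ℂ) ζ ≠ 0 := by
    have := one_sub_conj_mul_ne_zero (h := (starRingEnd ℂ) (h z)) (ζ := (starRingEnd ℂ) ζ)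
      (by simpa using hlt) (by simpa using hζ.le)
    simpa using this
  have hζζ : ζ * (starRingEnd ℂ) ζ = 1 := by
    rw [Complex.mul_conj, Complex.normSq_eq_norm_sq, hζ]; simp
  have hpos : 0 < 1 - Complex.normSq (h z) := by
    rw [Complex.normSq_eq_norm_sq]; nlinarith [norm_nonneg (h z)]
  have hhk : h z * (starRingEnd ℂ) (h z) = Complex.normSq (h z) := Complex.mul_conj _
  have hne3 : 1 - h z * (starRingEnd ℂ) (h z) ≠ 0 := by
    rw [hhk]; exact_mod_cast hpos.ne'
  set f1 : ℂ → ℝ := fun y => Complex.normSq (1 - (starRingEnd ℂ) (h y) * ζ) with hf1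
  set f2 : ℂ → ℝ := fun y => 1 - Complex.normSq (h y) with hf2
  have c1 : ContDiffAt ℝ 2 f1 z :=
    contDiffAt_normSq (contDiffAt_const.sub (hc.conj.mul contDiffAt_const))
  have c2 : ContDiffAt ℝ 2 f2 z := contDiffAt_const.sub (contDiffAt_normSq hc)
  have n1 : f1 z ≠ 0 := (Complex.normSq_pos.2 hne1).ne'
  have n2 : f2 z ≠ 0 := hpos.ne'
  have hfun : (fun z => -Real.log (poisson (h z) ζ)) =ᶠ[𝓝 z]
      fun y => Real.log (f1 y) + (-1) * Real.log (f2 y) := by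
    filter_upwards [c1.continuousAt.eventually_ne n1, c2.continuousAt.eventually_ne n2] with y h1 h2
    rw [poisson, ← Complex.normSq_eq_norm_sq, ← Complex.normSq_eq_norm_sq, Real.log_div h2 h1]
    ring
  have F1 : (fun y => (f1 y : ℂ)) = fun y =>
      (1 - (starRingEnd ℂ) (h y) * ζ) * (1 - h y * (starRingEnd ℂ) ζ) := by
    ext y; rw [hf1, ← Complex.mul_conj]; simp
  have F2 : (fun y => (f2 y : ℂ)) = fun y => 1 - h y * (starRingEnd ℂ) (h y) := by
    ext y; rw [hf2, Complex.mul_conj]; push_cast; ring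
  have hev : ∀ᶠ y in 𝓝 z, DifferentiableAt ℝ h y := by
    filter_upwards [hc.eventually (by simp)] with y hy using hy.differentiableAt (by norm_num)
  have conjd {f : ℂ → ℂ} {y} (hf : DifferentiableAt ℝ f y) :
      DifferentiableAt ℝ (fun y => (starRingEnd ℂ) (f y)) y :=
    Complex.conjCLE.differentiableAt.comp y hf
  have A1 {y} (hy : DifferentiableAt ℝ h y) :
      DifferentiableAt ℝ (fun y => 1 - (starRingEnd ℂ) (h y) * ζ) y :=
    (differentiableAt_const _).fun_sub ((conjd hy).fun_mul (differentiableAt_const _))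
  have A2 {y} (hy : DifferentiableAt ℝ h y) :
      DifferentiableAt ℝ (fun y => 1 - h y * (starRingEnd ℂ) ζ) y :=
    (differentiableAt_const _).fun_sub (hy.fun_mul (differentiableAt_const _))
  have z1 {y} (hy : DifferentiableAt ℝ h y) : dz 1 (fun y => 1 - (starRingEnd ℂ) (h y) * ζ) y =
      -((starRingEnd ℂ) (dzb 1 h y) * ζ) := by
    rw [dz_sub (differentiableAt_const _) ((conjd hy).fun_mul (differentiableAt_const _)),
      dz_mul (conjd hy) (differentiableAt_const _), dz_const, dz_const, dz_conj]; ring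
  have z2 {y} (hy : DifferentiableAt ℝ h y) : dz 1 (fun y => 1 - h y * (starRingEnd ℂ) ζ) y =
      -(dz 1 h y * (starRingEnd ℂ) ζ) := by
    rw [dz_sub (differentiableAt_const _) (hy.fun_mul (differentiableAt_const _)),
      dz_mul hy (differentiableAt_const _), dz_const, dz_const]; ring
  have b1 {y} (hy : DifferentiableAt ℝ h y) : dzb 1 (fun y => 1 - (starRingEnd ℂ) (h y) * ζ) y =
      -((starRingEnd ℂ) (dz 1 h y) * ζ) := by
    rw [dzb_sub (differentiableAt_const _) ((conjd hy).fun_mul (differentiableAt_const _)),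
      dzb_mul (conjd hy) (differentiableAt_const _), dzb_const, dzb_const, dzb_conj]; ring
  have b2 {y} (hy : DifferentiableAt ℝ h y) : dzb 1 (fun y => 1 - h y * (starRingEnd ℂ) ζ) y =
      -(dzb 1 h y * (starRingEnd ℂ) ζ) := by
    rw [dzb_sub (differentiableAt_const _) (hy.fun_mul (differentiableAt_const _)),
      dzb_mul hy (differentiableAt_const _), dzb_const, dzb_const]; ring
  have B1 : dzb 1 (fun y => (f1 y : ℂ)) =ᶠ[𝓝 z] fun y =>
      (1 - (starRingEnd ℂ) (h y) * ζ) * (dzb 1 h y * (-(starRingEnd ℂ) ζ))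
      + (1 - h y * (starRingEnd ℂ) ζ) * ((starRingEnd ℂ) (dz 1 h y) * (-ζ)) := by
    filter_upwards [hev] with y hy
    rw [F1, dzb_mul (A1 hy) (A2 hy), b1 hy, b2 hy]; ring
  have B2 : dzb 1 (fun y => (f2 y : ℂ)) =ᶠ[𝓝 z] fun y =>
      (-1) * (h y * (starRingEnd ℂ) (dz 1 h y) + (starRingEnd ℂ) (h y) * dzb 1 h y) := by
    filter_upwards [hev] with y hy
    rw [F2, dzb_sub (differentiableAt_const _) (hy.fun_mul (conjd hy)), dzb_const,
      dzb_mul hy (conjd hy), dzb_conj]; ring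
  have hd : DifferentiableAt ℝ h z := hev.self_of_nhds
  have hdb : DifferentiableAt ℝ (dzb 1 h) z :=
    (hc.dzb (m := 1) (by norm_num) 1).differentiableAt (by norm_num)
  have hdz : DifferentiableAt ℝ (dz 1 h) z :=
    (hc.dz (m := 1) (by norm_num) 1).differentiableAt (by norm_num)
  have Z1 : dz 1 (fun y => (f1 y : ℂ)) z = -((starRingEnd ℂ) (dzb 1 h z) * ζ)
      * (1 - h z * (starRingEnd ℂ) ζ) - (1 - (starRingEnd ℂ) (h z) * ζ) * (dz 1 h z * (starRingEnd ℂ) ζ) := by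
    rw [F1, dz_mul (A1 hd) (A2 hd), z1 hd, z2 hd]; ring
  have Z2 : dz 1 (fun y => (f2 y : ℂ)) z =
      -(dz 1 h z * (starRingEnd ℂ) (h z) + h z * (starRingEnd ℂ) (dzb 1 h z)) := by
    rw [F2, dz_sub (differentiableAt_const _) (hd.fun_mul (conjd hd)), dz_const,
      dz_mul hd (conjd hd), dz_conj]; ring
  have hcomm : dzb 1 (dz 1 h) z = dz 1 (dzb 1 h) z := (dz_dzb_comm hc 1 1).symm
  have L1 : leviE f1 z 1 1 = -((starRingEnd ℂ) (dz 1 (dzb 1 h) z) * ζ) * (1 - h z * (starRingEnd ℂ) ζ)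
      + (starRingEnd ℂ) (dz 1 h z) * ζ * (dz 1 h z * (starRingEnd ℂ) ζ)
      + (starRingEnd ℂ) (dzb 1 h z) * ζ * (dzb 1 h z * (starRingEnd ℂ) ζ)
      - (1 - (starRingEnd ℂ) (h z) * ζ) * (dz 1 (dzb 1 h) z * (starRingEnd ℂ) ζ) := by
    rw [leviE_eq_dz_dzb c1, dz_congr B1,
      dz_add ((A1 hd).fun_mul (hdb.fun_mul (differentiableAt_const _)))
        ((A2 hd).fun_mul ((conjd hdz).fun_mul (differentiableAt_const _))),
      dz_mul (A1 hd) (hdb.fun_mul (differentiableAt_const _)),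
      dz_mul (A2 hd) ((conjd hdz).fun_mul (differentiableAt_const _)),
      dz_mul hdb (differentiableAt_const _), dz_mul (conjd hdz) (differentiableAt_const _),
      z1 hd, z2 hd, dz_const, dz_const, dz_conj, hcomm]
    ring
  have L2 : leviE f2 z 1 1 = -(dz 1 (dzb 1 h) z * (starRingEnd ℂ) (h z)
      + dzb 1 h z * (starRingEnd ℂ) (dzb 1 h z)
      + dz 1 h z * (starRingEnd ℂ) (dz 1 h z) + h z * (starRingEnd ℂ) (dz 1 (dzb 1 h) z)) := by
    rw [leviE_eq_dz_dzb c2, dz_congr B2, dz_mul (differentiableAt_const _)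
      ((hd.fun_mul (conjd hdz)).fun_add ((conjd hd).fun_mul hdb)), dz_const,
      dz_add (hd.fun_mul (conjd hdz)) ((conjd hd).fun_mul hdb), dz_mul hd (conjd hdz),
      dz_mul (conjd hd) hdb, dz_conj, dz_conj, hcomm]
    ring
  -- On the unit circle the numerator is `ζ̄` times the conjugate of the denominator.
  have hw : ‖((starRingEnd ℂ) ζ - (starRingEnd ℂ) (h z)) / (1 - h z * (starRingEnd ℂ) ζ)‖ = 1 := by
    have e : (starRingEnd ℂ) ζ - (starRingEnd ℂ) (h z)
        = (starRingEnd ℂ) ζ * (starRingEnd ℂ) (1 - h z * (starRingEnd ℂ) ζ) := by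
      simp only [map_sub, map_one, map_mul, Complex.conj_conj]
      linear_combination (starRingEnd ℂ) (h z) * hζζ
    rw [e, norm_div, norm_mul, RCLike.norm_conj, RCLike.norm_conj, hζ, one_mul,
      div_self (norm_ne_zero_iff.2 hne2)]
  refine ⟨_, hw, ?_⟩
  rw [leviE_congr hfun, leviE_add (c1.log n1) (contDiffAt_const.mul (c2.log n2)),
    leviE_const_mul _ (c2.log n2), leviE_log c1 n1, leviE_log c2 n2, L1, L2, Z1, Z2,
    B1.self_of_nhds, B2.self_of_nhds]
  have F1z := congrFun F1 z
  have F2z := congrFun F2 z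
  beta_reduce at F1z F2z
  rw [F1z, F2z]
  have hH : dz 1 (dzb 1 h) z =
      -(2 * (starRingEnd ℂ) (h z) / (1 - h z * (starRingEnd ℂ) (h z)) * dz 1 h z * dzb 1 h z) := by
    rw [hhk, Complex.normSq_eq_norm_sq]; push_cast; linear_combination heq
  have hHb : (starRingEnd ℂ) (dz 1 (dzb 1 h) z) =
      -(2 * h z / (1 - h z * (starRingEnd ℂ) (h z)) * (starRingEnd ℂ) (dz 1 h z)
        * (starRingEnd ℂ) (dzb 1 h z)) := by
    rw [hH]
    simp only [map_neg, map_mul, map_div₀, map_sub, map_one, Complex.conj_conj, Complex.conj_ofNat]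
    ring
  have key := poisson_levi_identity hζζ hne3 hne1 hne2 hH hHb
  have hden : ((1 - ‖h z‖ ^ 2 : ℝ) : ℂ) = 1 - h z * (starRingEnd ℂ) (h z) := by
    rw [hhk, Complex.normSq_eq_norm_sq]; push_cast; ring
  rw [hden]
  have hfin : (starRingEnd ℂ) ((((starRingEnd ℂ) ζ - (starRingEnd ℂ) (h z))
      / (1 - h z * (starRingEnd ℂ) ζ)) ^ 2 * (dz 1 h z * dzb 1 h z)) =
      ((ζ - h z) / (1 - (starRingEnd ℂ) (h z) * ζ)) ^ 2 * ((starRingEnd ℂ) (dz 1 h z)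
        * (starRingEnd ℂ) (dzb 1 h z)) := by
    simp only [map_mul, map_pow, map_div₀, map_sub, map_one, Complex.conj_conj]
  rw [hfin, ← sub_sub, ← key]
  push_cast
  ring

/-- Since `|w| = 1`, the mixed term is at least `-2 |h_z| |h_z̄|`, which completes the square. -/
lemma leviE_poisson_lower {h : ℂ → ℂ} {z ζ : ℂ} (hh : IsHarmonicDiscMapAt h z) (hlt : ‖h z‖ < 1)
    (hζ : ‖ζ‖ = 1) :
    (‖dz 1 h z‖ - ‖dzb 1 h z‖) ^ 2 / (1 - ‖h z‖ ^ 2) ^ 2 ≤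
      (leviE (fun z => -Real.log (poisson (h z) ζ)) z 1 1).re := by
  obtain ⟨w, hw, h1⟩ := leviE_poisson hh hlt hζ
  rw [h1, Complex.add_conj, Complex.mul_conj, Complex.mul_conj, Complex.normSq_eq_norm_sq,
    Complex.normSq_eq_norm_sq]
  norm_cast
  have hpos : 0 < 1 - ‖h z‖ ^ 2 := by nlinarith [norm_nonneg (h z)]
  gcongr
  have h2 := Complex.re_le_norm (w ^ 2 * (dz 1 h z * dzb 1 h z))
  rw [norm_mul, norm_pow, hw, norm_mul, one_pow, one_mul] at h2
  nlinarith

lemma leviE_poisson_nonneg {h : ℂ → ℂ} {z ζ : ℂ} (hh : IsHarmonicDiscMapAt h z) (hlt : ‖h z‖ < 1)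
    (hζ : ‖ζ‖ = 1) : 0 ≤ (leviE (fun z => -Real.log (poisson (h z) ζ)) z 1 1).re :=
  le_trans (by positivity) (leviE_poisson_lower hh hlt hζ)

lemma leviE_poisson_pos {h : ℂ → ℂ} {z ζ : ℂ} (hh : IsHarmonicDiscMapAt h z) (hlt : ‖h z‖ < 1)
    (hζ : ‖ζ‖ = 1) (hs : Function.Surjective (fderiv ℝ h z)) :
    0 < (leviE (fun z => -Real.log (poisson (h z) ζ)) z 1 1).re := by
  refine lt_of_lt_of_le ?_ (leviE_poisson_lower hh hlt hζ)
  have h1 : ‖dz 1 h z‖ - ‖dzb 1 h z‖ ≠ 0 := fun h0 =>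
    fderiv_not_surjective_of_norm_eq (sub_eq_zero.1 h0) hs
  have hpos : 0 < 1 - ‖h z‖ ^ 2 := by nlinarith [norm_nonneg (h z)]
  positivity

end Harmonic

/-! ### Automorphisms of the disc and the Poisson kernel. -/

section Moebius

open RiemannSphere

lemma coe_mem_unitDisc {z : ℂ} : (z : OnePoint ℂ) ∈ unitDisc ↔ ‖z‖ < 1 := by
  simp [unitDisc]

lemma infty_notMem_unitDisc : (OnePoint.infty : OnePoint ℂ) ∉ unitDisc := by
  simp [unitDisc]

/-- A Möbius transformation that preserves the unit disc preserves, up to a positive factor, the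
Hermitian form that defines it. -/
lemma IsDiscAut.exists_coeff {g : GL (Fin 2) ℂ} (hg : IsDiscAut g) :
    ∃ (a b c d : ℂ) (k : ℝ), 0 < k ∧ ‖a * d - b * c‖ = k ∧
      (∀ ζ : ℂ, g • (ζ : OnePoint ℂ) =
        if c * ζ + d = 0 then OnePoint.infty else (((a * ζ + b) / (c * ζ + d) : ℂ) : OnePoint ℂ)) ∧
      ∀ η ζ : ℂ, (starRingEnd ℂ) (c * η + d) * (c * ζ + d) - (starRingEnd ℂ) (a * η + b) * (a * ζ + b)
        = k * (1 - (starRingEnd ℂ) η * ζ) := by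
  set a := g 0 0
  set b := g 0 1
  set c := g 1 0
  set d := g 1 1
  have hact : ∀ ζ : ℂ, g • (ζ : OnePoint ℂ) =
        if c * ζ + d = 0 then OnePoint.infty else (((a * ζ + b) / (c * ζ + d) : ℂ) : OnePoint ℂ) := by
    intro ζ
    rw [OnePoint.smul_some_eq_ite]
  have hin : ∀ ζ : ℂ, ‖ζ‖ < 1 → ‖a * ζ + b‖ < ‖c * ζ + d‖ := by
    intro ζ hζ
    have h1 : g • (ζ : OnePoint ℂ) ∈ unitDisc := by
      rw [← hg]; exact ⟨_, coe_mem_unitDisc.2 hζ, rfl⟩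
    rw [hact] at h1
    split_ifs at h1 with h
    · exact absurd h1 infty_notMem_unitDisc
    · rw [coe_mem_unitDisc, norm_div, div_lt_one (norm_pos_iff.2 h)] at h1
      exact h1
  -- Radial limit of the inequality inside the disc.
  have hle : ∀ ζ : ℂ, ‖ζ‖ = 1 → ‖a * ζ + b‖ ≤ ‖c * ζ + d‖ := by
    intro ζ hζ
    have h1 : Tendsto (fun t : ℝ => ‖a * (t * ζ) + b‖) (𝓝[<] 1) (𝓝 ‖a * ((1 : ℝ) * ζ) + b‖) :=
      Tendsto.mono_left (Continuous.tendsto (by fun_prop) _) nhdsWithin_le_nhds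
    have h2 : Tendsto (fun t : ℝ => ‖c * (t * ζ) + d‖) (𝓝[<] 1) (𝓝 ‖c * ((1 : ℝ) * ζ) + d‖) :=
      Tendsto.mono_left (Continuous.tendsto (by fun_prop) _) nhdsWithin_le_nhds
    have h3 := le_of_tendsto_of_tendsto h1 h2 (by
      filter_upwards [Ioo_mem_nhdsLT (show (0 : ℝ) < 1 by norm_num)] with t ht
      refine (hin _ ?_).le
      rw [norm_mul, hζ, Complex.norm_real, Real.norm_eq_abs, abs_of_pos ht.1, mul_one]
      exact ht.2)
    simpa using h3
  -- With strict inequality the image would lie in the disc, hence be the image of a point of the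
  -- disc, against injectivity.
  have heq : ∀ ζ : ℂ, ‖ζ‖ = 1 → ‖a * ζ + b‖ = ‖c * ζ + d‖ := by
    intro ζ hζ
    refine le_antisymm (hle ζ hζ) (not_lt.1 fun hlt => ?_)
    have hne : c * ζ + d ≠ 0 := by
      intro h; rw [h, norm_zero] at hlt; exact absurd hlt (not_lt.2 (norm_nonneg _))
    have h1 : g • (ζ : OnePoint ℂ) ∈ unitDisc := by
      rw [hact, if_neg hne, coe_mem_unitDisc, norm_div, div_lt_one (norm_pos_iff.2 hne)]
      exact hlt
    rw [← hg] at h1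
    obtain ⟨x, hx, hxe⟩ := h1
    have : x = (ζ : OnePoint ℂ) := MulAction.injective g hxe
    rw [this, coe_mem_unitDisc] at hx
    exact absurd hζ hx.ne
  have hsq : ∀ ζ : ℂ, ‖ζ‖ = 1 → Complex.normSq a + Complex.normSq b - Complex.normSq c
      - Complex.normSq d + 2 * ((a * (starRingEnd ℂ) b - c * (starRingEnd ℂ) d) * ζ).re = 0 := by
    intro ζ hζ
    have h1 : Complex.normSq (a * ζ + b) = Complex.normSq (c * ζ + d) := by
      rw [Complex.normSq_eq_norm_sq, Complex.normSq_eq_norm_sq, heq ζ hζ]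
    have h2 : Complex.normSq ζ = 1 := by rw [Complex.normSq_eq_norm_sq, hζ]; norm_num
    rw [Complex.normSq_add, Complex.normSq_add, Complex.normSq_mul, Complex.normSq_mul, h2] at h1
    have e : ((a * (starRingEnd ℂ) b - c * (starRingEnd ℂ) d) * ζ).re =
        (a * ζ * (starRingEnd ℂ) b).re - (c * ζ * (starRingEnd ℂ) d).re := by
      rw [← Complex.sub_re]; congr 1; ring
    rw [e]; linarith
  -- The values at `1`, `-1`, `i` determine the constant term and the linear coefficient of this
  -- trigonometric polynomial, so both vanish.
  have s1 := hsq 1 (by simp)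
  have s2 := hsq (-1) (by simp)
  have s3 := hsq Complex.I (by simp)
  have hm : a * (starRingEnd ℂ) b = c * (starRingEnd ℂ) d := by
    rw [← sub_eq_zero]
    set m := a * (starRingEnd ℂ) b - c * (starRingEnd ℂ) d
    simp only [mul_one, mul_neg, Complex.neg_re, Complex.mul_I_re] at s1 s2 s3
    apply Complex.ext <;> simp <;> linarith
  have hs : Complex.normSq a + Complex.normSq b = Complex.normSq c + Complex.normSq d := by
    rw [hm] at s1; simp at s1; linarith
  have hmc : (starRingEnd ℂ) a * b = (starRingEnd ℂ) c * d := by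
    have := congrArg (starRingEnd ℂ) hm
    simpa using this
  have h0 := hin 0 (by simp)
  simp only [mul_zero, zero_add] at h0
  -- This is the factor `k` by which the Hermitian form is multiplied; its positivity is the
  -- statement that `0` goes into the disc.
  have hk : 0 < Complex.normSq d - Complex.normSq b := by
    rw [Complex.normSq_eq_norm_sq, Complex.normSq_eq_norm_sq]
    nlinarith [norm_nonneg b]
  have hsC : a * (starRingEnd ℂ) a + b * (starRingEnd ℂ) b
      = c * (starRingEnd ℂ) c + d * (starRingEnd ℂ) d := by
    rw [Complex.mul_conj, Complex.mul_conj, Complex.mul_conj, Complex.mul_conj]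
    exact_mod_cast hs
  refine ⟨a, b, c, d, _, hk, ?_, hact, ?_⟩
  · have h1 : Complex.normSq (a * d - b * c) = (Complex.normSq d - Complex.normSq b) ^ 2 := by
      have : (Complex.normSq (a * d - b * c) : ℂ) = (Complex.normSq d - Complex.normSq b) ^ 2 := by
        rw [← Complex.mul_conj, ← Complex.mul_conj, ← Complex.mul_conj]
        simp only [map_sub, map_mul]
        linear_combination (d * (starRingEnd ℂ) d - b * (starRingEnd ℂ) b) * hsC
          - d * (starRingEnd ℂ) c * hm + b * (starRingEnd ℂ) a * hm
      exact_mod_cast this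
    rw [Complex.normSq_eq_norm_sq, sq_eq_sq₀ (norm_nonneg _) hk.le] at h1
    exact h1
  · intro η ζ
    push_cast
    rw [← Complex.mul_conj, ← Complex.mul_conj]
    simp only [map_add, map_mul]
    linear_combination (-ζ * hm) - (starRingEnd ℂ) η * hmc - ζ * (starRingEnd ℂ) η * hsC

/-- The Poisson kernel transforms like a density under automorphisms of the disc. -/
lemma poisson_moebius {a b c d : ℂ} {k : ℝ} (hk : 0 < k)
    (hform : ∀ η ζ : ℂ, (starRingEnd ℂ) (c * η + d) * (c * ζ + d)
      - (starRingEnd ℂ) (a * η + b) * (a * ζ + b) = k * (1 - (starRingEnd ℂ) η * ζ))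
    {h ζ : ℂ} (h1 : c * h + d ≠ 0) (h2 : c * ζ + d ≠ 0) :
    poisson ((a * h + b) / (c * h + d)) ((a * ζ + b) / (c * ζ + d)) =
      poisson h ζ * (‖c * ζ + d‖ ^ 2 / k) := by
  have e1 : 1 - ‖(a * h + b) / (c * h + d)‖ ^ 2 = k * (1 - ‖h‖ ^ 2) / ‖c * h + d‖ ^ 2 := by
    have := hform h h
    rw [mul_comm, Complex.mul_conj, mul_comm ((starRingEnd ℂ) (a * h + b)), Complex.mul_conj,
      mul_comm ((starRingEnd ℂ) h), Complex.mul_conj, Complex.normSq_eq_norm_sq,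
      Complex.normSq_eq_norm_sq, Complex.normSq_eq_norm_sq] at this
    norm_cast at this
    have hn : ‖c * h + d‖ ≠ 0 := norm_ne_zero_iff.2 h1
    rw [← this, norm_div, div_pow, sub_div, div_self (pow_ne_zero 2 hn)]
  have e2 : 1 - (starRingEnd ℂ) ((a * h + b) / (c * h + d)) * ((a * ζ + b) / (c * ζ + d)) =
      k * (1 - (starRingEnd ℂ) h * ζ) / ((starRingEnd ℂ) (c * h + d) * (c * ζ + d)) := by
    have h1' : (starRingEnd ℂ) (c * h + d) ≠ 0 := (map_ne_zero _).2 h1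
    rw [← hform h ζ, map_div₀, sub_div, div_self (mul_ne_zero h1' h2), div_mul_div_comm]
  have hn1 : ‖c * h + d‖ ≠ 0 := norm_ne_zero_iff.2 h1
  have hn2 : ‖c * ζ + d‖ ≠ 0 := norm_ne_zero_iff.2 h2
  rw [poisson, poisson, e1, e2, norm_div, norm_mul, norm_mul, RCLike.norm_conj, Complex.norm_real,
    Real.norm_eq_abs, abs_of_pos hk]
  by_cases h3 : ‖1 - (starRingEnd ℂ) h * ζ‖ = 0
  · rw [h3]; simp
  · field_simp

lemma dz_comp {E F : Type*} [NormedAddCommGroup E] [NormedSpace ℂ E] [NormedAddCommGroup F]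
    [NormedSpace ℂ F] {Ψ : E → F} {f : F → ℂ} {x : E} (hΨ : DifferentiableAt ℂ Ψ x)
    (hf : DifferentiableAt ℝ f (Ψ x)) (u : E) :
    dz u (fun y => f (Ψ y)) x = dz (fderiv ℂ Ψ x u) f (Ψ x) := by
  have := (hf.hasFDerivAt.comp x (hΨ.hasFDerivAt.restrictScalars ℝ)).fderiv
  simp only [Function.comp_def] at this
  simp only [dz, this]
  simp

lemma hasDerivAt_moebius {a b c d ζ : ℂ} (h : c * ζ + d ≠ 0) :
    HasDerivAt (fun ζ => (a * ζ + b) / (c * ζ + d)) ((a * d - b * c) / (c * ζ + d) ^ 2) ζ := by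
  have h1 : HasDerivAt (fun ζ => a * ζ + b) a ζ := by
    simpa using ((hasDerivAt_id ζ).const_mul a).add_const b
  have h2 : HasDerivAt (fun ζ => c * ζ + d) c ζ := by
    simpa using ((hasDerivAt_id ζ).const_mul c).add_const d
  exact (h1.fun_div h2 h).congr_deriv (by ring)

end Moebius

/-! ### Holomorphic charts as real charts, and the Levi form in an arbitrary chart. -/

section RealStructure

variable {E : Type*} [NormedAddCommGroup E] [NormedSpace ℂ E]

lemma contDiffGroupoid_complex_le_real (n : WithTop ℕ∞) :
    contDiffGroupoid n 𝓘(ℂ, E) ≤ contDiffGroupoid n 𝓘(ℝ, E) := by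
  rw [StructureGroupoid.le_iff]
  intro e he
  rw [contDiffGroupoid, mem_groupoid_of_pregroupoid] at he ⊢
  refine ⟨?_, ?_⟩
  · have := he.1
    simp only [contDiffPregroupoid, modelWithCornersSelf_coe, modelWithCornersSelf_coe_symm,
      Function.id_comp, Function.comp_id, preimage_id, range_id, inter_univ] at this ⊢
    exact this.restrict_scalars ℝ
  · have := he.2
    simp only [contDiffPregroupoid, modelWithCornersSelf_coe, modelWithCornersSelf_coe_symm,
      Function.id_comp, Function.comp_id, preimage_id, range_id, inter_univ] at this ⊢
    exact this.restrict_scalars ℝ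

variable {X : Type*} [TopologicalSpace X] [ChartedSpace E X]

lemma isManifold_real (n : WithTop ℕ∞) [h : IsManifold 𝓘(ℂ, E) n X] : IsManifold 𝓘(ℝ, E) n X where
  compatible := fun he he' => contDiffGroupoid_complex_le_real n (h.compatible he he')

lemma mem_maximalAtlas_real {n : WithTop ℕ∞} [IsManifold 𝓘(ℂ, E) n X]
    {a : OpenPartialHomeomorph X E} (ha : a ∈ IsManifold.maximalAtlas 𝓘(ℂ, E) n X) :
    a ∈ IsManifold.maximalAtlas 𝓘(ℝ, E) n X := fun e' he' =>
  ⟨contDiffGroupoid_complex_le_real n (ha e' he').1, contDiffGroupoid_complex_le_real n (ha e' he').2⟩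

section

variable [IsManifold 𝓘(ℂ, E) ω X]

/-- A function of class `C^n` is of class `C^n` in each holomorphic chart. -/
lemma ContMDiffAt.contDiffAt_chart {F : Type*} [NormedAddCommGroup F] [NormedSpace ℝ F]
    {n : WithTop ℕ∞} {f : X → F} {a : OpenPartialHomeomorph X E} {y : E}
    (ha : a ∈ IsManifold.maximalAtlas 𝓘(ℂ, E) ω X) (hy : y ∈ a.target)
    (hf : ContMDiffAt 𝓘(ℝ, E) 𝓘(ℝ, F) n f (a.symm y)) : ContDiffAt ℝ n (f ∘ a.symm) y := by
  have := isManifold_real (X := X) (E := E) ω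
  have h1 : ContMDiffAt 𝓘(ℝ, E) 𝓘(ℝ, E) n a.symm y :=
    ((contMDiffOn_symm_of_mem_maximalAtlas (mem_maximalAtlas_real ha)).contMDiffAt
      (a.open_target.mem_nhds hy)).of_le le_top
  exact (hf.comp y h1).contDiffAt

lemma contMDiffAt_of_contDiffAt_chart {F : Type*} [NormedAddCommGroup F] [NormedSpace ℝ F]
    {n : WithTop ℕ∞} {f : X → F} {a : OpenPartialHomeomorph X E} {x : X}
    (ha : a ∈ IsManifold.maximalAtlas 𝓘(ℂ, E) ω X) (hx : x ∈ a.source)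
    (hf : ContDiffAt ℝ n (f ∘ a.symm) (a x)) : ContMDiffAt 𝓘(ℝ, E) 𝓘(ℝ, F) n f x := by
  have := isManifold_real (X := X) (E := E) ω
  have h1 : ContMDiffAt 𝓘(ℝ, E) 𝓘(ℝ, E) n a x :=
    ((contMDiffOn_of_mem_maximalAtlas (mem_maximalAtlas_real ha)).contMDiffAt
      (a.open_source.mem_nhds hx)).of_le le_top
  refine (hf.contMDiffAt.comp x h1).congr_of_eventuallyEq ?_
  filter_upwards [a.open_source.mem_nhds hx] with y hy
  simp [a.left_inv hy]

end

/-- The derivative of a holomorphic change of charts. -/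
lemma exists_chart_deriv {a b : OpenPartialHomeomorph X E}
    (ha : a ∈ IsManifold.maximalAtlas 𝓘(ℂ, E) ω X) (hb : b ∈ IsManifold.maximalAtlas 𝓘(ℂ, E) ω X)
    {x : X} (hxa : x ∈ a.source) (hxb : x ∈ b.source) :
    ContDiffAt ℂ ω (a ∘ b.symm) (b x) ∧ ∃ A : E ≃L[ℂ] E,
      HasFDerivAt (a ∘ b.symm) (A : E →L[ℂ] E) (b x) := by
  have key {a b : OpenPartialHomeomorph X E} (ha : a ∈ IsManifold.maximalAtlas 𝓘(ℂ, E) ω X)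
      (hb : b ∈ IsManifold.maximalAtlas 𝓘(ℂ, E) ω X) (hxa : x ∈ a.source) (hxb : x ∈ b.source) :
      ContDiffAt ℂ ω (a ∘ b.symm) (b x) := by
    have h1 : ContMDiffAt 𝓘(ℂ, E) 𝓘(ℂ, E) ω b.symm (b x) :=
      (contMDiffOn_symm_of_mem_maximalAtlas hb).contMDiffAt
        (b.open_target.mem_nhds (b.map_source hxb))
    have h2 : ContMDiffAt 𝓘(ℂ, E) 𝓘(ℂ, E) ω a (b.symm (b x)) := by
      rw [b.left_inv hxb]
      exact (contMDiffOn_of_mem_maximalAtlas ha).contMDiffAt (a.open_source.mem_nhds hxa)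
    exact (h2.comp (b x) h1).contDiffAt
  have hab := key ha hb hxa hxb
  have hba := key hb ha hxb hxa
  refine ⟨hab, ?_⟩
  have d1 := (hab.differentiableAt (by simp)).hasFDerivAt
  have d2 := (hba.differentiableAt (by simp)).hasFDerivAt
  have e1 : (b ∘ a.symm) ∘ (a ∘ b.symm) =ᶠ[𝓝 (b x)] id := by
    have h1 : ∀ᶠ y in 𝓝 (b x), b.symm y ∈ a.source :=
      (b.continuousAt_symm (b.map_source hxb)).eventually
        (a.open_source.mem_nhds (by rwa [b.left_inv hxb]))
    filter_upwards [h1, b.open_target.mem_nhds (b.map_source hxb)] with y hy hy'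
    simp [a.left_inv hy, b.right_inv hy']
  have e2 : (a ∘ b.symm) ∘ (b ∘ a.symm) =ᶠ[𝓝 (a x)] id := by
    have h1 : ∀ᶠ y in 𝓝 (a x), a.symm y ∈ b.source :=
      (a.continuousAt_symm (a.map_source hxa)).eventually
        (b.open_source.mem_nhds (by rwa [a.left_inv hxa]))
    filter_upwards [h1, a.open_target.mem_nhds (a.map_source hxa)] with y hy hy'
    simp [b.left_inv hy, a.right_inv hy']
  have p1 : (a ∘ b.symm) (b x) = a x := by simp [b.left_inv hxb]
  have p2 : (b ∘ a.symm) (a x) = b x := by simp [a.left_inv hxa]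
  have c1 := ((p1 ▸ d2 : HasFDerivAt (b ∘ a.symm) (fderiv ℂ (b ∘ a.symm) (a x))
    ((a ∘ b.symm) (b x))).comp (b x) d1).unique
    ((hasFDerivAt_id (𝕜 := ℂ) (b x)).congr_of_eventuallyEq e1)
  have c2 := ((p2 ▸ d1 : HasFDerivAt (a ∘ b.symm) (fderiv ℂ (a ∘ b.symm) (b x))
    ((b ∘ a.symm) (a x))).comp (a x) d2).unique
    ((hasFDerivAt_id (𝕜 := ℂ) (a x)).congr_of_eventuallyEq e2)
  refine ⟨ContinuousLinearEquiv.equivOfInverse (fderiv ℂ (a ∘ b.symm) (b x))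
    (fderiv ℂ (b ∘ a.symm) (a x)) (fun v => ?_) (fun v => ?_), ?_⟩
  · exact congrArg (fun L : E →L[ℂ] E => L v) c1
  · exact congrArg (fun L : E →L[ℂ] E => L v) c2
  · exact d1

/-- The differential and the Levi form of a function in an arbitrary holomorphic chart. -/
lemma exists_leviForm_eq [IsManifold 𝓘(ℂ, E) ω X] {a : OpenPartialHomeomorph X E}
    (ha : a ∈ IsManifold.maximalAtlas 𝓘(ℂ, E) ω X) {x : X} (hx : x ∈ a.source) :
    ∃ A : E ≃L[ℂ] E, (A : E →L[ℂ] E) = fderiv ℂ (a ∘ (chartAt E x).symm) (chartAt E x x) ∧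
      ∀ f : X → ℝ, ContDiffAt ℝ 2 (f ∘ a.symm) (a x) →
      (∀ v, differential E f x v = fderiv ℝ (f ∘ a.symm) (a x) (A v)) ∧
      ∀ v w, leviForm E f x v w = leviE (f ∘ a.symm) (a x) (A v) (A w) := by
  obtain ⟨hc, A, hA⟩ := exists_chart_deriv ha (IsManifold.chart_mem_maximalAtlas (I := 𝓘(ℂ, E)) x)
    hx (mem_chart_source E x)
  refine ⟨A, hA.fderiv.symm, fun f hf => ?_⟩
  have p1 : (a ∘ (chartAt E x).symm) (chartAt E x x) = a x := by simp
  have e : f ∘ (chartAt E x).symm =ᶠ[𝓝 (chartAt E x x)]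
      (f ∘ a.symm) ∘ (a ∘ (chartAt E x).symm) := by
    have h1 : ∀ᶠ y in 𝓝 (chartAt E x x), (chartAt E x).symm y ∈ a.source :=
      ((chartAt E x).continuousAt_symm (mem_chart_target E x)).eventually
        (a.open_source.mem_nhds (by simpa using hx))
    filter_upwards [h1] with y hy
    simp [a.left_inv hy]
  rw [← p1] at hf
  constructor
  · intro v
    rw [differential, e.fderiv_eq, ((hf.differentiableAt (by norm_num)).hasFDerivAt.comp _
      (hA.restrictScalars ℝ)).fderiv, p1]
    rfl
  · intro v w
    rw [leviForm_eq_leviE, leviE_congr e, leviE_comp (hc.of_le le_top) hf, hA.fderiv, p1]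
    rfl

end RealStructure

/-! ### Flat coordinates on the `ℙ¹`-bundle, and the topology of the disc bundle. -/

section BundleTopology

open RiemannSphere

lemma closure_unitDisc : closure unitDisc = (↑) '' Metric.closedBall (0 : ℂ) 1 := by
  apply subset_antisymm
  · refine closure_minimal (image_mono Metric.ball_subset_closedBall) ?_
    exact ((isCompact_closedBall (0 : ℂ) 1).image OnePoint.continuous_coe).isClosed
  · rw [← closure_ball (0 : ℂ) one_ne_zero]
    exact image_closure_subset_closure_image OnePoint.continuous_coe

lemma isOpen_unitDisc : IsOpen unitDisc :=
  OnePoint.isOpenEmbedding_coe.isOpenMap _ Metric.isOpen_ball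

lemma frontier_unitDisc : frontier unitDisc = (↑) '' Metric.sphere (0 : ℂ) 1 := by
  rw [frontier, closure_unitDisc, isOpen_unitDisc.interior_eq, unitDisc,
    ← image_sdiff OnePoint.coe_injective, Metric.closedBall_sdiff_ball]

variable {C P : Type*} [TopologicalSpace C] [ChartedSpace ℂ C]
  [TopologicalSpace P] [ChartedSpace (ℂ × ℂ) P]

namespace DiscBundle

variable (B : DiscBundle C P)

/-- The coordinates `(z, ζ)` of the `ℙ¹`-bundle given by a flat trivialization and a preferred chart
of the base. -/
noncomputable def coord (e : Trivialization (OnePoint ℂ) B.proj) (x : C) :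
    OpenPartialHomeomorph P (ℂ × ℂ) :=
  e.toOpenPartialHomeomorph.trans ((chartAt ℂ x).prod chartZero)

variable {B} {e e' : Trivialization (OnePoint ℂ) B.proj} {x : C} {p : P}

lemma mem_coord_source : p ∈ (B.coord e x).source ↔ B.proj p ∈ e.baseSet ∧
    B.proj p ∈ (chartAt ℂ x).source ∧ (e p).2 ∈ range ((↑) : ℂ → OnePoint ℂ) := by
  simp only [coord, OpenPartialHomeomorph.trans_source, mem_inter_iff, mem_preimage,
    OpenPartialHomeomorph.prod_source, mem_prod, mem_chartZero_source]
  constructor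
  · rintro ⟨h1, h2, h3⟩
    have h1 : p ∈ e.source := h1
    refine ⟨e.mem_source.1 h1, ?_, h3⟩
    rw [← e.coe_fst h1]; exact h2
  · rintro ⟨h1, h2, h3⟩
    refine ⟨e.mem_source.2 h1, ?_, h3⟩
    have := e.coe_fst (e.mem_source.2 h1)
    rw [← this] at h2; exact h2

lemma coord_apply (hp : B.proj p ∈ e.baseSet) {ζ : ℂ} (hζ : (e p).2 = ζ) :
    B.coord e x p = (chartAt ℂ x (B.proj p), ζ) := by
  have h1 : B.coord e x p = (chartAt ℂ x (e p).1, chartZero (e p).2) := rfl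
  rw [h1, hζ, chartZero_coe, e.coe_fst (e.mem_source.2 hp)]

lemma coord_fst (hp : p ∈ (B.coord e x).source) :
    (B.coord e x p).1 = chartAt ℂ x (B.proj p) := by
  obtain ⟨h1, -, ζ, hζ⟩ := mem_coord_source.1 hp
  rw [coord_apply h1 hζ.symm]

lemma coe_coord_snd (hp : p ∈ (B.coord e x).source) : (e p).2 = ((B.coord e x p).2 : OnePoint ℂ) := by
  obtain ⟨h1, -, ζ, hζ⟩ := mem_coord_source.1 hp
  rw [coord_apply h1 hζ.symm, hζ]

lemma coord_snd (hp : p ∈ (B.coord e x).source) : (B.coord e x p).2 = toComplex (e p).2 := by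
  rw [coe_coord_snd hp]; rfl

lemma coord_symm (y : ℂ × ℂ) : (B.coord e x).symm y =
    e.toOpenPartialHomeomorph.symm ((chartAt ℂ x).symm y.1, (y.2 : OnePoint ℂ)) := rfl

lemma mem_coord_target {y : ℂ × ℂ} : y ∈ (B.coord e x).target ↔
    y.1 ∈ (chartAt ℂ x).target ∧ (chartAt ℂ x).symm y.1 ∈ e.baseSet := by
  simp [coord, Trivialization.target_eq, chartZero]

lemma proj_coord_symm {y : ℂ × ℂ} (hy : y ∈ (B.coord e x).target) :
    B.proj ((B.coord e x).symm y) = (chartAt ℂ x).symm y.1 := by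
  rw [coord_symm]
  exact e.proj_symm_apply' (mem_coord_target.1 hy).2

lemma transition_coeff (he : e ∈ B.trivs) (he' : e' ∈ B.trivs) (hx : x ∈ e.baseSet)
    (hx' : x ∈ e'.baseSet) : ∃ g : GL (Fin 2) ℂ, IsDiscAut g ∧ ∀ p : P, B.proj p = x →
      (e' p).2 = g • (e p).2 := by
  obtain ⟨g, hg, hev⟩ := B.transition e he e' he' x ⟨hx, hx'⟩
  refine ⟨g, hg, ?_⟩
  rintro p rfl
  have h1 : p ∈ e.source := e.mem_source.2 hx
  have := hev.self_of_nhds (e p).2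
  rw [show (B.proj p, (e p).2) = e p from Prod.ext (e.coe_fst h1).symm rfl] at this
  have h2 : e.toOpenPartialHomeomorph.symm (e p) = p := e.toOpenPartialHomeomorph.left_inv h1
  rw [h2] at this
  rw [this]

lemma smul_mem_unitDisc_iff {g : GL (Fin 2) ℂ} (hg : IsDiscAut g) (ζ : OnePoint ℂ) :
    g • ζ ∈ unitDisc ↔ ζ ∈ unitDisc := by
  constructor
  · intro h
    rw [← hg] at h
    obtain ⟨x, hx, hxe⟩ := h
    rwa [← MulAction.injective g hxe]
  · intro h
    rw [← hg]; exact ⟨ζ, h, rfl⟩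

/-- The transition maps preserve the unit disc, so membership can be tested in any one flat
trivialization. -/
lemma mem_disc_iff (he : e ∈ B.trivs) (hp : B.proj p ∈ e.baseSet) :
    p ∈ B.disc ↔ (e p).2 ∈ unitDisc := by
  constructor
  · rintro ⟨e', he', hp', h⟩
    obtain ⟨g, hg, h1⟩ := transition_coeff he' he hp' hp
    rw [h1 p rfl]
    exact (smul_mem_unitDisc_iff hg _).2 h
  · exact fun h => ⟨e, he, hp, h⟩

lemma isImage_disc (he : e ∈ B.trivs) :
    e.toOpenPartialHomeomorph.IsImage B.disc (univ ×ˢ unitDisc) := by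
  intro p hp
  have hp' : B.proj p ∈ e.baseSet := e.mem_source.1 hp
  rw [mem_disc_iff he hp']
  simp

lemma mem_frontier_disc_iff (he : e ∈ B.trivs) (hp : B.proj p ∈ e.baseSet) :
    p ∈ frontier B.disc ↔ ∃ ζ : ℂ, ‖ζ‖ = 1 ∧ (e p).2 = ζ := by
  have h1 := (isImage_disc he).frontier.apply_mem_iff (e.mem_source.2 hp)
  rw [← h1, frontier_univ_prod_eq, frontier_unitDisc]
  simp only [mem_prod, mem_univ, true_and, mem_image, mem_sphere_zero_iff_norm]
  exact ⟨fun ⟨ζ, a, b⟩ => ⟨ζ, a, b.symm⟩, fun ⟨ζ, a, b⟩ => ⟨ζ, a, b.symm⟩⟩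

lemma isOpen_disc (B : DiscBundle C P) : IsOpen B.disc := by
  rw [isOpen_iff_mem_nhds]
  intro p hp
  obtain ⟨e, he, hpe⟩ := B.cover (B.proj p)
  have h1 := (isImage_disc he).isOpen_iff.2 (show IsOpen (e.toOpenPartialHomeomorph.target ∩
    univ ×ˢ unitDisc) from e.open_target.inter (isOpen_univ.prod isOpen_unitDisc))
  exact mem_of_superset (h1.mem_nhds ⟨e.mem_source.2 hpe, hp⟩) inter_subset_right

lemma mem_disc_iff_coord (he : e ∈ B.trivs) (hp : p ∈ (B.coord e x).source) :
    p ∈ B.disc ↔ ‖(B.coord e x p).2‖ < 1 := by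
  rw [mem_disc_iff he (mem_coord_source.1 hp).1, coe_coord_snd hp, coe_mem_unitDisc]

lemma mem_frontier_iff_coord (he : e ∈ B.trivs) (hp : p ∈ (B.coord e x).source) :
    p ∈ frontier B.disc ↔ ‖(B.coord e x p).2‖ = 1 := by
  rw [mem_frontier_disc_iff he (mem_coord_source.1 hp).1, coe_coord_snd hp]
  simp

lemma mem_coord_source_of_frontier (he : e ∈ B.trivs) (hp : B.proj p ∈ e.baseSet)
    (hp' : B.proj p ∈ (chartAt ℂ x).source) (hf : p ∈ frontier B.disc) :
    p ∈ (B.coord e x).source := by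
  obtain ⟨ζ, -, h⟩ := (mem_frontier_disc_iff he hp).1 hf
  exact mem_coord_source.2 ⟨hp, hp', ζ, h.symm⟩

lemma coord_mem_maximalAtlas [IsManifold 𝓘(ℂ) ω C] [IsManifold 𝓘(ℂ, ℂ × ℂ) ω P] (he : e ∈ B.trivs) :
    B.coord e x ∈ IsManifold.maximalAtlas 𝓘(ℂ, ℂ × ℂ) ω P := by
  have hz : chartZero ∈ IsManifold.maximalAtlas 𝓘(ℂ) ω (OnePoint ℂ) :=
    StructureGroupoid.subset_maximalAtlas _ (Or.inl rfl)
  refine OpenPartialHomeomorph.mem_maximalAtlas_of_contMDiffOn _ ?_ ?_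
  · have h1 : ContMDiffOn (𝓘(ℂ).prod 𝓘(ℂ)) 𝓘(ℂ, ℂ × ℂ) ω
        (fun q : C × OnePoint ℂ => (chartAt ℂ x q.1, chartZero q.2))
        ((chartAt ℂ x).prod chartZero).source := by
      have a1 : ContMDiffOn (𝓘(ℂ).prod 𝓘(ℂ)) 𝓘(ℂ) ω
          (fun q : C × OnePoint ℂ => chartAt ℂ x q.1) ((chartAt ℂ x).prod chartZero).source :=
        (contMDiffOn_chart (I := 𝓘(ℂ)) (n := ω) (x := x)).comp contMDiff_fst.contMDiffOn
          (fun q hq => hq.1)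
      have a2 : ContMDiffOn (𝓘(ℂ).prod 𝓘(ℂ)) 𝓘(ℂ) ω
          (fun q : C × OnePoint ℂ => chartZero q.2) ((chartAt ℂ x).prod chartZero).source :=
        (contMDiffOn_of_mem_maximalAtlas hz).comp contMDiff_snd.contMDiffOn (fun q hq => hq.2)
      exact a1.prodMk_space a2
    refine h1.comp ((B.holomorphic e he).mono ?_) ?_
    · intro p hp
      exact e.mem_source.2 (mem_coord_source.1 hp).1
    · intro p hp
      exact hp.2
  · have h1 : ContMDiffOn 𝓘(ℂ, ℂ × ℂ) (𝓘(ℂ).prod 𝓘(ℂ)) ω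
        (fun y : ℂ × ℂ => ((chartAt ℂ x).symm y.1, (y.2 : OnePoint ℂ))) (B.coord e x).target := by
      have f1 : ContMDiffOn 𝓘(ℂ, ℂ × ℂ) 𝓘(ℂ) ω (fun y : ℂ × ℂ => y.1) (B.coord e x).target :=
        contDiff_fst.contMDiff.contMDiffOn
      have f2 : ContMDiffOn 𝓘(ℂ, ℂ × ℂ) 𝓘(ℂ) ω (fun y : ℂ × ℂ => y.2) (B.coord e x).target :=
        contDiff_snd.contMDiff.contMDiffOn
      have a1 := (contMDiffOn_chart_symm (I := 𝓘(ℂ)) (n := ω) (x := x)).comp f1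
          (fun q hq => (mem_coord_target.1 hq).1)
      have a2 := (contMDiffOn_symm_of_mem_maximalAtlas hz).comp f2
          (fun q hq => by simp [chartZero])
      exact a1.prodMk a2
    refine (B.holomorphic_symm e he).comp h1 ?_
    intro y hy
    have h2 : ((chartAt ℂ x).symm y.1, (y.2 : OnePoint ℂ)) ∈ e.target :=
      e.mem_target.2 (mem_coord_target.1 hy).2
    exact h2

/-- Over a small compact set `K` the total space is the image of the compact set `K × ℙ¹`, and
finitely many such `K` cover the base. -/
lemma compactSpace_total [CompactSpace C] (B : DiscBundle C P) : CompactSpace P := by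
  have hloc : LocallyCompactSpace C := ChartedSpace.locallyCompactSpace ℂ C
  have key : ∀ x : C, ∃ K : Set C, K ∈ 𝓝 x ∧ IsCompact (B.proj ⁻¹' K) := by
    intro x
    obtain ⟨e, he, hx⟩ := B.cover x
    obtain ⟨K, hK, hKe, hKc⟩ := local_compact_nhds (e.open_baseSet.mem_nhds hx)
    refine ⟨K, hK, ?_⟩
    have h1 : IsCompact (K ×ˢ (univ : Set (OnePoint ℂ))) := hKc.prod isCompact_univ
    have hsub : K ×ˢ (univ : Set (OnePoint ℂ)) ⊆ e.target := fun q hq => by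
      rw [e.mem_target]; exact hKe hq.1
    have h2 := h1.image_of_continuousOn (e.toOpenPartialHomeomorph.continuousOn_symm.mono hsub)
    convert h2 using 1
    ext p
    constructor
    · intro hp
      have hp' : p ∈ e.source := e.mem_source.2 (hKe hp)
      exact ⟨e p, ⟨by rw [e.coe_fst hp']; exact hp, mem_univ _⟩,
        e.toOpenPartialHomeomorph.left_inv hp'⟩
    · rintro ⟨q, hq, rfl⟩
      have := e.proj_symm_apply (hsub hq)
      rw [mem_preimage, this]
      exact hq.1
  choose K hK hKc using key
  obtain ⟨t, -, ht⟩ := isCompact_univ.elim_nhds_subcover K (fun x _ => hK x)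
  refine ⟨(t.isCompact_biUnion fun x _ => hKc x).of_isClosed_subset isClosed_univ fun p _ => ?_⟩
  have := ht (mem_univ (B.proj p))
  simpa using this

lemma isCompact_frontier_disc [CompactSpace C] (B : DiscBundle C P) :
    IsCompact (frontier B.disc) := by
  have := compactSpace_total B
  exact isClosed_frontier.isCompact

end DiscBundle

end BundleTopology

/-! ### From an inequality of Hermitian forms to eigenvalues. -/

section Eigenvalues

/-- Simultaneous diagonalization of a positive definite Hermitian form and a Hermitian form that is
larger. -/
lemma exists_orthonormal_eigenvectors {V : Type*} [AddCommGroup V] [Module ℂ V]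
    [FiniteDimensional ℂ V] {n : ℕ} (hn : Module.finrank ℂ V = n) (g : V →ₗ⋆[ℂ] V →ₗ[ℂ] ℂ)
    (L : V →ₗ⋆[ℂ] V →ₗ[ℂ] ℂ) (hg : ∀ v w, (starRingEnd ℂ) (g v w) = g w v)
    (hL : ∀ v w, (starRingEnd ℂ) (L v w) = L w v) (hpos : ∀ v, v ≠ 0 → 0 < (g v v).re)
    (hlt : ∀ v, v ≠ 0 → (g v v).re < (L v v).re) :
    ∃ (v : Fin n → V) (μ : Fin n → ℝ), (∀ i j, g (v i) (v j) = if i = j then 1 else 0) ∧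
      ∀ i, 1 < μ i ∧ ∀ w, L (v i) w = μ i * g (v i) w := by
  -- The form `g` itself is taken as the inner product, and `T` below is the operator that
  -- represents `L`. Its symmetric eigenbasis diagonalizes both forms.
  let core : InnerProductSpace.Core ℂ V :=
    { inner := fun v w => g v w
      conj_inner_symm := fun v w => hg w v
      re_inner_nonneg := fun v => by
        by_cases hv : v = 0
        · simp [hv]
        · exact (hpos v hv).le
      add_left := fun v w u => by simp
      smul_left := fun v w r => by simp
      definite := fun v hv => by
        by_contra h
        have h2 : (g v v).re = 0 := by
          have h3 : g v v = 0 := hv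
          rw [h3]; simp
        exact (hpos v h).ne' h2 }
  let _ : NormedAddCommGroup V := core.toNormedAddCommGroup
  let _ : InnerProductSpace ℂ V := InnerProductSpace.ofCore core.toCore
  have hinner (v w : V) : inner ℂ v w = g v w := rfl
  have : CompleteSpace V := FiniteDimensional.complete ℂ V
  let T : V →ₗ[ℂ] V :=
    { toFun := fun v => (InnerProductSpace.toDual ℂ V).symm (LinearMap.toContinuousLinearMap (L v))
      map_add' := fun v w => by rw [map_add, map_add, map_add]
      map_smul' := fun c v => by rw [LinearMap.map_smulₛₗ, map_smul, LinearIsometryEquiv.map_smulₛₗ]; simp }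
  have hT (v w : V) : inner ℂ (T v) w = L v w := by
    show inner ℂ ((InnerProductSpace.toDual ℂ V).symm (LinearMap.toContinuousLinearMap (L v))) w = _
    rw [InnerProductSpace.toDual_symm_apply]; rfl
  have hs : T.IsSymmetric := fun v w => by
    rw [hT, ← inner_conj_symm, hT, hL]
  refine ⟨hs.eigenvectorBasis hn, hs.eigenvalues hn, fun i j => ?_, fun i => ?_⟩
  · rw [← hinner]
    exact orthonormal_iff_ite.1 (hs.eigenvectorBasis hn).orthonormal i j
  · have h1 : ∀ w, L (hs.eigenvectorBasis hn i) w =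
        (hs.eigenvalues hn i : ℂ) * g (hs.eigenvectorBasis hn i) w := by
      intro w
      rw [← hT, hs.apply_eigenvectorBasis, inner_smul_left, hinner]
      simp
    refine ⟨?_, h1⟩
    have hb : g (hs.eigenvectorBasis hn i) (hs.eigenvectorBasis hn i) = 1 := by
      rw [← hinner]
      simp
    have hne : hs.eigenvectorBasis hn i ≠ 0 := by
      intro h0; rw [h0] at hb; simp at hb
    have h2 := hlt _ hne
    rw [h1, hb] at h2
    simpa using h2

variable {E : Type*} [NormedAddCommGroup E] [NormedSpace ℂ E]

/-- The Levi form of a function of class `C²` as a sesquilinear map. -/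
noncomputable def leviESesq (f : E → ℝ) (x : E) : E →ₗ⋆[ℂ] E →ₗ[ℂ] ℂ :=
  LinearMap.mk₂'ₛₗ (starRingEnd ℂ) (RingHom.id ℂ) (leviE f x)
    (leviE_add_left f x) (fun c v w => leviE_smul_left f x v w c)
    (leviE_add_right f x) (fun c v w => leviE_smul_right f x v w c)

lemma hasEigenvaluesGtOne_of_lt {X : Type*} [TopologicalSpace X] [ChartedSpace E X]
    [FiniteDimensional ℂ E] (g : HermitianMetric E X) {f : X → ℝ} {x : X}
    (hf : ContDiffAt ℝ 2 (f ∘ (chartAt E x).symm) (chartAt E x x))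
    (h : ∀ v, v ≠ 0 → (g.form x v v).re < (leviForm E f x v v).re) :
    HasEigenvaluesGtOne E g f x (Module.finrank ℂ E) :=
  exists_orthonormal_eigenvectors rfl (g.form x) (leviESesq (f ∘ (chartAt E x).symm) (chartAt E x x))
    (g.conj_symm x) (leviE_conj hf) (g.pos x) h

end Eigenvalues

/-! ### Existence of Hermitian metrics on a compact complex surface. -/

section Metric

variable {E : Type*} [NormedAddCommGroup E] [NormedSpace ℂ E]
  {X : Type*} [TopologicalSpace X] [ChartedSpace E X]

/-- A positive multiple of a Hermitian metric. -/
noncomputable def HermitianMetric.scale (g : HermitianMetric E X) (c : ℝ) (hc : 0 < c) :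
    HermitianMetric E X where
  form x := (c : ℂ) • g.form x
  conj_symm x v w := by simp [g.conj_symm]
  pos x v hv := by
    simp only [LinearMap.smul_apply, smul_eq_mul, Complex.re_ofReal_mul]
    exact mul_pos hc (g.pos x v hv)
  smooth a v w := by
    exact contDiffOn_const.mul (g.smooth a v w)

/-- The standard Hermitian form of `ℂ²`. -/
noncomputable def stdForm : (ℂ × ℂ) →ₗ⋆[ℂ] (ℂ × ℂ) →ₗ[ℂ] ℂ :=
  LinearMap.mk₂'ₛₗ (starRingEnd ℂ) (RingHom.id ℂ)
    (fun v w => (starRingEnd ℂ) v.1 * w.1 + (starRingEnd ℂ) v.2 * w.2)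
    (fun u v w => by simp; ring) (fun c v w => by simp; ring)
    (fun u v w => by simp; ring) (fun c v w => by simp; ring)

lemma stdForm_apply (v w : ℂ × ℂ) :
    stdForm v w = (starRingEnd ℂ) v.1 * w.1 + (starRingEnd ℂ) v.2 * w.2 := rfl

lemma stdForm_self_re (v : ℂ × ℂ) : (stdForm v v).re = Complex.normSq v.1 + Complex.normSq v.2 := by
  rw [stdForm_apply, mul_comm, Complex.mul_conj, mul_comm, Complex.mul_conj]; simp

lemma stdForm_pos {v : ℂ × ℂ} (hv : v ≠ 0) : 0 < (stdForm v v).re := by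
  rw [stdForm_self_re]
  have h1 := Complex.normSq_nonneg v.1
  have h2 := Complex.normSq_nonneg v.2
  by_contra! h
  apply hv
  have h3 : Complex.normSq v.1 = 0 := by linarith
  have h4 : Complex.normSq v.2 = 0 := by linarith
  exact Prod.ext (Complex.normSq_eq_zero.1 h3) (Complex.normSq_eq_zero.1 h4)

/-- The derivative of the chart at `a`, as a linear map on the tangent space at `x`. -/
noncomputable def chartDeriv (a x : X) : E →L[ℂ] E :=
  fderiv ℂ (chartAt E a ∘ (chartAt E x).symm) (chartAt E x x)

/-- The tangent space at `x` is identified with `E` by the preferred chart at `x`, which need not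
vary continuously with `x`. In this composition that chart cancels and only a transition map between
fixed charts remains, which is what makes smoothness of the metric checkable. -/
lemma chartDeriv_comp [IsManifold 𝓘(ℂ, E) ω X] (a b : X) {y : E} (hy : y ∈ (chartAt E a).target)
    (hb : (chartAt E a).symm y ∈ (chartAt E b).source) (v : E) :
    chartDeriv (E := E) b ((chartAt E a).symm y)
        ((mfderiv 𝓘(ℂ, E) 𝓘(ℂ, E) (chartAt E a).symm y : E →L[ℂ] E) v) =
      fderiv ℂ (chartAt E b ∘ (chartAt E a).symm) y v := by
  set x := (chartAt E a).symm y with hx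
  have hmd : MDifferentiableAt 𝓘(ℂ, E) 𝓘(ℂ, E) (chartAt E a).symm y :=
    mdifferentiableAt_atlas_symm (I := 𝓘(ℂ, E)) (chart_mem_atlas E a) hy
  have e1 : (mfderiv 𝓘(ℂ, E) 𝓘(ℂ, E) (chartAt E a).symm y : E →L[ℂ] E) =
      fderiv ℂ (chartAt E x ∘ (chartAt E a).symm) y := by
    rw [hmd.mfderiv]
    simp only [writtenInExtChartAt, extChartAt, mfld_simps, fderivWithin_univ]
    rfl
  have ha := IsManifold.chart_mem_maximalAtlas (I := 𝓘(ℂ, E)) (n := ω) a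
  have hbm := IsManifold.chart_mem_maximalAtlas (I := 𝓘(ℂ, E)) (n := ω) b
  have hxm := IsManifold.chart_mem_maximalAtlas (I := 𝓘(ℂ, E)) (n := ω) x
  have hay : chartAt E a x = y := (chartAt E a).right_inv hy
  have hxa : x ∈ (chartAt E a).source := (chartAt E a).map_target hy
  obtain ⟨c1, -⟩ := exists_chart_deriv hxm ha (mem_chart_source E x) hxa
  obtain ⟨c2, -⟩ := exists_chart_deriv hbm hxm hb (mem_chart_source E x)
  rw [hay] at c1
  have p : (chartAt E x ∘ (chartAt E a).symm) y = chartAt E x x := rfl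
  have e : chartAt E b ∘ (chartAt E a).symm =ᶠ[𝓝 y]
      (chartAt E b ∘ (chartAt E x).symm) ∘ (chartAt E x ∘ (chartAt E a).symm) := by
    have h1 : ∀ᶠ z in 𝓝 y, (chartAt E a).symm z ∈ (chartAt E x).source :=
      ((chartAt E a).continuousAt_symm hy).eventually (chart_source_mem_nhds E x)
    filter_upwards [h1] with z hz
    simp [(chartAt E x).left_inv hz]
  rw [← p] at c2
  have e2 := e.fderiv_eq (𝕜 := ℂ)
  rw [fderiv_comp y (c2.differentiableAt (by simp)) (c1.differentiableAt (by simp))] at e2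
  rw [e2]
  exact congrArg (fun L : E →L[ℂ] E => fderiv ℂ (chartAt E b ∘ (chartAt E x).symm) (chartAt E x x)
    (L v)) e1

lemma chartDeriv_eq_comp [IsManifold 𝓘(ℂ, E) ω X] {a : OpenPartialHomeomorph X E}
    (ha : a ∈ IsManifold.maximalAtlas 𝓘(ℂ, E) ω X) (b : X) {p : X} (hpa : p ∈ a.source)
    (hpb : p ∈ (chartAt E b).source) (v : E) :
    chartDeriv b p v = fderiv ℂ (chartAt E b ∘ a.symm) (a p)
      (fderiv ℂ (a ∘ (chartAt E p).symm) (chartAt E p p) v) := by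
  have hbm := IsManifold.chart_mem_maximalAtlas (I := 𝓘(ℂ, E)) (n := ω) b
  have hpm := IsManifold.chart_mem_maximalAtlas (I := 𝓘(ℂ, E)) (n := ω) p
  obtain ⟨c1, -⟩ := exists_chart_deriv ha hpm hpa (mem_chart_source E p)
  obtain ⟨c2, -⟩ := exists_chart_deriv hbm ha hpb hpa
  have e1 : (a ∘ (chartAt E p).symm) (chartAt E p p) = a p := by simp
  have e : chartAt E b ∘ (chartAt E p).symm =ᶠ[𝓝 (chartAt E p p)]
      (chartAt E b ∘ a.symm) ∘ (a ∘ (chartAt E p).symm) := by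
    have h1 : ∀ᶠ z in 𝓝 (chartAt E p p), (chartAt E p).symm z ∈ a.source :=
      ((chartAt E p).continuousAt_symm (mem_chart_target E p)).eventually
        (a.open_source.mem_nhds (by simpa using hpa))
    filter_upwards [h1] with z hz
    simp [a.left_inv hz]
  rw [← e1] at c2
  rw [chartDeriv, e.fderiv_eq,
    fderiv_comp _ (c2.differentiableAt (by simp)) (c1.differentiableAt (by simp)), e1]
  rfl

/-- A compact complex surface carries a Hermitian metric. In each holomorphic chart it is locally
bounded by the Euclidean metric. -/
lemma exists_hermitianMetric (X : Type*) [TopologicalSpace X] [ChartedSpace (ℂ × ℂ) X]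
    [IsManifold 𝓘(ℂ, ℂ × ℂ) ω X] [T2Space X] [CompactSpace X] :
    ∃ g : HermitianMetric (ℂ × ℂ) X, ∀ a ∈ IsManifold.maximalAtlas 𝓘(ℂ, ℂ × ℂ) ω X,
      ∀ q ∈ a.source, ∃ M > 0, ∀ᶠ p in 𝓝 q, ∀ v, (g.form p v v).re ≤
        M * ‖fderiv ℂ (a ∘ (chartAt (ℂ × ℂ) p).symm) (chartAt (ℂ × ℂ) p p) v‖ ^ 2 := by
  have hr : IsManifold 𝓘(ℝ, ℂ × ℂ) ω X := isManifold_real ω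
  have hr : IsManifold 𝓘(ℝ, ℂ × ℂ) ∞ X := IsManifold.of_le (n := ω) le_top
  have hχ (a : X) : Nonempty (SmoothBumpFunction 𝓘(ℝ, ℂ × ℂ) a) := by
    obtain ⟨f, -, -⟩ := (SmoothBumpFunction.nhds_basis_support (I := 𝓘(ℝ, ℂ × ℂ))
      (chart_source_mem_nhds (ℂ × ℂ) a)).mem_iff.1 (chart_source_mem_nhds (ℂ × ℂ) a)
    exact ⟨f⟩
  let χ (a : X) : SmoothBumpFunction 𝓘(ℝ, ℂ × ℂ) a := (hχ a).some
  obtain ⟨t, -, ht⟩ := isCompact_univ.elim_nhds_subcover (fun a : X => Function.support (χ a))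
    (fun a _ => (χ a).support_mem_nhds)
  -- Euclidean metrics of finitely many charts, glued by bump functions. Their supports cover, so no
  -- normalization to a partition of unity is needed for positivity.
  refine ⟨{ form := fun x => ∑ a ∈ t, ((χ a x : ℝ) : ℂ) •
              ((stdForm.comp (chartDeriv a x).toLinearMap).compl₂ (chartDeriv a x).toLinearMap)
            conj_symm := ?_, pos := ?_, smooth := ?_ }, ?_⟩
  · intro x v w
    simp only [LinearMap.sum_apply, LinearMap.smul_apply, map_sum, smul_eq_mul, map_mul,
      Complex.conj_ofReal]
    refine Finset.sum_congr rfl fun a _ => ?_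
    congr 1
    simp only [LinearMap.compl₂_apply, LinearMap.comp_apply, stdForm_apply]
    simp; ring
  · intro x v hv
    simp only [LinearMap.sum_apply, LinearMap.smul_apply, smul_eq_mul, Complex.re_sum,
      Complex.re_ofReal_mul]
    obtain ⟨a, ha, hxa⟩ : ∃ a ∈ t, x ∈ Function.support (χ a) := by
      simpa using ht (mem_univ x)
    refine Finset.sum_pos' (fun b _ => mul_nonneg (χ b).nonneg ?_) ⟨a, ha, mul_pos ?_ ?_⟩
    · simp only [LinearMap.compl₂_apply, LinearMap.comp_apply, stdForm_self_re]
      exact add_nonneg (Complex.normSq_nonneg _) (Complex.normSq_nonneg _)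
    · exact lt_of_le_of_ne (χ a).nonneg (Ne.symm hxa)
    · simp only [LinearMap.compl₂_apply, LinearMap.comp_apply]
      apply stdForm_pos
      obtain ⟨-, A, hA⟩ := exists_chart_deriv
        (IsManifold.chart_mem_maximalAtlas (I := 𝓘(ℂ, ℂ × ℂ)) (n := ω) a)
        (IsManifold.chart_mem_maximalAtlas (I := 𝓘(ℂ, ℂ × ℂ)) (n := ω) x)
        ((χ a).support_subset_source hxa) (mem_chart_source _ x)
      have : chartDeriv (E := ℂ × ℂ) a x = A := hA.fderiv
      rw [this]
      exact fun h => hv (A.injective (by simpa using h))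
  · intro a v w y hy
    apply ContDiffAt.contDiffWithinAt
    set L : ℂ × ℂ → (ℂ × ℂ →L[ℂ] ℂ × ℂ) := fun z =>
      mfderiv 𝓘(ℂ, ℂ × ℂ) 𝓘(ℂ, ℂ × ℂ) (chartAt (ℂ × ℂ) a).symm z with hL
    have hform (z : ℂ × ℂ) : (∑ b ∈ t, ((χ b ((chartAt (ℂ × ℂ) a).symm z) : ℝ) : ℂ) •
        ((stdForm.comp (chartDeriv b ((chartAt (ℂ × ℂ) a).symm z)).toLinearMap).compl₂
          (chartDeriv b ((chartAt (ℂ × ℂ) a).symm z)).toLinearMap)) (L z v) (L z w) =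
        ∑ b ∈ t, ((χ b ((chartAt (ℂ × ℂ) a).symm z) : ℝ) : ℂ) *
          stdForm (chartDeriv b ((chartAt (ℂ × ℂ) a).symm z) (L z v))
            (chartDeriv b ((chartAt (ℂ × ℂ) a).symm z) (L z w)) := by
      simp only [LinearMap.sum_apply, LinearMap.smul_apply, smul_eq_mul, LinearMap.compl₂_apply,
        LinearMap.comp_apply, ContinuousLinearMap.coe_coe]
    refine ContDiffAt.congr_of_eventuallyEq ?_ (Eventually.of_forall hform)
    refine ContDiffAt.sum fun b _ => ?_
    have hya : (chartAt (ℂ × ℂ) a).symm y ∈ (chartAt (ℂ × ℂ) a).source := (chartAt _ a).map_target hy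
    have hcont := (chartAt (ℂ × ℂ) a).continuousAt_symm hy
    -- On the closed support of the bump function its own chart is available; off it the summand
    -- vanishes nearby.
    by_cases hb : (chartAt (ℂ × ℂ) a).symm y ∈ tsupport (χ b)
    · have hbs := (χ b).tsupport_subset_chartAt_source hb
      obtain ⟨hc, -⟩ := exists_chart_deriv
        (IsManifold.chart_mem_maximalAtlas (I := 𝓘(ℂ, ℂ × ℂ)) (n := ω) b)
        (IsManifold.chart_mem_maximalAtlas (I := 𝓘(ℂ, ℂ × ℂ)) (n := ω) a) hbs hya
      rw [(chartAt (ℂ × ℂ) a).right_inv hy] at hc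
      have h1 : ContDiffAt ℝ ∞ (χ b ∘ (chartAt (ℂ × ℂ) a).symm) y :=
        ContMDiffAt.contDiffAt_chart (IsManifold.chart_mem_maximalAtlas a) hy (χ b).contMDiffAt
      have h2 (u : ℂ × ℂ) : ContDiffAt ℝ ∞
          (fun z => fderiv ℂ (chartAt (ℂ × ℂ) b ∘ (chartAt (ℂ × ℂ) a).symm) z u) y :=
        ((hc.fderiv_right (m := ∞) le_top).clm_apply contDiffAt_const).restrict_scalars ℝ
      have h3 : ContDiffAt ℝ ∞ (fun z => ((χ b ((chartAt (ℂ × ℂ) a).symm z) : ℝ) : ℂ) *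
          stdForm (fderiv ℂ (chartAt (ℂ × ℂ) b ∘ (chartAt (ℂ × ℂ) a).symm) z v)
            (fderiv ℂ (chartAt (ℂ × ℂ) b ∘ (chartAt (ℂ × ℂ) a).symm) z w)) y := by
        simp only [stdForm_apply]
        have f1 (u : ℂ × ℂ) := ContDiffAt.fst (h2 u)
        have f2 (u : ℂ × ℂ) := ContDiffAt.snd (h2 u)
        exact h1.ofReal.mul (((f1 v).conj.mul (f1 w)).add ((f2 v).conj.mul (f2 w)))
      refine h3.congr_of_eventuallyEq ?_
      filter_upwards [(chartAt (ℂ × ℂ) a).open_target.mem_nhds hy,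
        hcont.eventually ((chartAt (ℂ × ℂ) b).open_source.mem_nhds hbs)] with z hz hzb
      rw [← chartDeriv_comp a b hz hzb v, ← chartDeriv_comp a b hz hzb w]
      rfl
    · refine (contDiffAt_const (c := (0 : ℂ))).congr_of_eventuallyEq ?_
      have : ∀ᶠ z in 𝓝 y, (chartAt (ℂ × ℂ) a).symm z ∈ (tsupport (χ b))ᶜ :=
        hcont.eventually ((isClosed_tsupport _).isOpen_compl.mem_nhds hb)
      filter_upwards [this] with z hz
      have : χ b ((chartAt (ℂ × ℂ) a).symm z) = 0 := image_eq_zero_of_notMem_tsupport hz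
      rw [this]; simp
  · intro a ha q hq
    have key : ∀ b ∈ t, ∃ M > 0, ∀ᶠ p in 𝓝 q, ∀ v : ℂ × ℂ, χ b p *
        (stdForm (chartDeriv b p v) (chartDeriv b p v)).re ≤
        M * ‖fderiv ℂ (a ∘ (chartAt (ℂ × ℂ) p).symm) (chartAt (ℂ × ℂ) p p) v‖ ^ 2 := by
      intro b _
      by_cases hb : q ∈ tsupport (χ b)
      · have hbs := (χ b).tsupport_subset_chartAt_source hb
        obtain ⟨hc, -⟩ := exists_chart_deriv
          (IsManifold.chart_mem_maximalAtlas (I := 𝓘(ℂ, ℂ × ℂ)) (n := ω) b) ha hbs hq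
        have hcont : ContinuousAt (fun p => ‖fderiv ℂ (chartAt (ℂ × ℂ) b ∘ a.symm) (a p)‖) q :=
          (ContinuousAt.comp (f := a) (hc.fderiv_right (m := 0) le_top).continuousAt
            (a.continuousAt hq)).norm
        set R := ‖fderiv ℂ (chartAt (ℂ × ℂ) b ∘ a.symm) (a q)‖ + 1 with hR
        -- The norm of `ℂ × ℂ` is the maximum norm, so the Euclidean square is at most twice its
        -- square.
        refine ⟨2 * R ^ 2, by positivity, ?_⟩
        filter_upwards [hcont.eventually (gt_mem_nhds (lt_add_one _)), a.open_source.mem_nhds hq,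
          (chartAt (ℂ × ℂ) b).open_source.mem_nhds hbs] with p hp hpa hpb v
        rw [chartDeriv_eq_comp ha b hpa hpb, stdForm_self_re]
        set u := fderiv ℂ (a ∘ (chartAt (ℂ × ℂ) p).symm) (chartAt (ℂ × ℂ) p p) v
        set w := fderiv ℂ (chartAt (ℂ × ℂ) b ∘ a.symm) (a p) u with hw
        have h1 : ‖w‖ ≤ R * ‖u‖ :=
          (ContinuousLinearMap.le_opNorm _ _).trans
            (mul_le_mul_of_nonneg_right hp.le (norm_nonneg _))
        have h2 : ‖w‖ ^ 2 ≤ (R * ‖u‖) ^ 2 := pow_le_pow_left₀ (norm_nonneg _) h1 2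
        have h3 : Complex.normSq w.1 ≤ ‖w‖ ^ 2 := by
          rw [Complex.normSq_eq_norm_sq]
          exact pow_le_pow_left₀ (norm_nonneg _) (norm_fst_le w) 2
        have h4 : Complex.normSq w.2 ≤ ‖w‖ ^ 2 := by
          rw [Complex.normSq_eq_norm_sq]
          exact pow_le_pow_left₀ (norm_nonneg _) (norm_snd_le w) 2
        have h5 := Complex.normSq_nonneg w.1
        have h6 := Complex.normSq_nonneg w.2
        calc χ b p * (Complex.normSq w.1 + Complex.normSq w.2)
            ≤ 1 * (Complex.normSq w.1 + Complex.normSq w.2) :=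
              mul_le_mul_of_nonneg_right (χ b).le_one (by positivity)
          _ ≤ 2 * (R * ‖u‖) ^ 2 := by linarith
          _ = 2 * R ^ 2 * ‖u‖ ^ 2 := by ring
      · refine ⟨1, one_pos, ?_⟩
        filter_upwards [(isClosed_tsupport _).isOpen_compl.mem_nhds hb] with p hp v
        rw [image_eq_zero_of_notMem_tsupport hp]
        simp only [zero_mul]
        positivity
    choose! M hM hev using key
    refine ⟨∑ b ∈ t, M b + 1, add_pos_of_nonneg_of_pos
      (Finset.sum_nonneg fun b hb => (hM b hb).le) one_pos, ?_⟩
    filter_upwards [(eventually_all_finset _).2 hev] with p hp v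
    have h1 := Finset.sum_le_sum fun b hb => hp b hb v
    rw [← Finset.sum_mul] at h1
    simp only [LinearMap.sum_apply, LinearMap.smul_apply, smul_eq_mul, Complex.re_sum,
      Complex.re_ofReal_mul, LinearMap.compl₂_apply, LinearMap.comp_apply]
    refine h1.trans ?_
    exact mul_le_mul_of_nonneg_right (by linarith) (by positivity)

end Metric

/-! ### The weight given by the harmonic section. -/

section SectionFacts

open RiemannSphere

variable {C P : Type*} [TopologicalSpace C] [ChartedSpace ℂ C]
  [TopologicalSpace P] [ChartedSpace (ℂ × ℂ) P]

namespace DiscBundle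

variable {B : DiscBundle C P} {e : Trivialization (OnePoint ℂ) B.proj} {x y : C} {s : C → P}

lemma coe_localSection (hs : B.IsHarmonicSection s) (he : e ∈ B.trivs) (hy : y ∈ e.baseSet)
    (hyx : y ∈ (chartAt ℂ x).source) :
    (e (s y)).2 = (B.localSection s e x (chartAt ℂ x y) : OnePoint ℂ) := by
  have h1 : (e (s y)).2 ∈ unitDisc :=
    (mem_disc_iff he (by rw [hs.1]; exact hy)).1 (hs.2.1 y)
  obtain ⟨ζ, -, h⟩ := h1
  rw [localSection, (chartAt ℂ x).left_inv hyx, ← h]; rfl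

lemma norm_localSection_lt (hs : B.IsHarmonicSection s) (he : e ∈ B.trivs) (hy : y ∈ e.baseSet)
    (hyx : y ∈ (chartAt ℂ x).source) : ‖B.localSection s e x (chartAt ℂ x y)‖ < 1 := by
  rw [← coe_mem_unitDisc, ← coe_localSection hs he hy hyx]
  exact (mem_disc_iff he (by rw [hs.1]; exact hy)).1 (hs.2.1 y)

lemma localSection_eventuallyEq (s : C → P) (e : Trivialization (OnePoint ℂ) B.proj)
    (hyx : y ∈ (chartAt ℂ x).source) : B.localSection s e x =ᶠ[𝓝 (chartAt ℂ x y)]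
      B.localSection s e y ∘ (chartAt ℂ y ∘ (chartAt ℂ x).symm) := by
  have h1 : ∀ᶠ z in 𝓝 (chartAt ℂ x y), (chartAt ℂ x).symm z ∈ (chartAt ℂ y).source :=
    ((chartAt ℂ x).continuousAt_symm ((chartAt ℂ x).map_source hyx)).eventually
      (by rw [(chartAt ℂ x).left_inv hyx]; exact chart_source_mem_nhds ℂ y)
  filter_upwards [h1] with z hz
  simp [localSection, (chartAt ℂ y).left_inv hz]

variable [IsManifold 𝓘(ℂ) ω C]

lemma contDiffAt_chart_change (hyx : y ∈ (chartAt ℂ x).source) :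
    ContDiffAt ℂ ω (chartAt ℂ y ∘ (chartAt ℂ x).symm) (chartAt ℂ x y) :=
  (exists_chart_deriv (IsManifold.chart_mem_maximalAtlas (I := 𝓘(ℂ)) (n := ω) y)
    (IsManifold.chart_mem_maximalAtlas (I := 𝓘(ℂ)) (n := ω) x) (mem_chart_source ℂ y) hyx).1

lemma contDiffAt_localSection (hs : B.IsHarmonicSection s) (he : e ∈ B.trivs) (hy : y ∈ e.baseSet)
    (hyx : y ∈ (chartAt ℂ x).source) :
    ContDiffAt ℝ 2 (B.localSection s e x) (chartAt ℂ x y) := by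
  refine ContDiffAt.congr_of_eventuallyEq ?_ (localSection_eventuallyEq s e hyx)
  refine ContDiffAt.comp _ ?_ (((contDiffAt_chart_change hyx).restrict_scalars ℝ).of_le le_top)
  simpa [(chartAt ℂ x).left_inv hyx] using (hs.2.2 e he y hy).1

/-- The harmonic map equation is available at `y` in the preferred chart at `y`. A holomorphic
change of charts multiplies the Levi form by the square of the modulus of its derivative, so the
sign carries over to the chart at `x`. -/
lemma leviE_localSection_nonneg (hs : B.IsHarmonicSection s) (he : e ∈ B.trivs)
    (hy : y ∈ e.baseSet) (hyx : y ∈ (chartAt ℂ x).source) {ζ : ℂ} (hζ : ‖ζ‖ = 1) :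
    0 ≤ (leviE (fun z => -Real.log (poisson (B.localSection s e x z) ζ)) (chartAt ℂ x y) 1 1).re := by
  have hτ := contDiffAt_chart_change (x := x) hyx
  have hτy : (chartAt ℂ y ∘ (chartAt ℂ x).symm) (chartAt ℂ x y) = chartAt ℂ y y := by
    simp [(chartAt ℂ x).left_inv hyx]
  have hlt := norm_localSection_lt (x := y) hs he hy (mem_chart_source ℂ y)
  have hF : ContDiffAt ℝ 2 (fun z => -Real.log (poisson (B.localSection s e y z) ζ))
      (chartAt ℂ y y) :=
    contDiffAt_log_poisson (hs.2.2 e he y hy).1 contDiffAt_const hlt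
      (one_sub_conj_mul_ne_zero hlt hζ.le)
  have e1 : (fun z => -Real.log (poisson (B.localSection s e x z) ζ)) =ᶠ[𝓝 (chartAt ℂ x y)]
      (fun z => -Real.log (poisson (B.localSection s e y z) ζ)) ∘
        (chartAt ℂ y ∘ (chartAt ℂ x).symm) := by
    filter_upwards [localSection_eventuallyEq s e hyx] with z hz
    rw [hz]; rfl
  rw [leviE_congr e1, leviE_comp (hτ.of_le le_top) (by rwa [hτy]), hτy]
  have h1 := leviE_poisson_nonneg (hs.2.2 e he y hy) hlt hζ
  set c := fderiv ℂ (chartAt ℂ y ∘ (chartAt ℂ x).symm) (chartAt ℂ x y) 1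
  rw [show c = c • (1 : ℂ) by simp, leviE_smul_left, leviE_smul_right, ← mul_assoc, mul_comm _ c,
    Complex.mul_conj, Complex.re_ofReal_mul]
  exact mul_nonneg (Complex.normSq_nonneg _) h1

lemma continuous_section (hs : B.IsHarmonicSection s) : Continuous s := by
  rw [continuous_iff_continuousAt]
  intro x
  obtain ⟨e, he, hx⟩ := B.cover x
  have h1 := contDiffAt_localSection hs he hx (mem_chart_source ℂ x)
  have h2 : ContinuousAt (fun y => B.localSection s e x (chartAt ℂ x y)) x :=
    ContinuousAt.comp (f := chartAt ℂ x) h1.continuousAt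
      ((chartAt ℂ x).continuousAt (mem_chart_source ℂ x))
  have h3 : ContinuousAt (fun y => (y, (B.localSection s e x (chartAt ℂ x y) : OnePoint ℂ))) x :=
    continuousAt_id.prodMk (OnePoint.continuous_coe.continuousAt.comp h2)
  have h4 : ContinuousAt e.toOpenPartialHomeomorph.symm
      (x, (B.localSection s e x (chartAt ℂ x x) : OnePoint ℂ)) :=
    e.toOpenPartialHomeomorph.continuousAt_symm (e.mem_target.2 hx)
  refine (ContinuousAt.comp (f := fun y => (y, (B.localSection s e x (chartAt ℂ x y) : OnePoint ℂ)))
    h4 h3).congr ?_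
  filter_upwards [chart_source_mem_nhds ℂ x, e.open_baseSet.mem_nhds hx] with y hy hye
  have h5 : s y ∈ e.source := e.mem_source.2 (by rw [hs.1]; exact hye)
  simp only [Function.comp_apply]
  rw [← coe_localSection hs he hye hy]
  have h6 : (y, (e (s y)).2) = e (s y) := Prod.ext (by rw [e.coe_fst h5, hs.1]) rfl
  rw [h6]
  exact e.toOpenPartialHomeomorph.left_inv h5

end DiscBundle

lemma leviE_slice {f : ℂ × ℂ → ℝ} {y : ℂ × ℂ} (hf : ContDiffAt ℝ 2 f y) :
    leviE f y (1, 0) (1, 0) = leviE (fun z => f (z, y.2)) y.1 1 1 := by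
  have h1 : HasFDerivAt (fun z : ℂ => (z, y.2)) (ContinuousLinearMap.inl ℂ ℂ ℂ) y.1 :=
    hasFDerivAt_prodMk_left _ _
  have h2 : ContDiffAt ℂ 2 (fun z : ℂ => (z, y.2)) y.1 := contDiffAt_id.prodMk contDiffAt_const
  have := leviE_comp (Ψ := fun z : ℂ => (z, y.2)) (f := f) h2 hf 1 1
  rw [h1.fderiv] at this
  exact this.symm

lemma leviE_normSq_sub (c : ℂ) (z : ℂ) : leviE (fun z => Complex.normSq (z - c)) z 1 1 = 1 := by
  have hc : ContDiffAt ℝ 2 (fun z => Complex.normSq (z - c)) z :=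
    contDiffAt_normSq (contDiffAt_id.sub contDiffAt_const)
  have hd (w : ℂ) : DifferentiableAt ℝ (fun z => z - c) w := by fun_prop
  have hid (w u : ℂ) : fderiv ℝ (fun z : ℂ => z - c) w u = u := by
    rw [fderiv_sub_const, fderiv_fun_id]; rfl
  have a1 (w : ℂ) : dz 1 (fun z : ℂ => z - c) w = 1 := by
    simp only [dz, hid, smul_eq_mul, mul_one, Complex.I_mul_I]; ring
  have a2 (w : ℂ) : dzb 1 (fun z : ℂ => z - c) w = 0 := by
    simp only [dzb, hid, smul_eq_mul, mul_one, Complex.I_mul_I]; ring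
  have h1 : (fun z => ((Complex.normSq (z - c) : ℝ) : ℂ)) =
      fun z => (z - c) * (starRingEnd ℂ) (z - c) := by
    ext w; rw [Complex.mul_conj]
  have h2 : dzb 1 (fun z => (z - c) * (starRingEnd ℂ) (z - c)) = fun w => w - c := by
    ext w
    have hdc : DifferentiableAt ℝ (fun z => (starRingEnd ℂ) (z - c)) w :=
      Complex.conjCLE.differentiableAt.comp w (hd w)
    rw [dzb_mul (hd w) hdc, a2, dzb_conj, a1]
    simp
  rw [leviE_eq_dz_dzb hc, h1, h2, a1]

/-- A smooth function that is strictly subharmonic at finitely many given points of a Riemann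
surface. -/
lemma exists_subharmonic_at [T2Space C] [IsManifold 𝓘(ℂ) ω C] {Z : Set C} (hZ : Z.Finite) :
    ∃ ψ : C → ℝ, ContMDiff 𝓘(ℝ, ℂ) 𝓘(ℝ, ℝ) ∞ ψ ∧
      ∀ a ∈ Z, leviE (ψ ∘ (chartAt ℂ a).symm) (chartAt ℂ a a) 1 1 = 1 := by
  classical
  have hr : IsManifold 𝓘(ℝ, ℂ) ω C := isManifold_real ω
  have hr : IsManifold 𝓘(ℝ, ℂ) ∞ C := IsManifold.of_le (n := ω) le_top
  -- The support avoids the other points of `Z`, so that near each point of `Z` only its own summand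
  -- `|z - z_a|²` is present.
  have hχ (a : C) : ∃ χ : SmoothBumpFunction 𝓘(ℝ, ℂ) a, tsupport χ ⊆ (Z \ {a})ᶜ := by
    have h1 : (Z \ {a})ᶜ ∈ 𝓝 a :=
      (hZ.subset sdiff_subset).isClosed.isOpen_compl.mem_nhds (by simp)
    obtain ⟨χ, -, h⟩ := (SmoothBumpFunction.nhds_basis_tsupport (I := 𝓘(ℝ, ℂ)) a).mem_iff.1 h1
    exact ⟨χ, h⟩
  choose χ hχ using hχ
  let ψ (a : C) : C → ℝ := fun x => χ a x • Complex.normSq (chartAt ℂ a x - chartAt ℂ a a)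
  have hψ (a : C) : ContMDiff 𝓘(ℝ, ℂ) 𝓘(ℝ, ℝ) ∞ (ψ a) := by
    apply (χ a).contMDiff_smul
    intro x hx
    apply ContMDiffAt.contMDiffWithinAt
    refine contMDiffAt_of_contDiffAt_chart (IsManifold.chart_mem_maximalAtlas a) hx ?_
    refine ContDiffAt.congr_of_eventuallyEq (f := fun z => Complex.normSq (z - chartAt ℂ a a))
      (contDiffAt_normSq (contDiffAt_id.sub contDiffAt_const)) ?_
    filter_upwards [(chartAt ℂ a).open_target.mem_nhds ((chartAt ℂ a).map_source hx)] with z hz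
    simp [(chartAt ℂ a).right_inv hz]
  refine ⟨fun x => ∑ a ∈ hZ.toFinset, ψ a x, contMDiff_finsetSum fun a _ => hψ a, fun a ha => ?_⟩
  have hc : Tendsto (chartAt ℂ a).symm (𝓝 (chartAt ℂ a a)) (𝓝 a) := by
    have := (chartAt ℂ a).continuousAt_symm (mem_chart_target ℂ a)
    rwa [ContinuousAt, (chartAt ℂ a).left_inv (mem_chart_source ℂ a)] at this
  have h0 (b : C) (hb : b ∈ hZ.toFinset.erase a) :
      ∀ᶠ z in 𝓝 (chartAt ℂ a a), ψ b ((chartAt ℂ a).symm z) = 0 := by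
    have h1 : a ∉ tsupport (χ b) := fun h => hχ b h ⟨ha, fun h' => by
      rw [mem_singleton_iff] at h'; simp [h'] at hb⟩
    filter_upwards [hc.eventually ((isClosed_tsupport _).isOpen_compl.mem_nhds h1)] with z hz
    simp [ψ, image_eq_zero_of_notMem_tsupport hz]
  have h1 : ∀ᶠ z in 𝓝 (chartAt ℂ a a), ∀ b ∈ hZ.toFinset.erase a,
      ψ b ((chartAt ℂ a).symm z) = 0 := (eventually_all_finset _).2 h0
  have h2 : (fun x => ∑ a ∈ hZ.toFinset, ψ a x) ∘ (chartAt ℂ a).symm =ᶠ[𝓝 (chartAt ℂ a a)]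
      fun z => Complex.normSq (z - chartAt ℂ a a) := ?_
  · rw [leviE_congr h2, leviE_normSq_sub]
  filter_upwards [h1, (chartAt ℂ a).open_target.mem_nhds (mem_chart_target ℂ a),
    hc.eventually (χ a).eventuallyEq_one] with z hz hzt hz1
  simp only [Function.comp_apply]
  rw [← Finset.add_sum_erase _ _ (hZ.mem_toFinset.2 ha), Finset.sum_eq_zero hz]
  simp only [Pi.one_apply] at hz1
  simp [ψ, hz1, (chartAt ℂ a).right_inv hzt]

namespace DiscBundle

variable (B : DiscBundle C P) in
/-- The weight `-log poisson + ψ` in the coordinates `(z, ζ)`. -/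
noncomputable def logWeight (s : C → P) (ψ : C → ℝ) (e : Trivialization (OnePoint ℂ) B.proj) (x : C)
    (y : ℂ × ℂ) : ℝ :=
  -Real.log (poisson (B.localSection s e x y.1) y.2) + ψ ((chartAt ℂ x).symm y.1)

variable {B : DiscBundle C P} {e : Trivialization (OnePoint ℂ) B.proj} {x : C} {s : C → P}
  [IsManifold 𝓘(ℂ) ω C]

lemma contDiffAt_comp_chart_symm {ψ : C → ℝ} (hψ : ContMDiff 𝓘(ℝ, ℂ) 𝓘(ℝ, ℝ) ∞ ψ) {z : ℂ}
    (hz : z ∈ (chartAt ℂ x).target) : ContDiffAt ℝ 2 (ψ ∘ (chartAt ℂ x).symm) z :=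
  (ContMDiffAt.contDiffAt_chart (IsManifold.chart_mem_maximalAtlas x) hz
    hψ.contMDiffAt).of_le (WithTop.coe_le_coe.2 le_top)

lemma contDiffAt_log_poisson_coord (hs : B.IsHarmonicSection s) (he : e ∈ B.trivs) {y : ℂ × ℂ}
    (hy : y ∈ (B.coord e x).target) (hζ : ‖y.2‖ = 1) : ContDiffAt ℝ 2
      (fun y : ℂ × ℂ => -Real.log (poisson (B.localSection s e x y.1) y.2)) y := by
  obtain ⟨h1, h2⟩ := mem_coord_target.1 hy
  have h3 := (chartAt ℂ x).map_target h1
  have h4 := norm_localSection_lt hs he h2 h3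
  have h5 := contDiffAt_localSection hs he h2 h3
  rw [(chartAt ℂ x).right_inv h1] at h4 h5
  exact contDiffAt_log_poisson (h5.comp y contDiffAt_fst) contDiffAt_snd h4
    (one_sub_conj_mul_ne_zero h4 hζ.le)

lemma contDiffAt_comp_chart_symm_fst {ψ : C → ℝ} (hψ : ContMDiff 𝓘(ℝ, ℂ) 𝓘(ℝ, ℝ) ∞ ψ) {y : ℂ × ℂ}
    (hy : y ∈ (B.coord e x).target) :
    ContDiffAt ℝ 2 (fun y : ℂ × ℂ => ψ ((chartAt ℂ x).symm y.1)) y :=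
  (contDiffAt_comp_chart_symm hψ (mem_coord_target.1 hy).1).comp y contDiffAt_fst

lemma contDiffAt_logWeight (hs : B.IsHarmonicSection s) (he : e ∈ B.trivs) {ψ : C → ℝ}
    (hψ : ContMDiff 𝓘(ℝ, ℂ) 𝓘(ℝ, ℝ) ∞ ψ) {y : ℂ × ℂ}
    (hy : y ∈ (B.coord e x).target) (hζ : ‖y.2‖ = 1) : ContDiffAt ℝ 2 (B.logWeight s ψ e x) y :=
  (contDiffAt_log_poisson_coord hs he hy hζ).add (contDiffAt_comp_chart_symm_fst hψ hy)

/-- The Poisson part has nonnegative Levi form along the leaves, and positive Levi form away from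
the critical points, where a small multiple of `ψ₀` does no harm. Over a critical point `ψ₀`
contributes a positive amount. Compactness of `∂D` yields one factor `ε` that works everywhere. -/
lemma exists_logWeight_pos [CompactSpace C] [T2Space C] (hs : B.IsHarmonicSection s)
    (hcrit : (B.criticalPoints s).Finite) : ∃ ψ : C → ℝ, ContMDiff 𝓘(ℝ, ℂ) 𝓘(ℝ, ℝ) ∞ ψ ∧
      ∀ q ∈ frontier B.disc, ∃ e ∈ B.trivs, ∃ x, q ∈ (B.coord e x).source ∧
        0 < (leviE (B.logWeight s ψ e x) (B.coord e x q) (1, 0) (1, 0)).re := by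
  obtain ⟨ψ₀, hψ₀, hpos⟩ := exists_subharmonic_at hcrit
  have key : ∀ q ∈ frontier B.disc, ∃ e ∈ B.trivs, ∃ x, ∃ ε₀ > 0, ∀ᶠ p in 𝓝 q,
      p ∈ frontier B.disc → ∀ ε ∈ Ioo 0 ε₀, p ∈ (B.coord e x).source ∧
        0 < (leviE (B.logWeight s (fun x => ε * ψ₀ x) e x) (B.coord e x p) (1, 0) (1, 0)).re := by
    intro q hq
    obtain ⟨e, he, hqe⟩ := B.cover (B.proj q)
    set x := B.proj q with hx
    have hqs : q ∈ (B.coord e x).source :=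
      mem_coord_source_of_frontier he hqe (mem_chart_source ℂ x) hq
    refine ⟨e, he, x, ?_⟩
    set u : ℂ × ℂ → ℝ := fun y => -Real.log (poisson (B.localSection s e x y.1) y.2) with hu
    set v : ℂ × ℂ → ℝ := fun y => ψ₀ ((chartAt ℂ x).symm y.1) with hv
    have hfront {p : P} (hp : p ∈ (B.coord e x).source) (hpf : p ∈ frontier B.disc) :
        ContDiffAt ℝ 2 u (B.coord e x p) ∧ ContDiffAt ℝ 2 v (B.coord e x p) :=
      ⟨contDiffAt_log_poisson_coord hs he ((B.coord e x).map_source hp)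
        ((mem_frontier_iff_coord he hp).1 hpf),
      contDiffAt_comp_chart_symm_fst hψ₀ ((B.coord e x).map_source hp)⟩
    have hsum {p : P} (hp : p ∈ (B.coord e x).source) (hpf : p ∈ frontier B.disc) (ε : ℝ) :
        (leviE (B.logWeight s (fun x => ε * ψ₀ x) e x) (B.coord e x p) (1, 0) (1, 0)).re =
          (leviE u (B.coord e x p) (1, 0) (1, 0)).re +
            ε * (leviE v (B.coord e x p) (1, 0) (1, 0)).re := by
      obtain ⟨h1, h2⟩ := hfront hp hpf
      have : leviE (B.logWeight s (fun x => ε * ψ₀ x) e x) (B.coord e x p) (1, 0) (1, 0) =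
          leviE (fun y => u y + ε * v y) (B.coord e x p) (1, 0) (1, 0) := rfl
      rw [this, leviE_add h1 (contDiffAt_const.mul h2), leviE_const_mul ε h2, Complex.add_re,
        Complex.re_ofReal_mul]
    have hnn {p : P} (hp : p ∈ (B.coord e x).source) (hpf : p ∈ frontier B.disc) :
        0 ≤ (leviE u (B.coord e x p) (1, 0) (1, 0)).re := by
      rw [leviE_slice (hfront hp hpf).1, coord_fst hp]
      obtain ⟨h1, h2, -⟩ := mem_coord_source.1 hp
      exact leviE_localSection_nonneg hs he h1 h2 ((mem_frontier_iff_coord he hp).1 hpf)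
    have hcoord : ContinuousAt (B.coord e x) q := (B.coord e x).continuousAt hqs
    have hcu : ContinuousAt (fun p => (leviE u (B.coord e x p) (1, 0) (1, 0)).re) q :=
      Complex.continuous_re.continuousAt.comp
        (ContinuousAt.comp (f := B.coord e x)
          (continuousAt_leviE (hfront hqs hq).1 continuousAt_const continuousAt_const) hcoord)
    have hcv : ContinuousAt (fun p => (leviE v (B.coord e x p) (1, 0) (1, 0)).re) q :=
      Complex.continuous_re.continuousAt.comp
        (ContinuousAt.comp (f := B.coord e x)
          (continuousAt_leviE (hfront hqs hq).2 continuousAt_const continuousAt_const) hcoord)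
    have hsrc := (B.coord e x).open_source.mem_nhds hqs
    by_cases hxc : x ∈ B.criticalPoints s
    · have h1 : 0 < (leviE v (B.coord e x q) (1, 0) (1, 0)).re := by
        rw [leviE_slice (hfront hqs hq).2, coord_fst hqs]
        have := hpos x hxc
        rw [Function.comp_def] at this
        simp only [hv]
        rw [← hx, this]
        simp
      refine ⟨1, one_pos, ?_⟩
      filter_upwards [hcv.eventually (lt_mem_nhds h1), hsrc] with p hp hps hpf ε hε
      refine ⟨hps, ?_⟩
      rw [hsum hps hpf]
      have := mul_pos hε.1 hp
      linarith [hnn hps hpf]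
    · have h1 : 0 < (leviE u (B.coord e x q) (1, 0) (1, 0)).re := by
        rw [leviE_slice (hfront hqs hq).1, coord_fst hqs]
        refine leviE_poisson_pos (hs.2.2 e he x hqe)
          (norm_localSection_lt hs he hqe (mem_chart_source ℂ x))
          ((mem_frontier_iff_coord he hqs).1 hq) ?_
        by_contra h
        exact hxc ⟨e, he, hqe, h⟩
      set c := (leviE u (B.coord e x q) (1, 0) (1, 0)).re with hc
      -- Near `q` the Poisson part exceeds `c / 2` while the other part is at most `ε M < c / 2` in
      -- modulus.
      set M := |(leviE v (B.coord e x q) (1, 0) (1, 0)).re| + 1 with hM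
      have hM0 : 0 < M := by positivity
      refine ⟨c / 2 / M, by positivity, ?_⟩
      filter_upwards [hcu.eventually (lt_mem_nhds (half_lt_self h1)),
        hcv.abs.eventually (gt_mem_nhds (lt_add_one _)), hsrc] with p hp hpv hps hpf ε hε
      refine ⟨hps, ?_⟩
      rw [hsum hps hpf]
      have h2 : ε * M < c / 2 := (lt_div_iff₀ hM0).1 hε.2
      have h3 : |ε * (leviE v (B.coord e x p) (1, 0) (1, 0)).re| ≤ ε * M := by
        rw [abs_mul, abs_of_pos hε.1]
        exact mul_le_mul_of_nonneg_left hpv.le hε.1.le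
      linarith [(abs_le.1 h3).1]
  choose e he x ε₀ hε₀ hev using key
  obtain ⟨t, hcov⟩ := (isCompact_frontier_disc B).elim_nhds_subcover' _ hev
  -- Half of the minimum, because the admissible intervals are open.
  obtain ⟨ε, hε, hεt⟩ : ∃ ε > 0, ∀ q ∈ t, ε < ε₀ q q.2 := by
    rcases t.eq_empty_or_nonempty with rfl | hne
    · exact ⟨1, one_pos, by simp⟩
    · obtain ⟨q, hq, hmin⟩ := t.exists_min_image (fun q => ε₀ q q.2) hne
      have := hε₀ q q.2
      exact ⟨ε₀ q q.2 / 2, by positivity, fun q' hq' => by linarith [hmin q' hq']⟩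
  refine ⟨fun x => ε * ψ₀ x, contMDiff_const.mul hψ₀, fun q hq => ?_⟩
  obtain ⟨a, ha, hqa⟩ := mem_iUnion₂.1 (hcov hq)
  exact ⟨e a a.2, he a a.2, x a a.2, hqa hq ε ⟨hε, hεt a ha⟩⟩

end DiscBundle

end SectionFacts

/-! ### The domain bounded by a graph in a collar. -/

section Collar

/-- The inverse of a continuous injective map on a compact set is continuous. -/
lemma continuousOn_inverse_of_isCompact {X : Type*} [TopologicalSpace X] {Y : Type*} [TopologicalSpace Y] [T2Space Y] {f : X → Y}
    {g : Y → X} {N : Set X} {M : Set Y} (hN : IsCompact N) (hf : ContinuousOn f N)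
    (hinj : InjOn f N) (hg : ∀ y ∈ M, g y ∈ N ∧ f (g y) = y) : ContinuousOn g M := by
  rw [continuousOn_iff_isClosed]
  intro t ht
  refine ⟨f '' (N ∩ t), ((hN.inter_right ht).image_of_continuousOn
    (hf.mono inter_subset_left)).isClosed, ?_⟩
  ext y
  constructor
  · rintro ⟨h1, h2⟩
    exact ⟨⟨g y, ⟨(hg y h2).1, h1⟩, (hg y h2).2⟩, h2⟩
  · rintro ⟨⟨p, ⟨hp, hpt⟩, rfl⟩, h2⟩
    refine ⟨?_, h2⟩
    have := hinj (hg _ h2).1 hp (hg _ h2).2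
    rw [mem_preimage, this]
    exact hpt

/-- A domain whose boundary is a graph over the boundary of another domain, in a collar. -/
lemma exists_displaced_domain {X : Type*} [TopologicalSpace X] [T2Space X] {D U : Set X}
    {base : X → X} {height : X → ℝ} {σ : X → ℝ} {a : ℝ}
    (ha : 0 < a) (hD : IsOpen D) (hDc : IsConnected D) (hU : IsOpen U)
    (hbase : ContinuousOn base U) (hheight : ContinuousOn height U)
    (hσ : ContinuousOn (σ ∘ base) U) (hmaps : MapsTo base U (frontier D))
    (hzero : ∀ p ∈ frontier D, p ∈ U ∧ height p = 0)
    (hinj : InjOn (fun p => (base p, height p)) U)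
    (hN : IsCompact {p | p ∈ U ∧ |height p| ≤ a})
    (hsurj : ∀ b ∈ frontier D, ∀ t, |t| ≤ a → ∃ p ∈ U, base p = b ∧ height p = t)
    (hside : ∀ p ∈ U, |height p| ≤ a → (p ∈ D ↔ height p < 0))
    (hsmall : ∀ b ∈ frontier D, |σ b| ≤ a / 2) :
    ∃ Ω : Set X, IsOpen Ω ∧ IsConnected Ω ∧ frontier Ω = {p | p ∈ U ∧ height p = σ (base p)} ∧
      Ω \ U = D \ U ∧ ∀ p ∈ U, |height p| ≤ a → (p ∈ Ω ↔ height p < σ (base p)) := by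
  set N := {p | p ∈ U ∧ |height p| ≤ a} with hNdef
  have hNc : IsClosed N := hN.isClosed
  have hNU : N ⊆ U := fun p hp => hp.1
  have hσp {p : X} (hp : p ∈ U) : |σ (base p)| ≤ a / 2 := hsmall _ (hmaps hp)
  set O : Set X := {p | p ∈ U ∧ |height p| < a} with hO
  have hOo : IsOpen O := by
    have := hheight.abs.isOpen_inter_preimage hU (isOpen_Iio (a := a))
    exact this
  -- Outside the collar `N` the domain is unchanged, and inside it the graph of `σ` replaces the
  -- zero section.
  set Ω : Set X := {p | p ∈ D ∧ p ∉ N} ∪ {p | p ∈ N ∧ height p < σ (base p)} with hΩ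
  have hmem : ∀ p ∈ N, (p ∈ Ω ↔ height p < σ (base p)) := by
    intro p hp
    constructor
    · rintro (h | h)
      · exact absurd hp h.2
      · exact h.2
    · exact fun h => Or.inr ⟨hp, h⟩
  have hmem' : ∀ p ∉ N, (p ∈ Ω ↔ p ∈ D) := by
    intro p hp
    constructor
    · rintro (h | h)
      · exact h.1
      · exact absurd h.1 hp
    · exact fun h => Or.inl ⟨h, hp⟩
  have hopen : IsOpen Ω := by
    have h1 : IsClosed (N ∩ {p | |height p| ≤ a / 2}) :=
      (hheight.abs.mono hNU).preimage_isClosed_of_isClosed hNc (isClosed_Iic (a := a / 2))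
    have h2 : IsOpen (O ∩ {p | height p < σ (base p)}) := by
      have h3 : ContinuousOn (fun p => σ (base p) - height p) O :=
        (hσ.sub hheight).mono fun p hp => hp.1
      have := h3.isOpen_inter_preimage hOo (isOpen_Ioi (a := 0))
      convert this using 2
      ext p; simp
    -- Openness is seen from another description: where `a / 2 < |height|`, `Ω` agrees with `D`
    -- because `|σ| ≤ a / 2`, and these points overlap the open collar.
    convert (hD.inter h1.isOpen_compl).union h2 using 1
    ext p
    constructor
    · rintro (⟨h, h'⟩ | ⟨h, h'⟩)
      · exact Or.inl ⟨h, fun h'' => h' h''.1⟩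
      · have h3 := abs_le.1 (hσp h.1)
        have h4 := abs_le.1 h.2
        by_cases h5 : |height p| < a
        · exact Or.inr ⟨⟨h.1, h5⟩, h'⟩
        · refine Or.inl ⟨(hside p h.1 h.2).2 ?_, fun h6 => ?_⟩
          · by_contra! h7
            rw [abs_of_nonneg h7] at h5
            linarith
          · have := h6.2
            simp only [mem_ofPred_eq] at this
            linarith
    · rintro (⟨h, h'⟩ | ⟨h, h'⟩)
      · by_cases hp : p ∈ N
        · have h3 : ¬ |height p| ≤ a / 2 := fun h4 => h' ⟨hp, h4⟩
          have h4 := (hside p hp.1 hp.2).1 h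
          rw [abs_of_neg h4] at h3
          refine Or.inr ⟨hp, ?_⟩
          linarith [(abs_le.1 (hσp hp.1)).1]
        · exact Or.inl ⟨h, hp⟩
      · exact Or.inr ⟨⟨h.1, h.2.le⟩, h'⟩
  have hsurj' : ∀ q : X × ℝ, ∃ p, q ∈ frontier D ×ˢ Icc (-a) a →
      p ∈ N ∧ (base p, height p) = q := by
    intro q
    by_cases hq : q ∈ frontier D ×ˢ Icc (-a) a
    · obtain ⟨p, hp, h1, h2⟩ := hsurj q.1 hq.1 q.2 (abs_le.2 hq.2)
      exact ⟨p, fun _ => ⟨⟨hp, by rw [h2]; exact abs_le.2 hq.2⟩, Prod.ext h1 h2⟩⟩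
    · exact ⟨q.1, fun h => absurd h hq⟩
  -- `Φ` inverts `(base, height)` on the compact collar, hence is continuous.
  choose Φ hΦ using hsurj'
  have hΦc : ContinuousOn Φ (frontier D ×ˢ Icc (-a) a) :=
    continuousOn_inverse_of_isCompact hN ((hbase.prodMk hheight).mono hNU) (hinj.mono hNU) hΦ
  have hΦb {b : X} {t : ℝ} (hb : b ∈ frontier D) (ht : t ∈ Icc (-a) a) :
      Φ (b, t) ∈ N ∧ base (Φ (b, t)) = b ∧ height (Φ (b, t)) = t := by
    obtain ⟨h1, h2⟩ := hΦ (b, t) ⟨hb, ht⟩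
    exact ⟨h1, congrArg Prod.fst h2, congrArg Prod.snd h2⟩
  have hΦp {p : X} (hp : p ∈ N) : Φ (base p, height p) = p := by
    obtain ⟨h1, h2, h3⟩ := hΦb (hmaps hp.1) (abs_le.1 hp.2)
    exact hinj h1.1 hp.1 (Prod.ext h2 h3)
  have hfront : frontier Ω = {p | p ∈ U ∧ height p = σ (base p)} := by
    rw [hopen.frontier_eq]
    apply subset_antisymm
    · rintro p ⟨hpc, hpn⟩
      have hdisj : p ∈ closure D → p ∉ D → p ∈ N ∧ height p = 0 := by
        intro h1 h2
        have h3 : p ∈ frontier D := by rw [hD.frontier_eq]; exact ⟨h1, h2⟩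
        obtain ⟨h4, h5⟩ := hzero p h3
        exact ⟨⟨h4, by rw [h5, abs_zero]; exact ha.le⟩, h5⟩
      by_cases hpN : p ∈ N
      · have h1 := not_lt.1 (fun h => hpn ((hmem p hpN).2 h))
        by_cases h2 : |height p| < a
        · refine ⟨hpN.1, le_antisymm ?_ h1⟩
          have h3 : ContinuousWithinAt (fun p => σ (base p) - height p) Ω p :=
            ((hσ.sub hheight).continuousAt (hU.mem_nhds hpN.1)).continuousWithinAt
          have h4 : ∀ᶠ q in 𝓝[Ω] p, 0 ≤ σ (base q) - height q := by
            filter_upwards [self_mem_nhdsWithin,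
              nhdsWithin_le_nhds (hOo.mem_nhds (show p ∈ O from ⟨hpN.1, h2⟩))] with q hq hqO
            linarith [(hmem q ⟨hqO.1, hqO.2.le⟩).1 hq]
          have : (𝓝[Ω] p).NeBot := mem_closure_iff_nhdsWithin_neBot.1 hpc
          linarith [ge_of_tendsto h3 h4]
        · exfalso
          have h3 := abs_le.1 (hσp hpN.1)
          have h4 : height p = a := by
            rcases le_or_gt 0 (height p) with h | h
            · have := hpN.2
              rw [abs_of_nonneg h] at h2 this
              linarith
            · rw [abs_of_neg h] at h2
              linarith
          have h5 : p ∈ closure D := by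
            rw [mem_closure_iff_frequently] at hpc ⊢
            have h6 : ∀ᶠ q in 𝓝 p, q ∈ U ∧ a / 2 < height q :=
              (hU.eventually_mem hpN.1).and ((hheight.continuousAt (hU.mem_nhds hpN.1)).eventually
                (lt_mem_nhds (by linarith)))
            refine (hpc.and_eventually h6).mono ?_
            rintro q ⟨hq, hqU, hqa⟩
            have hqN : q ∉ N := fun h => by
              have := (hmem q h).1 hq
              linarith [(abs_le.1 (hσp hqU)).2]
            exact (hmem' q hqN).1 hq
          have h6 := hdisj h5 (fun h => by linarith [(hside p hpN.1 hpN.2).1 h])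
          linarith [h6.2]
      · exfalso
        have h1 : p ∈ closure D := by
          rw [mem_closure_iff_frequently] at hpc ⊢
          refine (hpc.and_eventually (hNc.isOpen_compl.mem_nhds hpN)).mono ?_
          rintro q ⟨hq, hqN⟩
          exact (hmem' q hqN).1 hq
        exact hpN (hdisj h1 (fun h => hpn ((hmem' p hpN).2 h))).1
    · rintro p ⟨hp, hpσ⟩
      have h1 := abs_le.1 (hσp hp)
      have hpN : p ∈ N := ⟨hp, by rw [hpσ]; linarith [hσp hp]⟩
      refine ⟨?_, fun h => ((hmem p hpN).1 h).ne hpσ⟩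
      -- A point of the graph is the limit of the points below it on the same fibre of the collar.
      have hc : ContinuousWithinAt (fun t => Φ (base p, t)) (Ico (-a) (σ (base p)))
          (σ (base p)) := by
        have h2 : ContinuousOn (fun t => Φ (base p, t)) (Icc (-a) a) :=
          hΦc.comp (by fun_prop) fun t ht => ⟨hmaps hp, ht⟩
        exact (h2 _ ⟨by linarith, by linarith⟩).mono fun t ht => ⟨ht.1, by linarith [ht.2]⟩
      have h3 : σ (base p) ∈ closure (Ico (-a) (σ (base p))) := by
        rw [closure_Ico (by linarith)]
        exact ⟨by linarith, le_rfl⟩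
      have h4 := hc.mem_closure h3 (t := Ω) (fun t ht => by
        have h5 := hΦb (hmaps hp) (show t ∈ Icc (-a) a from ⟨ht.1, by linarith [ht.2]⟩)
        refine (hmem _ h5.1).2 ?_
        rw [h5.2.1, h5.2.2]
        exact ht.2)
      rw [← hpσ, hΦp hpN] at h4
      exact h4
  refine ⟨Ω, hopen, ?_, hfront, ?_, fun p hp hpa => hmem p ⟨hp, hpa⟩⟩
  · classical
    set s : Set X := N ∩ {p | height p ≤ 0} with hs
    have hsc : IsClosed s :=
      (hheight.mono hNU).preimage_isClosed_of_isClosed hNc (isClosed_Iic (a := (0 : ℝ)))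
    -- The affine map of `[-a, 0]` onto `[-a, σ]` in each fibre. It fixes `-a`, so the map `F` below
    -- glues with the identity, and `Ω = F(D)` is connected.
    set τ : X → ℝ := fun p => -a + (height p + a) * (σ (base p) + a) / a with hτ
    have hτc : ContinuousOn τ U := by
      have := hσ
      simp only [hτ]
      exact continuousOn_const.add ((((hheight.add continuousOn_const).mul
        (hσ.add continuousOn_const))).div_const a)
    have hτm {p : X} (hp : p ∈ s) : τ p ∈ Icc (-a) (σ (base p)) ∧
        (height p < 0 → τ p < σ (base p)) := by
      have h1 := abs_le.1 (hσp hp.1.1)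
      have h2 := abs_le.1 hp.1.2
      have h3 : height p ≤ 0 := hp.2
      have h4 : τ p = σ (base p) + height p * (σ (base p) + a) / a := by
        simp only [hτ]; field_simp; ring
      refine ⟨⟨?_, ?_⟩, fun h => ?_⟩
      · have : 0 ≤ (height p + a) * (σ (base p) + a) / a :=
          div_nonneg (mul_nonneg (by linarith) (by linarith)) ha.le
        simp only [hτ]; linarith
      · have : height p * (σ (base p) + a) / a ≤ 0 :=
          div_nonpos_of_nonpos_of_nonneg (mul_nonpos_of_nonpos_of_nonneg h3 (by linarith)) ha.le
        linarith
      · have : height p * (σ (base p) + a) / a < 0 :=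
          div_neg_of_neg_of_pos (mul_neg_of_neg_of_pos h (by linarith)) ha
        linarith
    have hτI {p : X} (hp : p ∈ s) : τ p ∈ Icc (-a) a :=
      ⟨(hτm hp).1.1, by linarith [(hτm hp).1.2, (abs_le.1 (hσp hp.1.1)).2]⟩
    set F : X → X := fun p => if p ∈ s then Φ (base p, τ p) else p with hF
    have hFs : ∀ p ∈ s, F p = Φ (base p, τ p) := fun p hp => if_pos hp
    have hFO : ∀ p ∈ Oᶜ, F p = p := by
      intro p hp
      by_cases h : p ∈ s
      · rw [hFs p h]
        have h1 : height p = -a := by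
          have h2 : ¬ |height p| < a := fun h2 => hp ⟨h.1.1, h2⟩
          have h3 : height p ≤ 0 := h.2
          have h4 := abs_le.1 h.1.2
          rw [abs_of_nonpos h3] at h2
          linarith
        have h2 : τ p = height p := by simp only [hτ, h1]; simp
        rw [h2, hΦp h.1]
      · exact if_neg h
    have hFc : ContinuousOn F (s ∪ Oᶜ) := by
      refine ContinuousOn.union_of_isClosed ?_ ?_ hsc hOo.isClosed_compl
      · refine ContinuousOn.congr ?_ hFs
        refine hΦc.comp ((hbase.prodMk hτc).mono fun p hp => hp.1.1) fun p hp => ?_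
        exact ⟨hmaps hp.1.1, hτI hp⟩
      · exact continuousOn_id.congr hFO
    have hDs : D ⊆ s ∪ Oᶜ := by
      intro p hp
      by_cases h : p ∈ O
      · exact Or.inl ⟨⟨h.1, h.2.le⟩, ((hside p h.1 h.2.le).1 hp).le⟩
      · exact Or.inr h
    have himg : F '' D = Ω := by
      apply subset_antisymm
      · rintro _ ⟨p, hp, rfl⟩
        by_cases h : p ∈ s
        · rw [hFs p h]
          obtain ⟨h1, h2, h3⟩ := hΦb (hmaps h.1.1) (hτI h)
          rw [hmem _ h1, h2, h3]
          exact (hτm h).2 ((hside p h.1.1 h.1.2).1 hp)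
        · have : F p = p := if_neg h
          rw [this]
          refine (hmem' p fun hpN => h ⟨hpN, ?_⟩).2 hp
          exact ((hside p hpN.1 hpN.2).1 hp).le
      · intro p hp
        by_cases hpN : p ∈ N
        · have h1 := (hmem p hpN).1 hp
          have h2 := abs_le.1 (hσp hpN.1)
          have h3 := abs_le.1 hpN.2
          have hpos : 0 < σ (base p) + a := by linarith
          -- The inverse of the affine stretching `τ`.
          set t := -a + (height p + a) * a / (σ (base p) + a) with ht
          have ht0 : t < 0 := by
            have : (height p + a) * a / (σ (base p) + a) < a := by
              rw [div_lt_iff₀ hpos]; nlinarith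
            linarith
          have hta : -a ≤ t := by
            have : 0 ≤ (height p + a) * a / (σ (base p) + a) :=
              div_nonneg (mul_nonneg (by linarith) ha.le) hpos.le
            linarith
          obtain ⟨k1, k2, k3⟩ := hΦb (hmaps hpN.1) (show t ∈ Icc (-a) a from ⟨hta, by linarith⟩)
          refine ⟨Φ (base p, t), (hside _ k1.1 k1.2).2 (by rw [k3]; exact ht0), ?_⟩
          rw [hFs _ ⟨k1, by rw [mem_ofPred_eq, k3]; exact ht0.le⟩]
          have : τ (Φ (base p, t)) = height p := by
            change -a + (height (Φ (base p, t)) + a) * (σ (base (Φ (base p, t))) + a) / a = _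
            rw [k2, k3, ht]
            field_simp
            ring
          rw [this, k2, hΦp hpN]
        · refine ⟨p, (hmem' p hpN).1 hp, ?_⟩
          exact if_neg fun h => hpN h.1
    rw [← himg]
    exact hDc.image F (hFc.mono hDs)
  · ext p
    constructor
    · rintro ⟨h, hp⟩
      exact ⟨(hmem' p fun h' => hp h'.1).1 h, hp⟩
    · rintro ⟨h, hp⟩
      exact ⟨(hmem' p fun h' => hp h'.1).2 h, hp⟩

end Collar

/-! ### Tubular neighbourhoods in local coordinates. -/

section TubularCoordinates

/-- Normal form of a tubular neighbourhood of the hypersurface `{|ζ| = 1}`. -/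
lemma exists_tubular_normal_form {b : ℂ × ℂ → ℂ × ℂ} {h : ℂ × ℂ → ℝ} {y₀ : ℂ × ℂ}
    (hb : ContDiffAt ℝ ω b y₀) (hh : ContDiffAt ℝ ω h y₀) (hb0 : b y₀ = y₀) (hh0 : h y₀ = 0)
    (hbS : ∀ᶠ y in 𝓝 y₀, ‖(b y).2‖ = 1)
    (himm : ∀ v, fderiv ℝ b y₀ v = 0 → fderiv ℝ h y₀ v = 0 → v = 0) :
    map (fun y => ((b y).1, (b y).2 * (1 + (h y : ℂ)))) (𝓝 y₀) = 𝓝 y₀ ∧ fderiv ℝ h y₀ ≠ 0 := by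
  set Θ : ℂ × ℂ → ℂ × ℂ := fun y => ((b y).1, (b y).2 * (1 + (h y : ℂ))) with hΘ
  set L := fderiv ℝ b y₀ with hL
  set l := fderiv ℝ h y₀ with hl
  have hζ0 : ‖y₀.2‖ = 1 := by have := hbS.self_of_nhds; rwa [hb0] at this
  have db : HasFDerivAt b L y₀ := (hb.differentiableAt (by simp)).hasFDerivAt
  have dh : HasFDerivAt h l y₀ := (hh.differentiableAt (by simp)).hasFDerivAt
  have dh' : HasFDerivAt (fun y => 1 + (h y : ℂ)) (Complex.ofRealCLM.comp l) y₀ :=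
    (Complex.ofRealCLM.hasFDerivAt.comp y₀ dh).const_add 1
  have db2 : HasFDerivAt (fun y => (b y).2) ((ContinuousLinearMap.snd ℝ ℂ ℂ).comp L) y₀ :=
    (ContinuousLinearMap.snd ℝ ℂ ℂ).hasFDerivAt.comp y₀ db
  have db1 : HasFDerivAt (fun y => (b y).1) ((ContinuousLinearMap.fst ℝ ℂ ℂ).comp L) y₀ :=
    (ContinuousLinearMap.fst ℝ ℂ ℂ).hasFDerivAt.comp y₀ db
  have hΘc : ContDiffAt ℝ ω Θ y₀ :=
    (contDiffAt_fst.comp y₀ hb).prodMk ((contDiffAt_snd.comp y₀ hb).mul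
      (contDiffAt_const.add hh.ofReal))
  have dΘ : HasFDerivAt Θ _ y₀ := db1.prodMk (db2.mul dh')
  have hΘ0 : Θ y₀ = y₀ := by simp [hΘ, hb0, hh0]
  set M : ℂ × ℂ →L[ℝ] ℂ × ℂ := fderiv ℝ Θ y₀ with hM
  have hMv (v : ℂ × ℂ) : M v = ((L v).1, (L v).2 + y₀.2 * (l v : ℂ)) := by
    rw [hM, dΘ.fderiv]
    simp [hb0, hh0]
    ring
  -- As `|(b y).2| = 1`, the derivative of this component is tangent to the circle. Thus the radial
  -- part of `M v` is exactly `l v`, and `M` is injective by the immersion condition.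
  have htan (v : ℂ × ℂ) : ((starRingEnd ℂ) y₀.2 * (L v).2).re = 0 := by
    have e1 : (fun y => ((starRingEnd ℂ) (b y).2 * (b y).2)) =ᶠ[𝓝 y₀] fun _ => 1 := by
      filter_upwards [hbS] with y hy
      rw [mul_comm, Complex.mul_conj, Complex.normSq_eq_norm_sq, hy]; simp
    have d1 := ((Complex.conjCLE.hasFDerivAt.comp y₀ db2).mul db2).congr_of_eventuallyEq e1.symm
    have d2 := d1.unique (hasFDerivAt_const (1 : ℂ) y₀)
    have d3 := congrArg (fun T : ℂ × ℂ →L[ℝ] ℂ => (T v).re) d2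
    simp [hb0] at d3
    simp
    linarith
  have hnorm : (starRingEnd ℂ) y₀.2 * y₀.2 = 1 := by
    rw [mul_comm, Complex.mul_conj, Complex.normSq_eq_norm_sq, hζ0]; simp
  have hlM (v : ℂ × ℂ) : l v = ((starRingEnd ℂ) y₀.2 * (M v).2).re := by
    rw [hMv]
    simp only
    rw [mul_add, ← mul_assoc, hnorm, Complex.add_re, htan]; simp
  have hinj : Function.Injective (M : ℂ × ℂ →ₗ[ℝ] ℂ × ℂ) := by
    rw [← LinearMap.ker_eq_bot, LinearMap.ker_eq_bot']
    intro v hv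
    have hv' : M v = 0 := hv
    have h1 : l v = 0 := by rw [hlM, hv']; simp
    have h2 := hMv v
    rw [hv', h1] at h2
    refine himm v (Prod.ext ?_ ?_) h1
    · exact (congrArg Prod.fst h2).symm
    · have := congrArg Prod.snd h2
      simpa using this.symm
  have hsurj : Function.Surjective (M : ℂ × ℂ →ₗ[ℝ] ℂ × ℂ) :=
    LinearMap.injective_iff_surjective.1 hinj
  refine ⟨?_, fun h0 => ?_⟩
  · have := (hΘc.hasStrictFDerivAt (by simp)).map_nhds_eq_of_surj (LinearMap.range_eq_top.2 hsurj)
    rwa [hΘ0] at this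
  · obtain ⟨v, hv⟩ := hsurj (0, y₀.2)
    have hv' : M v = (0, y₀.2) := hv
    have h1 := hlM v
    rw [h0, hv', hnorm] at h1
    simp at h1

variable {E : Type*} [NormedAddCommGroup E] [NormedSpace ℂ E]
  {X : Type*} [TopologicalSpace X] [ChartedSpace E X]

namespace TubularNbhd

variable {S : Set X} (T : TubularNbhd E S) {a b : OpenPartialHomeomorph X E}

lemma continuousAt_base {p : X} (hpT : p ∈ T.carrier) : ContinuousAt T.base p :=
  T.analytic_base.continuousOn.continuousAt (T.isOpen.mem_nhds hpT)

variable [IsManifold 𝓘(ℂ, E) ω X]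

lemma contDiffAt_height (ha : a ∈ IsManifold.maximalAtlas 𝓘(ℂ, E) ω X) {p : X} (hp : p ∈ a.source)
    (hpT : p ∈ T.carrier) : ContDiffAt ℝ ω (T.height ∘ a.symm) (a p) := by
  refine ContMDiffAt.contDiffAt_chart ha (a.map_source hp) ?_
  rw [a.left_inv hp]
  exact T.analytic_height.contMDiffAt (T.isOpen.mem_nhds hpT)

lemma contDiffAt_base (ha : a ∈ IsManifold.maximalAtlas 𝓘(ℂ, E) ω X)
    (hb : b ∈ IsManifold.maximalAtlas 𝓘(ℂ, E) ω X) {p : X} (hp : p ∈ a.source)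
    (hpb : T.base p ∈ b.source) (hpT : p ∈ T.carrier) :
    ContDiffAt ℝ ω (b ∘ T.base ∘ a.symm) (a p) := by
  have := isManifold_real (X := X) (E := E) ω
  have h1 : ContMDiffAt 𝓘(ℝ, E) 𝓘(ℝ, E) ω (b ∘ T.base) p :=
    ((contMDiffOn_of_mem_maximalAtlas (mem_maximalAtlas_real hb)).contMDiffAt
      (b.open_source.mem_nhds hpb)).comp p (T.analytic_base.contMDiffAt (T.isOpen.mem_nhds hpT))
  refine ContMDiffAt.contDiffAt_chart (f := b ∘ T.base) ha (a.map_source hp) ?_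
  rwa [a.left_inv hp]

/-- Points of `S` are fixed by `base`, so near `q` source and target of `base` can be read in the
same chart; the change of charts then conjugates the derivative by an isomorphism `A`. -/
lemma immersion_chart (ha : a ∈ IsManifold.maximalAtlas 𝓘(ℂ, E) ω X) {q : X} (hq : q ∈ S)
    (hqa : q ∈ a.source) {v : E} (hv : fderiv ℝ (a ∘ T.base ∘ a.symm) (a q) v = 0)
    (hv' : fderiv ℝ (T.height ∘ a.symm) (a q) v = 0) : v = 0 := by
  have hmfd := isManifold_real (X := X) (E := E) ω
  have hqT := T.subset hq
  have hbq : T.base q = q := (T.zero_section q hq).1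
  obtain ⟨A, hA, hAf⟩ := exists_leviForm_eq ha hqa
  have hqm : chartAt E q ∈ IsManifold.maximalAtlas 𝓘(ℂ, E) ω X :=
    IsManifold.chart_mem_maximalAtlas (I := 𝓘(ℂ, E)) (n := ω) q
  have hd : MDifferentiableAt 𝓘(ℝ, E) 𝓘(ℝ, E) T.base q :=
    (T.analytic_base.contMDiffAt (T.isOpen.mem_nhds hqT)).mdifferentiableAt (by simp)
  have e1 : (mfderiv 𝓘(ℝ, E) 𝓘(ℝ, E) T.base q : E →L[ℝ] E) =
      fderiv ℝ (chartAt E q ∘ T.base ∘ (chartAt E q).symm) (chartAt E q q) := by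
    rw [hd.mfderiv]
    simp only [writtenInExtChartAt, extChartAt, mfld_simps, fderivWithin_univ]
    rw [hbq]
  have e2 : differential E T.height q (A.symm v) = 0 := by
    rw [(hAf T.height ((T.contDiffAt_height ha hqa hqT).of_le le_top)).1]
    simpa using hv'
  set u := A.symm v with hu
  have hAu : A u = v := by simp [hu]
  have e3 : fderiv ℝ (chartAt E q ∘ T.base ∘ (chartAt E q).symm) (chartAt E q q) u = 0 := by
    have hqs := mem_chart_source E q
    have c1 : DifferentiableAt ℝ (a ∘ T.base ∘ a.symm) (a q) :=
      (T.contDiffAt_base ha ha hqa (by rwa [hbq]) hqT).differentiableAt (by simp)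
    have c2 : DifferentiableAt ℝ (chartAt E q ∘ T.base ∘ (chartAt E q).symm) (chartAt E q q) :=
      (T.contDiffAt_base hqm hqm hqs (by rwa [hbq]) hqT).differentiableAt (by simp)
    have cA : HasFDerivAt (a ∘ (chartAt E q).symm) ((A : E →L[ℂ] E).restrictScalars ℝ)
        (chartAt E q q) := by
      obtain ⟨h1, -⟩ := exists_chart_deriv ha hqm hqa hqs
      rw [hA]
      exact ((h1.differentiableAt (by simp)).hasFDerivAt).restrictScalars ℝ
    have p1 : (a ∘ (chartAt E q).symm) (chartAt E q q) = a q := by simp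
    have p2 : (chartAt E q ∘ T.base ∘ (chartAt E q).symm) (chartAt E q q) = chartAt E q q := by
      simp [hbq]
    have d1 : HasFDerivAt ((a ∘ T.base ∘ a.symm) ∘ (a ∘ (chartAt E q).symm))
        ((fderiv ℝ (a ∘ T.base ∘ a.symm) (a q)).comp ((A : E →L[ℂ] E).restrictScalars ℝ))
        (chartAt E q q) := by
      refine HasFDerivAt.comp _ ?_ cA
      rw [p1]; exact c1.hasFDerivAt
    have d2 : HasFDerivAt ((a ∘ (chartAt E q).symm) ∘
        (chartAt E q ∘ T.base ∘ (chartAt E q).symm))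
        (((A : E →L[ℂ] E).restrictScalars ℝ).comp
          (fderiv ℝ (chartAt E q ∘ T.base ∘ (chartAt E q).symm) (chartAt E q q)))
        (chartAt E q q) := by
      refine HasFDerivAt.comp _ ?_ c2.hasFDerivAt
      rw [p2]; exact cA
    have ee : (a ∘ T.base ∘ a.symm) ∘ (a ∘ (chartAt E q).symm) =ᶠ[𝓝 (chartAt E q q)]
        (a ∘ (chartAt E q).symm) ∘ (chartAt E q ∘ T.base ∘ (chartAt E q).symm) := by
      have t1 : Tendsto (chartAt E q).symm (𝓝 (chartAt E q q)) (𝓝 q) := by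
        have := (chartAt E q).continuousAt_symm (mem_chart_target E q)
        rwa [ContinuousAt, (chartAt E q).left_inv hqs] at this
      have t2 : Tendsto T.base (𝓝 q) (𝓝 q) := by
        have := T.continuousAt_base hqT
        rwa [ContinuousAt, hbq] at this
      filter_upwards [t1.eventually (a.open_source.mem_nhds hqa),
        (t2.comp t1).eventually (chart_source_mem_nhds E q)] with y hy hy'
      simp only [Function.comp_apply] at hy' ⊢
      rw [a.left_inv hy, (chartAt E q).left_inv hy']
    have d3 := congrArg (fun L : E →L[ℝ] E => L u) ((d2.congr_of_eventuallyEq ee).unique d1)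
    have d4 : A (fderiv ℝ (chartAt E q ∘ T.base ∘ (chartAt E q).symm) (chartAt E q q) u) =
        fderiv ℝ (a ∘ T.base ∘ a.symm) (a q) (A u) := d3
    rw [hAu, hv] at d4
    exact A.injective (by rw [d4, map_zero])
  have h0 : u = 0 := T.immersion q hqT u (by
    have := congrArg (fun L : E →L[ℝ] E => L u) e1
    exact this.trans e3) e2
  rw [← hAu, h0, map_zero]

end TubularNbhd

end TubularCoordinates

/-! ### The tubular neighbourhood of the boundary of the disc bundle. -/

section TubularDisc

open RiemannSphere

variable {C P : Type*} [TopologicalSpace C] [ChartedSpace ℂ C]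
  [TopologicalSpace P] [ChartedSpace (ℂ × ℂ) P]

namespace DiscBundle

/-- The image of the section is connected, and each fibre disc is connected and meets it. -/
lemma isConnected_disc [ConnectedSpace C] [IsManifold 𝓘(ℂ) ω C] {B : DiscBundle C P} {s : C → P}
    (hs : B.IsHarmonicSection s) : IsConnected B.disc := by
  obtain ⟨x₀⟩ := (inferInstance : Nonempty C)
  refine ⟨⟨s x₀, hs.2.1 x₀⟩, isPreconnected_of_forall (s x₀) fun p hp => ?_⟩
  obtain ⟨e, he, hpe⟩ := B.cover (B.proj p)
  set F : Set P := (fun ζ => e.toOpenPartialHomeomorph.symm (B.proj p, ζ)) '' unitDisc with hF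
  have hmemF {p' : P} (h : B.proj p' = B.proj p) (h' : p' ∈ B.disc) : p' ∈ F := by
    have h1 : p' ∈ e.source := e.mem_source.2 (by rw [h]; exact hpe)
    refine ⟨(e p').2, (mem_disc_iff he (by rw [h]; exact hpe)).1 h', ?_⟩
    have : (B.proj p, (e p').2) = e p' := Prod.ext (by rw [e.coe_fst h1, h]) rfl
    simp only [this]
    exact e.toOpenPartialHomeomorph.left_inv h1
  have hFD : F ⊆ B.disc := by
    rintro _ ⟨ζ, hζ, rfl⟩
    have h1 := e.proj_symm_apply' (x := ζ) hpe
    refine (mem_disc_iff he (by rw [h1]; exact hpe)).2 ?_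
    rw [e.apply_symm_apply' hpe]
    exact hζ
  have hFc : IsPreconnected F := by
    have h1 : IsPreconnected unitDisc :=
      (convex_ball (0 : ℂ) 1).isPreconnected.image _ OnePoint.continuous_coe.continuousOn
    refine h1.image _ ?_
    refine e.toOpenPartialHomeomorph.continuousOn_symm.comp (by fun_prop) fun ζ _ => ?_
    exact e.mem_target.2 hpe
  refine ⟨range s ∪ F, union_subset ?_ hFD, Or.inl ⟨x₀, rfl⟩, Or.inr (hmemF rfl hp), ?_⟩
  · rintro _ ⟨x, rfl⟩
    exact hs.2.1 x
  · exact (isPreconnected_range (continuous_section hs)).union (s (B.proj p)) ⟨_, rfl⟩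
      (hmemF (hs.1 _) (hs.2.1 _)) hFc

variable {B : DiscBundle C P} (T : TubularNbhd (ℂ × ℂ) (frontier B.disc))
  [IsManifold 𝓘(ℂ) ω C] [IsManifold 𝓘(ℂ, ℂ × ℂ) ω P]
  {e : Trivialization (OnePoint ℂ) B.proj} {x : C} {q : P}

/-- In flat coordinates `∂D` is `|ζ| = 1`, and `(base, height)` can be encoded as `(z, ζ (1 +
height))` evaluated at the base point. The immersion condition makes this a local diffeomorphism,
hence locally onto, with `d height ≠ 0`. -/
lemma tubular_normal_form (he : e ∈ B.trivs) (hq : q ∈ frontier B.disc)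
    (hqs : q ∈ (B.coord e x).source) :
    map (fun y => ((B.coord e x (T.base ((B.coord e x).symm y))).1,
      (B.coord e x (T.base ((B.coord e x).symm y))).2 *
        (1 + (T.height ((B.coord e x).symm y) : ℂ)))) (𝓝 (B.coord e x q)) = 𝓝 (B.coord e x q) ∧
      fderiv ℝ (T.height ∘ (B.coord e x).symm) (B.coord e x q) ≠ 0 := by
  have ha := coord_mem_maximalAtlas (B := B) (x := x) he
  have hqT := T.subset hq
  obtain ⟨hb0, hh0⟩ := T.zero_section q hq
  refine exists_tubular_normal_form (b := B.coord e x ∘ T.base ∘ (B.coord e x).symm)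
    (h := T.height ∘ (B.coord e x).symm)
    (T.contDiffAt_base ha ha hqs (by rwa [hb0]) hqT) (T.contDiffAt_height ha hqs hqT) ?_ ?_ ?_
    (fun v => T.immersion_chart ha hq hqs)
  · simp [(B.coord e x).left_inv hqs, hb0]
  · simp [(B.coord e x).left_inv hqs, hh0]
  · have t1 : Tendsto (B.coord e x).symm (𝓝 (B.coord e x q)) (𝓝 q) := by
      have := (B.coord e x).continuousAt_symm ((B.coord e x).map_source hqs)
      rwa [ContinuousAt, (B.coord e x).left_inv hqs] at this
    have t2 : Tendsto T.base (𝓝 q) (𝓝 q) := by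
      have := T.continuousAt_base hqT
      rwa [ContinuousAt, hb0] at this
    filter_upwards [t1.eventually (T.isOpen.mem_nhds hqT),
      (t2.comp t1).eventually ((B.coord e x).open_source.mem_nhds hqs)] with y hy hy'
    exact (mem_frontier_iff_coord he hy').1 (T.mapsTo hy)

/-- The local diffeomorphism of `tubular_normal_form` attains every value `(z, ζ (1 + t))` near `q`.
For `|t| < 1` the modulus of the second entry recovers `t`, and division recovers the base point. -/
lemma tubular_surjective_near (hq : q ∈ frontier B.disc) {W : Set P} (hW : W ∈ 𝓝 q) :
    ∃ a > 0, ∀ᶠ b in 𝓝 q, b ∈ frontier B.disc → ∀ t, |t| ≤ a → ∃ p ∈ W, p ∈ T.carrier ∧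
      T.base p = b ∧ T.height p = t := by
  obtain ⟨e, he, hqe⟩ := B.cover (B.proj q)
  have hqs := mem_coord_source_of_frontier he hqe (mem_chart_source ℂ (B.proj q)) hq
  set κ := B.coord e (B.proj q) with hκ
  obtain ⟨hmap, -⟩ := tubular_normal_form T he hq hqs
  have hqT := T.subset hq
  obtain ⟨hb0, hh0⟩ := T.zero_section q hq
  have t1 : Tendsto κ.symm (𝓝 (κ q)) (𝓝 q) := by
    have := κ.continuousAt_symm (κ.map_source hqs)
    rwa [ContinuousAt, κ.left_inv hqs] at this
  have t2 : Tendsto T.base (𝓝 q) (𝓝 q) := by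
    have := T.continuousAt_base hqT
    rwa [ContinuousAt, hb0] at this
  have t3 : Tendsto T.height (𝓝 q) (𝓝 0) := by
    have := T.analytic_height.continuousOn.continuousAt (T.isOpen.mem_nhds hqT)
    rwa [ContinuousAt, hh0] at this
  have hgood : ∀ᶠ y in 𝓝 (κ q), κ.symm y ∈ W ∧ κ.symm y ∈ T.carrier ∧
      T.base (κ.symm y) ∈ κ.source ∧ |T.height (κ.symm y)| < 1 := by
    filter_upwards [t1.eventually hW, t1.eventually (T.isOpen.mem_nhds hqT),
      (t2.comp t1).eventually (κ.open_source.mem_nhds hqs),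
      (t3.comp t1).eventually (Metric.ball_mem_nhds 0 one_pos)] with y h1 h2 h3 h4
    exact ⟨h1, h2, h3, by simpa using h4⟩
  have himg := image_mem_map (m := fun y => ((κ (T.base (κ.symm y))).1,
      (κ (T.base (κ.symm y))).2 * (1 + (T.height (κ.symm y) : ℂ)))) hgood
  rw [hmap] at himg
  have hcont : Tendsto (fun bt : P × ℝ => ((κ bt.1).1, (κ bt.1).2 * (1 + (bt.2 : ℂ))))
      (𝓝 q ×ˢ 𝓝 (0 : ℝ)) (𝓝 (κ q)) := by
    have h1 : ContinuousAt (fun bt : P × ℝ => ((κ bt.1).1, (κ bt.1).2 * (1 + (bt.2 : ℂ)))) (q, 0) := by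
      have h2 : ContinuousAt (fun bt : P × ℝ => κ bt.1) (q, 0) :=
        ContinuousAt.comp (f := Prod.fst) (κ.continuousAt hqs) continuousAt_fst
      have h3 : ContinuousAt (fun bt : P × ℝ => 1 + (bt.2 : ℂ)) (q, 0) := by fun_prop
      exact h2.fst.prodMk (h2.snd.mul h3)
    rw [ContinuousAt, nhds_prod_eq] at h1
    simpa using h1
  have h1 := (hcont.eventually himg)
  obtain ⟨pa, hpa, pb, hpb, hab⟩ := eventually_prod_iff.1 h1
  obtain ⟨a, ha, hball⟩ := Metric.eventually_nhds_iff.1 hpb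
  refine ⟨min (a / 2) (1 / 2), by positivity, ?_⟩
  filter_upwards [hpa, κ.open_source.mem_nhds hqs] with b hb hbs hbf t ht
  have hta : |t| ≤ a / 2 := ht.trans (min_le_left _ _)
  have ht1 : |t| ≤ 1 / 2 := ht.trans (min_le_right _ _)
  obtain ⟨y, ⟨hyW, hyT, hys, hyh⟩, hy⟩ := hab hb (hball (y := t) (by
    rw [Real.dist_eq, sub_zero]; linarith))
  simp only [Prod.mk.injEq] at hy
  obtain ⟨hy1, hy2⟩ := hy
  have n1 : ‖(κ (T.base (κ.symm y))).2‖ = 1 := (mem_frontier_iff_coord he hys).1 (T.mapsTo hyT)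
  have n2 : ‖(κ b).2‖ = 1 := (mem_frontier_iff_coord he hbs).1 hbf
  have n3 {t : ℝ} (ht : |t| < 1) : ‖1 + (t : ℂ)‖ = 1 + t := by
    rw [show (1 : ℂ) + t = ((1 + t : ℝ) : ℂ) by push_cast; ring, Complex.norm_real,
      Real.norm_of_nonneg (by linarith [(abs_lt.1 ht).1])]
  have n4 : T.height (κ.symm y) = t := by
    have := congrArg norm hy2
    rw [norm_mul, norm_mul, n1, n2, n3 hyh, n3 (by linarith)] at this
    linarith
  have n5 : (1 + (t : ℂ)) ≠ 0 := by
    rw [← norm_pos_iff, n3 (by linarith)]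
    linarith [(abs_le.1 ht1).1]
  refine ⟨κ.symm y, hyW, hyT, ?_, n4⟩
  rw [n4] at hy2
  exact κ.injOn hys hbs (Prod.ext hy1 (mul_right_cancel₀ n5 hy2))

/-- In a tubular neighbourhood of a compact hypersurface, small heights occur only close to the
hypersurface, and all of them occur. -/
lemma exists_collar [CompactSpace C] {W : Set P} (hW : IsOpen W) (hWS : frontier B.disc ⊆ W) :
    ∃ a > 0, (∀ b ∈ frontier B.disc, ∀ t, |t| ≤ a → ∃ p ∈ T.carrier, T.base p = b ∧ T.height p = t)
      ∧ ∀ p ∈ T.carrier, |T.height p| ≤ a → p ∈ W := by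
  have key : ∃ a > 0, ∀ b ∈ frontier B.disc, ∀ t, |t| ≤ a → ∃ p ∈ W, p ∈ T.carrier ∧
      T.base p = b ∧ T.height p = t := by
    have h1 := fun q (hq : q ∈ frontier B.disc) =>
      tubular_surjective_near T hq (hW.mem_nhds (hWS hq))
    choose a ha hev using h1
    obtain ⟨t, hcov⟩ := (isCompact_frontier_disc B).elim_nhds_subcover' _ hev
    obtain ⟨a₀, ha₀, hat⟩ : ∃ a₀ > 0, ∀ q ∈ t, a₀ ≤ a q q.2 := by
      rcases t.eq_empty_or_nonempty with rfl | hne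
      · exact ⟨1, one_pos, by simp⟩
      · obtain ⟨q, hq, hmin⟩ := t.exists_min_image (fun q => a q q.2) hne
        exact ⟨a q q.2, ha q q.2, fun q' hq' => hmin q' hq'⟩
    refine ⟨a₀, ha₀, fun b hb τ hτ => ?_⟩
    obtain ⟨q, hq, hbq⟩ := mem_iUnion₂.1 (hcov hb)
    exact hbq hb τ (hτ.trans (hat q hq))
  obtain ⟨a, ha, h⟩ := key
  refine ⟨a, ha, fun b hb t ht => ?_, fun p hp hpa => ?_⟩
  · obtain ⟨p, -, hp, h1, h2⟩ := h b hb t ht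
    exact ⟨p, hp, h1, h2⟩
  -- A point near the hypersurface already realizes the same base and height, and `φ` is injective.
  · obtain ⟨p', hp'W, hp', h1, h2⟩ := h (T.base p) (T.mapsTo hp) _ hpa
    rwa [← T.injOn hp' hp (Prod.ext h1 h2)]

/-- Both `height` and `|ζ|² - 1` vanish on `∂D`, and both have nonzero differentials there, so their
quotient tends to a nonzero `k`, whose sign tells on which side `height` is negative. -/
lemma exists_local_side (hq : q ∈ frontier B.disc) : ∃ k : ℝ, k ≠ 0 ∧ ∀ᶠ p in 𝓝 q,
    (p ∈ frontier B.disc ↔ T.height p = 0) ∧ (p ∈ B.disc ↔ k * T.height p < 0) := by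
  obtain ⟨e, he, hqe⟩ := B.cover (B.proj q)
  have hqs := mem_coord_source_of_frontier he hqe (mem_chart_source ℂ (B.proj q)) hq
  set κ := B.coord e (B.proj q) with hκ
  obtain ⟨-, hd⟩ := tubular_normal_form T he hq hqs
  have ha := coord_mem_maximalAtlas (B := B) (x := B.proj q) he
  have hqT := T.subset hq
  set ν : ℂ × ℂ → ℝ := fun y => Complex.normSq y.2 - 1 with hν
  have hνc : ContDiffAt ℝ 1 ν (κ q) := (contDiffAt_normSq contDiffAt_snd).sub contDiffAt_const
  have hνz (y : ℂ × ℂ) : ν y = ‖y.2‖ ^ 2 - 1 := by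
    simp only [hν, Complex.normSq_eq_norm_sq]
  have hνq : ν (κ q) = 0 := by
    rw [hνz, (mem_frontier_iff_coord he hqs).1 hq]; norm_num
  have hvan : ∀ᶠ y in 𝓝 (κ q), ν y = 0 → (T.height ∘ κ.symm) y = 0 := by
    filter_upwards [κ.open_target.mem_nhds (κ.map_source hqs)] with y hy h0
    refine (T.zero_section _ ((mem_frontier_iff_coord he (κ.map_target hy)).2 ?_)).2
    rw [κ.right_inv hy]
    rw [hνz] at h0
    exact (pow_eq_one_iff_of_nonneg (norm_nonneg _) two_ne_zero).1 (by linarith)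
  have hdν : fderiv ℝ ν (κ q) ≠ 0 := by
    intro h0
    have h1 : HasDerivAt (fun t : ℝ => κ q + t • ((0 : ℂ), (κ q).2)) (0, (κ q).2) 0 := by
      simpa using ((hasDerivAt_id (0 : ℝ)).smul_const ((0 : ℂ), (κ q).2)).const_add (κ q)
    have h2 : HasFDerivAt ν (0 : ℂ × ℂ →L[ℝ] ℝ) (κ q + (0 : ℝ) • ((0 : ℂ), (κ q).2)) := by
      rw [← h0]; simpa using (hνc.differentiableAt (by simp)).hasFDerivAt
    have h3 := h2.comp_hasDerivAt (0 : ℝ) h1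
    -- Along the radial line `(1 + t) ζ` the function is `(1 + t)² - 1`, of derivative `2` at `0`.
    have h4 : (ν ∘ fun t : ℝ => κ q + t • ((0 : ℂ), (κ q).2)) = fun t => (1 + t) ^ 2 - 1 := by
      ext t
      have h5 : (κ q + t • ((0 : ℂ), (κ q).2)).2 = ((1 + t : ℝ) : ℂ) * (κ q).2 := by
        simp; ring
      rw [Function.comp_apply, hνz, h5, norm_mul, (mem_frontier_iff_coord he hqs).1 hq,
        Complex.norm_real, mul_one, Real.norm_eq_abs, sq_abs]
    rw [h4] at h3
    have h6 : HasDerivAt (fun t : ℝ => (1 + t) ^ 2 - 1) 2 0 := by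
      have := (((hasDerivAt_id (0 : ℝ)).const_add 1).pow 2).sub_const 1
      simpa using this
    have := h3.unique h6
    simp at this
  obtain ⟨k, hk, hlim⟩ := exists_fderiv_eq_mul_of_vanish
    ((T.contDiffAt_height ha hqs hqT).of_le le_top) hνc hνq hdν hvan
  have hk0 : k ≠ 0 := fun h => hd (ContinuousLinearMap.ext fun u => by rw [hk, h]; simp)
  refine ⟨k, hk0, ?_⟩
  -- If `height p = 0`, then `p` and `base p` have the same base and height, so they coincide by
  -- injectivity.
  have hzero : ∀ᶠ p in 𝓝 q, (p ∈ frontier B.disc ↔ T.height p = 0) := by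
    filter_upwards [T.isOpen.mem_nhds hqT] with p hp
    refine ⟨fun h => (T.zero_section p h).2, fun h => ?_⟩
    obtain ⟨h1, h2⟩ := T.zero_section _ (T.mapsTo hp)
    have := T.injOn (T.subset (T.mapsTo hp)) hp (Prod.ext h1 (h2.trans h.symm))
    rw [← this]; exact T.mapsTo hp
  have hsign : ∀ᶠ y in 𝓝 (κ q), ν y ≠ 0 → 0 < k * ((T.height ∘ κ.symm) y / ν y) := by
    have h1 : Tendsto (fun y => k * ((T.height ∘ κ.symm) y / ν y)) (𝓝[{y | ν y ≠ 0}] (κ q))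
        (𝓝 (k * k)) := hlim.const_mul k
    exact eventually_nhdsWithin_iff.1 (h1.eventually (lt_mem_nhds (mul_self_pos.2 hk0)))
  filter_upwards [hzero, (κ.continuousAt hqs).eventually hsign, κ.open_source.mem_nhds hqs]
    with p hp hps hpκ
  refine ⟨hp, ?_⟩
  simp only [Function.comp_apply, κ.left_inv hpκ] at hps
  rw [mem_disc_iff_coord he hpκ]
  have h1 : ‖(κ p).2‖ < 1 ↔ ν (κ p) < 0 := by
    rw [hνz, sub_neg, sq_lt_one_iff₀ (norm_nonneg _)]
  change ‖(κ p).2‖ < 1 ↔ _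
  rw [h1]
  by_cases h0 : ν (κ p) = 0
  · have : T.height p = 0 := by
      rw [← hp, mem_frontier_iff_coord he hpκ]
      rw [hνz] at h0
      exact (pow_eq_one_iff_of_nonneg (norm_nonneg _) two_ne_zero).1 (by linarith)
    simp [h0, this]
  · have h2 := hps h0
    rw [← mul_div_assoc] at h2
    rcases lt_or_gt_of_ne h0 with h3 | h3
    · exact ⟨fun _ => by
        by_contra! h4
        exact absurd h2 (not_lt.2 (div_nonpos_of_nonneg_of_nonpos h4 h3.le)), fun _ => h3⟩
    · refine ⟨fun h => absurd h (not_lt.2 h3.le), fun h => ?_⟩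
      exact absurd h2 (not_lt.2 (div_nonpos_of_nonpos_of_nonneg h.le h3.le))

end DiscBundle

end TubularDisc

/-! ### Orientation of the normal bundle, and small sections. -/

section Normalization

variable {E : Type*} [NormedAddCommGroup E] [NormedSpace ℂ E]
  {X : Type*} [TopologicalSpace X] [ChartedSpace E X]

namespace TubularNbhd

variable {S : Set X} (T : TubularNbhd E S) {τ : X → ℝ}

lemma eventually_sign_base (hloc : ∀ q ∈ S, ∀ᶠ p in 𝓝 q, p ∈ S → τ p = τ q) {p : X}
    (hp : p ∈ T.carrier) : ∀ᶠ p' in 𝓝 p, τ (T.base p') = τ (T.base p) := by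
  filter_upwards [(T.continuousAt_base hp).eventually (hloc _ (T.mapsTo hp)),
    T.isOpen.mem_nhds hp] with p' h1 h2
  exact h1 (T.mapsTo h2)

lemma contMDiffOn_sign_mul (hloc : ∀ q ∈ S, ∀ᶠ p in 𝓝 q, p ∈ S → τ p = τ q) {f : X → ℝ}
    (hf : ContMDiffOn 𝓘(ℝ, E) 𝓘(ℝ, ℝ) ω f T.carrier) :
    ContMDiffOn 𝓘(ℝ, E) 𝓘(ℝ, ℝ) ω (fun p => τ (T.base p) * f p) T.carrier := by
  intro p hp
  have h1 : ContMDiffAt 𝓘(ℝ, E) 𝓘(ℝ, ℝ) ω (fun p' => τ (T.base p) * f p') p :=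
    contMDiffAt_const.mul (hf.contMDiffAt (T.isOpen.mem_nhds hp))
  refine (h1.congr_of_eventuallyEq ?_).contMDiffWithinAt
  filter_upwards [T.eventually_sign_base hloc hp] with p' h
  rw [h]

/-- The tubular neighbourhood with the orientation of the normal bundle changed by a locally
constant sign. -/
noncomputable def changeSign (hτ : ∀ p, τ p = 1 ∨ τ p = -1)
    (hloc : ∀ q ∈ S, ∀ᶠ p in 𝓝 q, p ∈ S → τ p = τ q) : TubularNbhd E S where
  carrier := T.carrier
  base := T.base
  height p := τ (T.base p) * T.height p
  isOpen := T.isOpen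
  subset := T.subset
  analytic_base := T.analytic_base
  analytic_height := T.contMDiffOn_sign_mul hloc T.analytic_height
  mapsTo := T.mapsTo
  zero_section p hp := ⟨(T.zero_section p hp).1, by rw [(T.zero_section p hp).2, mul_zero]⟩
  injOn := by
    intro p hp p' hp' h
    simp only [Prod.mk.injEq] at h
    refine T.injOn hp hp' (Prod.ext h.1 ?_)
    have h2 := h.2
    rw [h.1] at h2
    rcases hτ (T.base p') with h0 | h0 <;> rw [h0] at h2 <;> simpa using h2
  immersion p hp v hv hv' := by
    refine T.immersion p hp v hv ?_
    have e : (fun p => τ (T.base p) * T.height p) ∘ (chartAt E p).symm =ᶠ[𝓝 (chartAt E p p)]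
        fun y => τ (T.base p) * (T.height ∘ (chartAt E p).symm) y := by
      have h1 : Tendsto (chartAt E p).symm (𝓝 (chartAt E p p)) (𝓝 p) := by
        have := (chartAt E p).continuousAt_symm (mem_chart_target E p)
        rwa [ContinuousAt, (chartAt E p).left_inv (mem_chart_source E p)] at this
      filter_upwards [h1.eventually (T.eventually_sign_base hloc hp)] with y hy
      simp only [Function.comp_apply, hy]
    rw [differential, e.fderiv_eq] at hv'
    rcases hτ (T.base p) with h0 | h0
    · simp only [h0, one_mul] at hv'
      exact hv'
    · simp only [h0, neg_mul, one_mul, fderiv_fun_neg] at hv'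
      simpa [differential] using hv'

variable (hτ : ∀ p, τ p = 1 ∨ τ p = -1) (hloc : ∀ q ∈ S, ∀ᶠ p in 𝓝 q, p ∈ S → τ p = τ q)

lemma changeSign_displacement (σ : X → ℝ) :
    (T.changeSign hτ hloc).displacement (fun p => τ p * σ p) = T.displacement σ := by
  ext p
  refine and_congr_right fun _ => ?_
  change τ (T.base p) * T.height p = τ (T.base p) * σ (T.base p) ↔ _
  rcases hτ (T.base p) with h0 | h0 <;> rw [h0] <;> simp

lemma changeSign_isAnalyticSection {σ : X → ℝ} (hσ : T.IsAnalyticSection σ) :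
    (T.changeSign hτ hloc).IsAnalyticSection (fun p => τ p * σ p) :=
  T.contMDiffOn_sign_mul hloc hσ

lemma changeSign_c2NormLT {A : ChartCover E S} {σ : X → ℝ} {δ : ℝ} (h : T.C2NormLT A σ δ) :
    (T.changeSign hτ hloc).C2NormLT A (fun p => τ p * σ p) δ := by
  intro a ha x hx
  obtain ⟨h1, h2, h3⟩ := h a ha x hx
  have hxS : x ∈ S := by rw [← A.iUnion_piece]; exact mem_iUnion₂.2 ⟨a, ha, hx⟩
  have hxa := A.piece_subset a ha hx
  have hbx := (T.zero_section x hxS).1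
  refine ⟨?_, ?_⟩
  · rcases hτ x with h0 | h0 <;> simpa [h0] using h1
  have e : ((fun p => τ p * σ p) ∘ T.base) ∘ (chartAt E a).symm =ᶠ[𝓝 (chartAt E a x)]
      fun y => τ x * ((σ ∘ T.base) ∘ (chartAt E a).symm) y := by
    have t1 : Tendsto (chartAt E a).symm (𝓝 (chartAt E a x)) (𝓝 x) := by
      have := (chartAt E a).continuousAt_symm ((chartAt E a).map_source hxa)
      rwa [ContinuousAt, (chartAt E a).left_inv hxa] at this
    filter_upwards [t1.eventually (T.eventually_sign_base hloc (T.subset hxS))] with y hy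
    simp only [Function.comp_apply, hy, hbx]
  change ‖fderiv ℝ (((fun p => τ p * σ p) ∘ T.base) ∘ (chartAt E a).symm) (chartAt E a x)‖ < δ ∧
    ‖fderiv ℝ (fderiv ℝ (((fun p => τ p * σ p) ∘ T.base) ∘ (chartAt E a).symm)) (chartAt E a x)‖ < δ
  rw [secondDerivative] at h3
  rw [e.fderiv_eq, e.fderiv.fderiv_eq]
  rcases hτ x with h0 | h0
  · simp only [h0, one_mul]
    exact ⟨h2, h3⟩
  · have e1 (y : E) : fderiv ℝ (fun y => τ x * ((σ ∘ T.base) ∘ (chartAt E a).symm) y) y =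
        -fderiv ℝ ((σ ∘ T.base) ∘ (chartAt E a).symm) y := by
      simp only [h0, neg_mul, one_mul, fderiv_fun_neg]
    rw [e1, funext e1, fderiv_fun_neg]
    refine ⟨(norm_neg _).trans_lt h2, lt_of_eq_of_lt ?_ h3⟩
    have hneg {G : Type _} [SeminormedAddCommGroup G] (z : G) : ‖-z‖ = ‖z‖ := norm_neg z
    exact hneg (G := E →L[ℝ] E →L[ℝ] ℝ) _

lemma abs_lt_of_c2NormLT {A : ChartCover E S} {σ : X → ℝ} {δ : ℝ} (h : T.C2NormLT A σ δ) {x : X}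
    (hx : x ∈ S) : |σ x| < δ := by
  rw [← A.iUnion_piece] at hx
  obtain ⟨a, ha, hxa⟩ := mem_iUnion₂.1 hx
  exact (h a ha x hxa).1

/-- Since `base` is a retraction, `σ ∘ base = (σ ∘ base) ∘ base`. The derivative at a point off `S`
thus factors through the one at its base point on `S`, which the norm controls, and `M` bounds the
derivative of `base` in charts. -/
lemma exists_fderiv_section_bound [IsManifold 𝓘(ℂ, E) ω X] [T2Space X] (A : ChartCover E S)
    {b : OpenPartialHomeomorph X E}
    (hb : b ∈ IsManifold.maximalAtlas 𝓘(ℂ, E) ω X) {q : X} (hq : q ∈ S) (hqb : q ∈ b.source) :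
    ∃ M > 0, ∀ᶠ p in 𝓝 q, ∀ σ δ, 0 < δ → T.IsAnalyticSection σ → T.C2NormLT A σ δ →
      ‖fderiv ℝ ((σ ∘ T.base) ∘ b.symm) (b p)‖ ≤ M * δ := by
  have hqT := T.subset hq
  have hbq := (T.zero_section q hq).1
  have t2 : Tendsto T.base (𝓝 q) (𝓝 q) := by
    have := T.continuousAt_base hqT
    rwa [ContinuousAt, hbq] at this
  have key : ∀ a ∈ A.centers, ∃ M > 0, ∀ᶠ p in 𝓝 q, T.base p ∈ A.piece a →
      ∀ σ δ, T.IsAnalyticSection σ → T.C2NormLT A σ δ →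
      ‖fderiv ℝ ((σ ∘ T.base) ∘ b.symm) (b p)‖ ≤ M * δ := by
    intro a ha
    by_cases hqa : q ∈ A.piece a
    · have hqs := A.piece_subset a ha hqa
      have ham : chartAt E a ∈ IsManifold.maximalAtlas 𝓘(ℂ, E) ω X :=
        IsManifold.chart_mem_maximalAtlas (I := 𝓘(ℂ, E)) (n := ω) a
      set G := chartAt E a ∘ T.base ∘ b.symm with hG
      have hGc : ContDiffAt ℝ ω G (b q) := T.contDiffAt_base hb ham hqb (by rwa [hbq]) hqT
      have hcont : ContinuousAt (fun p => ‖fderiv ℝ G (b p)‖) q :=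
        (ContinuousAt.comp (f := b) (hGc.fderiv_right (m := 0) le_top).continuousAt
          (b.continuousAt hqb)).norm
      refine ⟨‖fderiv ℝ G (b q)‖ + 1, by positivity, ?_⟩
      filter_upwards [hcont.eventually (gt_mem_nhds (lt_add_one _)), b.open_source.mem_nhds hqb,
        T.isOpen.mem_nhds hqT] with p hp hpb hpT hpa σ δ hσ hA
      have hbs := A.piece_subset a ha hpa
      have hbS := T.mapsTo hpT
      have hGp : G (b p) = chartAt E a (T.base p) := by simp [hG, b.left_inv hpb]
      have hGd : DifferentiableAt ℝ G (b p) :=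
        (T.contDiffAt_base hb ham hpb hbs hpT).differentiableAt (by simp)
      have hσd : DifferentiableAt ℝ ((σ ∘ T.base) ∘ (chartAt E a).symm) (chartAt E a (T.base p)) := by
        refine (ContMDiffAt.contDiffAt_chart (n := ω) ham ((chartAt E a).map_source hbs)
          ?_).differentiableAt (by simp)
        rw [(chartAt E a).left_inv hbs]
        exact hσ.contMDiffAt (T.isOpen.mem_nhds (T.subset hbS))
      have e : (σ ∘ T.base) ∘ b.symm =ᶠ[𝓝 (b p)] ((σ ∘ T.base) ∘ (chartAt E a).symm) ∘ G := by
        have t1 : Tendsto b.symm (𝓝 (b p)) (𝓝 p) := by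
          have := b.continuousAt_symm (b.map_source hpb)
          rwa [ContinuousAt, b.left_inv hpb] at this
        filter_upwards [t1.eventually (T.isOpen.mem_nhds hpT), ((T.continuousAt_base
          hpT).tendsto.comp t1).eventually ((chartAt E a).open_source.mem_nhds hbs)] with y h1 h2
        simp only [Function.comp_apply, hG] at h2 ⊢
        rw [(chartAt E a).left_inv h2, (T.zero_section _ (T.mapsTo h1)).1]
      rw [e.fderiv_eq, fderiv_comp _ (by rwa [hGp]) hGd, hGp]
      refine (ContinuousLinearMap.opNorm_comp_le _ _).trans ?_
      obtain ⟨-, h2, -⟩ := hA a ha _ hpa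
      rw [mul_comm]
      exact mul_le_mul hp.le h2.le (norm_nonneg _) (by positivity)
    · refine ⟨1, one_pos, ?_⟩
      -- The piece is closed and misses `q`, so the base points of nearby points miss it too.
      filter_upwards [t2.eventually ((A.isCompact_piece a ha).isClosed.isOpen_compl.mem_nhds hqa)]
        with p hp hpa
      exact absurd hpa hp
  choose! M hM hev using key
  refine ⟨∑ a ∈ A.centers, M a + 1, add_pos_of_nonneg_of_pos
    (Finset.sum_nonneg fun a ha => (hM a ha).le) one_pos, ?_⟩
  filter_upwards [(eventually_all_finset _).2 hev, T.isOpen.mem_nhds hqT] with p hp hpT σ δ hδ hσ hA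
  obtain ⟨a, ha, hpa⟩ := mem_iUnion₂.1 (A.iUnion_piece.symm.subset (T.mapsTo hpT))
  refine (hp a ha hpa σ δ hσ hA).trans (mul_le_mul_of_nonneg_right ?_ hδ.le)
  linarith [Finset.single_le_sum (f := M) (fun a ha => (hM a ha).le) ha]

end TubularNbhd

namespace DiscBundle

variable {C P : Type*} [TopologicalSpace C] [ChartedSpace ℂ C]
  [TopologicalSpace P] [ChartedSpace (ℂ × ℂ) P] [IsManifold 𝓘(ℂ) ω C] [IsManifold 𝓘(ℂ, ℂ × ℂ) ω P]
  {B : DiscBundle C P} (T : TubularNbhd (ℂ × ℂ) (frontier B.disc))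

/-- The sign of the number `k` from `exists_local_side`. The same `k` serves at all nearby boundary
points, so the sign is locally constant on `∂D`; it may differ between components. -/
lemma exists_side_sign : ∃ τ : P → ℝ, (∀ p, τ p = 1 ∨ τ p = -1) ∧ ∀ q ∈ frontier B.disc,
    ∀ᶠ p in 𝓝 q, (p ∈ frontier B.disc → τ p = τ q) ∧ (p ∈ frontier B.disc ↔ T.height p = 0) ∧
      (p ∈ B.disc ↔ τ q * T.height p < 0) := by
  classical
  let τ : P → ℝ := fun q => if ∀ᶠ p in 𝓝 q, p ∈ B.disc → T.height p < 0 then 1 else -1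
  refine ⟨τ, fun p => ite_eq_or_eq _ _ _, fun q hq => ?_⟩
  obtain ⟨k, hk, hev⟩ := exists_local_side T hq
  rcases lt_or_gt_of_ne hk with hk | hk
  · have h1 {p : P} (hp : p ∈ frontier B.disc)
        (h : ∀ᶠ p' in 𝓝 p, p' ∈ B.disc ↔ k * T.height p' < 0) : τ p = -1 := by
      refine if_neg fun h' => ?_
      -- Points of the disc bundle accumulate at `p`; there `height` would be both positive and
      -- negative.
      have h2 := mem_closure_iff_frequently.1 (frontier_subset_closure hp)
      obtain ⟨p', hp', h3, h4⟩ := (h2.and_eventually (h.and h')).exists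
      have := h3.1 hp'
      have := h4 hp'
      nlinarith
    have hq1 := h1 hq (hev.mono fun p hp => hp.2)
    filter_upwards [hev, hev.eventually_nhds] with p hp hp'
    refine ⟨fun hpf => by rw [hq1, h1 hpf (hp'.mono fun p hp => hp.2)], hp.1, ?_⟩
    rw [hp.2, hq1]
    constructor <;> intro h <;> nlinarith
  · have h1 {p : P} (h : ∀ᶠ p' in 𝓝 p, p' ∈ B.disc ↔ k * T.height p' < 0) : τ p = 1 := by
      refine if_pos (h.mono fun p' hp' h2 => ?_)
      have := hp'.1 h2
      by_contra! h3
      exact absurd this (not_lt.2 (mul_nonneg hk.le h3))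
    have hq1 := h1 (hev.mono fun p hp => hp.2)
    filter_upwards [hev, hev.eventually_nhds] with p hp hp'
    refine ⟨fun hpf => by rw [hq1, h1 (hp'.mono fun p hp => hp.2)], hp.1, ?_⟩
    rw [hp.2, hq1, one_mul, mul_neg_iff]
    constructor
    · rintro (h | h)
      · exact h.2
      · linarith [h.1]
    · exact fun h => Or.inl ⟨hk, h⟩

end DiscBundle

end Normalization

/-! ### From local Levi estimates at the boundary to Takeuchi convexity. -/

section Takeuchi

/-- A defining function near the boundary of a domain extends to the whole manifold. -/
lemma exists_defining_extension {E : Type*} [NormedAddCommGroup E] [NormedSpace ℂ E]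
    [FiniteDimensional ℝ E] {X : Type*} [TopologicalSpace X] [ChartedSpace E X]
    [IsManifold 𝓘(ℂ, E) ω X] [T2Space X] [CompactSpace X] {Ω O : Set X} {f : X → ℝ}
    (hΩ : IsOpen Ω) (hO : IsOpen O) (hfr : frontier Ω ⊆ O)
    (hf : ContMDiffOn 𝓘(ℝ, E) 𝓘(ℝ, ℝ) 2 f O) (hneg : ∀ p ∈ O, f p < 0 ↔ p ∈ Ω) :
    ∃ r : X → ℝ, ContMDiff 𝓘(ℝ, E) 𝓘(ℝ, ℝ) 2 r ∧ Ω = {p | r p < 0} ∧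
      ∀ p ∈ frontier Ω, r =ᶠ[𝓝 p] f := by
  classical
  have hr : IsManifold 𝓘(ℝ, E) ω X := isManifold_real ω
  have hr : IsManifold 𝓘(ℝ, E) ∞ X := IsManifold.of_le (n := ω) le_top
  obtain ⟨χ, h0, h1, hI⟩ := exists_contMDiffMap_zero_one_nhds_of_isClosed 𝓘(ℝ, E) (n := ⊤)
    hO.isClosed_compl (isClosed_frontier (s := Ω)) (by
      rw [disjoint_compl_left_iff_subset]; exact hfr)
  have hχ : ContMDiff 𝓘(ℝ, E) 𝓘(ℝ, ℝ) 2 χ := χ.contMDiff.of_le (WithTop.coe_le_coe.2 le_top)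
  -- This function is locally constant off the frontier, where alone it is used, and has the same
  -- sign as `f`, so the convex combination with the cutoff has the right sign everywhere.
  set θ : X → ℝ := fun p => if p ∈ Ω then -1 else 1 with hθ
  have hχO {p : X} (hp : p ∉ O) : χ p = 0 := h0.self_of_nhdsSet p hp
  have hev1 {p : X} (hp : p ∈ frontier Ω) : ∀ᶠ p' in 𝓝 p, χ p' = 1 :=
    (eventually_nhdsSet_iff_forall.1 h1) p hp
  refine ⟨fun p => χ p * f p + (1 - χ p) * θ p, fun p => ?_, ?_, fun p hp => ?_⟩
  · by_cases hp : p ∈ frontier Ω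
    · refine (hf.contMDiffAt (hO.mem_nhds (hfr hp))).congr_of_eventuallyEq ?_
      filter_upwards [hev1 hp] with p' hp'
      rw [hp']; ring
    · have hA : ContMDiffAt 𝓘(ℝ, E) 𝓘(ℝ, ℝ) 2 (fun p => χ p * f p) p := by
        by_cases hpO : p ∈ O
        · exact hχ.contMDiffAt.mul (hf.contMDiffAt (hO.mem_nhds hpO))
        · refine contMDiffAt_const (c := (0 : ℝ)) |>.congr_of_eventuallyEq ?_
          filter_upwards [(eventually_nhdsSet_iff_forall.1 h0) p hpO] with p' hp'
          rw [hp', zero_mul]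
      have hB : ContMDiffAt 𝓘(ℝ, E) 𝓘(ℝ, ℝ) 2 θ p := by
        have hloc : ∀ᶠ p' in 𝓝 p, θ p' = θ p := by
          by_cases hpΩ : p ∈ Ω
          · filter_upwards [hΩ.mem_nhds hpΩ] with p' hp'
            simp [hθ, hp', hpΩ]
          · have h2 : p ∉ closure Ω := fun h => hp (by rw [hΩ.frontier_eq]; exact ⟨h, hpΩ⟩)
            filter_upwards [isClosed_closure.isOpen_compl.mem_nhds h2] with p' hp'
            have h3 : p' ∉ Ω := fun h => hp' (subset_closure h)
            simp [hθ, h3, hpΩ]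
        exact contMDiffAt_const (c := θ p) |>.congr_of_eventuallyEq hloc
      exact hA.add ((contMDiffAt_const.sub hχ.contMDiffAt).mul hB)
  · ext p
    simp only [mem_ofPred_eq]
    have hI1 := (hI p).1
    have hI2 := (hI p).2
    by_cases hpO : p ∈ O
    · by_cases hpΩ : p ∈ Ω
      · have h2 := (hneg p hpO).2 hpΩ
        simp only [hpΩ, hθ, if_true, true_iff]
        rcases hI1.eq_or_lt with h3 | h3
        · rw [← h3]; norm_num
        · nlinarith [mul_neg_of_pos_of_neg h3 h2]
      · have h2 := not_lt.1 (fun h => hpΩ ((hneg p hpO).1 h))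
        simp only [hpΩ, hθ, if_false, false_iff, not_lt]
        nlinarith [mul_nonneg hI1 h2]
    · rw [hχO hpO]
      by_cases hpΩ : p ∈ Ω <;> simp [hθ, hpΩ]
  · filter_upwards [hev1 hp] with p' hp'
    rw [hp']; ring

/-- A local criterion for Takeuchi `1`-convexity of a domain in a compact complex surface. -/
lemma isTakeuchiConvex_one_of_local {X : Type*} [TopologicalSpace X] [ChartedSpace (ℂ × ℂ) X]
    [IsManifold 𝓘(ℂ, ℂ × ℂ) ω X] [T2Space X] [CompactSpace X] {Ω O : Set X} {f : X → ℝ}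
    (hΩ : IsOpen Ω) (hΩc : IsConnected Ω) (hO : IsOpen O) (hfr : frontier Ω ⊆ O)
    (hf : ContMDiffOn 𝓘(ℝ, ℂ × ℂ) 𝓘(ℝ, ℝ) 2 f O) (hneg : ∀ p ∈ O, f p < 0 ↔ p ∈ Ω)
    (hloc : ∀ q ∈ frontier Ω, ∃ a ∈ IsManifold.maximalAtlas 𝓘(ℂ, ℂ × ℂ) ω X, q ∈ a.source ∧
      fderiv ℝ (f ∘ a.symm) (a q) ≠ 0 ∧
      ∃ c > 0, ∀ᶠ p in 𝓝 q, p ∈ Ω → ∀ u, c * ‖u‖ ^ 2 ≤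
        (leviE (fun y => -Real.log (-f (a.symm y))) (a p) u u).re) :
    IsTakeuchiConvex (ℂ × ℂ) 1 Ω := by
  obtain ⟨r, hr, hΩr, hrf⟩ := exists_defining_extension hΩ hO hfr hf hneg
  obtain ⟨g, hg⟩ := exists_hermitianMetric X
  have hrc {a : OpenPartialHomeomorph X (ℂ × ℂ)}
      (ha : a ∈ IsManifold.maximalAtlas 𝓘(ℂ, ℂ × ℂ) ω X) {p : X} (hp : p ∈ a.source) :
      ContDiffAt ℝ 2 (r ∘ a.symm) (a p) :=
    ContMDiffAt.contDiffAt_chart ha (a.map_source hp) hr.contMDiffAt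
  have htend {a : OpenPartialHomeomorph X (ℂ × ℂ)} {p : X} (hp : p ∈ a.source) :
      Tendsto a.symm (𝓝 (a p)) (𝓝 p) := by
    have := a.continuousAt_symm (a.map_source hp)
    rwa [ContinuousAt, a.left_inv hp] at this
  have hlogc {a : OpenPartialHomeomorph X (ℂ × ℂ)}
      (ha : a ∈ IsManifold.maximalAtlas 𝓘(ℂ, ℂ × ℂ) ω X) {p : X} (hp : p ∈ a.source)
      (hpΩ : p ∈ Ω) : ContDiffAt ℝ 2 ((fun p => -Real.log (-r p)) ∘ a.symm) (a p) := by
    have h1 : r p < 0 := by rw [hΩr] at hpΩ; exact hpΩ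
    refine ((hrc ha hp).neg.log ?_).neg
    simp only [Function.comp_apply, a.left_inv hp]
    linarith
  refine ⟨hΩ, hΩc, isClosed_closure.isCompact, r, hr, hΩr, fun q hq => ?_, ?_⟩
  · obtain ⟨a, ha, hqa, hd, -⟩ := hloc q hq
    obtain ⟨A, -, hA⟩ := exists_leviForm_eq ha hqa
    have h1 := (hA r (hrc ha hqa)).1
    intro h0
    apply hd
    have h2 : r ∘ a.symm =ᶠ[𝓝 (a q)] f ∘ a.symm := (htend hqa).eventually (hrf q hq)
    rw [← h2.fderiv_eq]
    refine ContinuousLinearMap.ext fun u => ?_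
    have h3 := h1 (A.symm u)
    rw [h0] at h3
    simpa using h3.symm
  have key : ∀ q ∈ frontier Ω, ∃ ε > 0, ∀ᶠ p in 𝓝 q, p ∈ Ω → ∀ v, v ≠ 0 →
      ε * (g.form p v v).re ≤ (leviForm (ℂ × ℂ) (fun p => -Real.log (-r p)) p v v).re := by
    intro q hq
    obtain ⟨a, ha, hqa, -, c, hc, hev⟩ := hloc q hq
    obtain ⟨M, hM, hMev⟩ := hg a ha q hqa
    -- `c` compares the Levi form with the Euclidean norm in the chart `a`, and `M` compares that
    -- norm with the Hermitian metric.
    refine ⟨c / M, by positivity, ?_⟩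
    filter_upwards [hev, hMev, (hrf q hq).eventually_nhds, a.open_source.mem_nhds hqa]
      with p hp hpM hpr hpa hpΩ v hv
    obtain ⟨A, hAe, hA⟩ := exists_leviForm_eq ha hpa
    rw [(hA _ (hlogc ha hpa hpΩ)).2]
    have h1 : (fun p => -Real.log (-r p)) ∘ a.symm =ᶠ[𝓝 (a p)]
        fun y => -Real.log (-f (a.symm y)) := by
      filter_upwards [(htend hpa).eventually hpr] with y hy
      simp only [Function.comp_apply, hy]
    rw [leviE_congr h1]
    refine le_trans ?_ (hp hpΩ (A v))
    have h2 := hpM v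
    rw [← hAe] at h2
    calc c / M * (g.form p v v).re ≤ c / M * (M * ‖A v‖ ^ 2) :=
          mul_le_mul_of_nonneg_left h2 (by positivity)
      _ = c * ‖A v‖ ^ 2 := by field_simp
  choose ε hε hev using key
  have hS : IsCompact (frontier Ω) := isClosed_frontier.isCompact
  obtain ⟨t, hcov⟩ := hS.elim_nhds_subcover' _ fun q hq => eventually_eventually_nhds.2 (hev q hq)
  obtain ⟨ε₀, hε₀, hεt⟩ : ∃ ε₀ > 0, ∀ q ∈ t, ε₀ < ε q q.2 := by
    rcases t.eq_empty_or_nonempty with rfl | hne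
    · exact ⟨1, one_pos, by simp⟩
    · obtain ⟨q, hq, hmin⟩ := t.exists_min_image (fun q => ε q q.2) hne
      have := hε q q.2
      exact ⟨ε q q.2 / 2, by positivity, fun q' hq' => by linarith [hmin q' hq']⟩
  set V : Set X := {p | ∀ᶠ p' in 𝓝 p, p' ∈ Ω → ∀ v, v ≠ 0 → ε₀ * (g.form p' v v).re <
    (leviForm (ℂ × ℂ) (fun p => -Real.log (-r p)) p' v v).re} with hV
  have hVo : IsOpen V := isOpen_setOfPred_eventually_nhds
  have hSV : frontier Ω ⊆ V := by
    intro p hp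
    obtain ⟨q, hq, hpq⟩ := mem_iUnion₂.1 (hcov hp)
    have hpq' : ∀ᶠ p' in 𝓝 p, p' ∈ Ω → ∀ v, v ≠ 0 → ε q q.2 * (g.form p' v v).re ≤
      (leviForm (ℂ × ℂ) (fun p => -Real.log (-r p)) p' v v).re := hpq
    filter_upwards [hpq'] with p' hp' hpΩ v hv
    exact lt_of_lt_of_le (mul_lt_mul_of_pos_right (hεt q hq) (g.pos p' v hv)) (hp' hpΩ v hv)
  -- Scaling the metric by `ε₀` turns the bound `L > ε₀ g` into eigenvalues greater than `1`. The
  -- exceptional set is compact in `Ω`, because `V` is an open neighbourhood of the frontier.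
  refine ⟨g.scale ε₀ hε₀, closure Ω \ V, (isClosed_closure.inter hVo.isClosed_compl).isCompact,
    ?_, fun p hp => ?_⟩
  · rintro p ⟨hp, hpV⟩
    by_contra h
    exact hpV (hSV (by rw [hΩ.frontier_eq]; exact ⟨hp, h⟩))
  · have hpV : p ∈ V := by
      by_contra h
      exact hp.2 ⟨subset_closure hp.1, h⟩
    rw [Nat.add_sub_cancel]
    refine hasEigenvaluesGtOne_of_lt _ (hlogc (IsManifold.chart_mem_maximalAtlas p)
      (mem_chart_source _ p) hp.1) fun v hv => ?_
    have h1 := hpV.self_of_nhds hp.1 v hv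
    have h2 : ((g.scale ε₀ hε₀).form p v v).re = ε₀ * (g.form p v v).re := by
      change ((ε₀ : ℂ) * g.form p v v).re = _
      rw [Complex.re_ofReal_mul]
    rw [h2]
    exact h1

end Takeuchi

/-! ### The global weight: Poisson kernel over fibre derivative. -/

section Weight

open RiemannSphere

variable {C P : Type*} [TopologicalSpace C] [ChartedSpace ℂ C]
  [TopologicalSpace P] [ChartedSpace (ℂ × ℂ) P]

namespace DiscBundle

variable (B : DiscBundle C P) in
/-- The quotient of the Poisson kernel and the fibre derivative of a function `ρ`, in a flat
trivialization. -/
noncomputable def fibreWeight (s : C → P) (ρ : P → ℝ) (e : Trivialization (OnePoint ℂ) B.proj)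
    (p : P) : ℝ :=
  poisson (toComplex (e (s (B.proj p))).2) (toComplex (e p).2) /
    ‖dz 1 (fun w : ℂ => ((ρ (e.toOpenPartialHomeomorph.symm (B.proj p, (w : OnePoint ℂ))) : ℝ) : ℂ))
      (toComplex (e p).2)‖

variable {B : DiscBundle C P} {e e' : Trivialization (OnePoint ℂ) B.proj} {x : C} {p : P} {s : C → P}
  {ρ : P → ℝ}

lemma fibre_eq_coord (hp : p ∈ (B.coord e x).source) (w : ℂ) :
    e.toOpenPartialHomeomorph.symm (B.proj p, (w : OnePoint ℂ)) =
      (B.coord e x).symm ((B.coord e x p).1, w) := by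
  rw [coord_symm, coord_fst hp, (chartAt ℂ x).left_inv (mem_coord_source.1 hp).2.1]

lemma fibreWeight_eq_coord (hp : p ∈ (B.coord e x).source)
    (hρ : DifferentiableAt ℝ (ρ ∘ (B.coord e x).symm) (B.coord e x p)) :
    B.fibreWeight s ρ e p = poisson (B.localSection s e x (B.coord e x p).1) (B.coord e x p).2 /
      ‖dz (0, 1) (fun y => (((ρ ∘ (B.coord e x).symm) y : ℝ) : ℂ)) (B.coord e x p)‖ := by
  have h1 : DifferentiableAt ℂ (fun w : ℂ => ((B.coord e x p).1, w)) (B.coord e x p).2 := by fun_prop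
  have h2 : HasFDerivAt (fun w : ℂ => ((B.coord e x p).1, w)) (ContinuousLinearMap.inr ℂ ℂ ℂ)
    (B.coord e x p).2 := hasFDerivAt_prodMk_right _ _
  have h3 := dz_comp (Ψ := fun w : ℂ => ((B.coord e x p).1, w))
    (f := fun y => (((ρ ∘ (B.coord e x).symm) y : ℝ) : ℂ)) h1
    (Complex.ofRealCLM.differentiableAt.comp _ hρ) 1
  rw [h2.fderiv] at h3
  rw [fibreWeight, ← coord_snd hp]
  simp only [fibre_eq_coord hp]
  rw [localSection, coord_fst hp, (chartAt ℂ x).left_inv (mem_coord_source.1 hp).2.1]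
  congr 2
  have h4 : (ContinuousLinearMap.inr ℂ ℂ ℂ) 1 = (0, 1) := rfl
  rw [h4] at h3
  rw [← coord_fst hp]
  exact h3

/-- Passing from `e` to `e'` by `m(ζ) = (aζ + b)/(cζ + d)` multiplies the Poisson kernel by `|cζ +
d|² / k = 1 / |m'(ζ)|`, by `poisson_moebius` and `|ad - bc| = k`. The chain rule multiplies the
modulus of the fibre derivative of `ρ` by the same factor. -/
lemma fibreWeight_eq (hs : B.IsHarmonicSection s) (he : e ∈ B.trivs) (he' : e' ∈ B.trivs)
    (hp : p ∈ (B.coord e x).source) (hp' : p ∈ (B.coord e' x).source)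
    (hρ : DifferentiableAt ℝ (ρ ∘ (B.coord e' x).symm) (B.coord e' x p)) :
    B.fibreWeight s ρ e p = B.fibreWeight s ρ e' p := by
  obtain ⟨hpe, hpx, -⟩ := mem_coord_source.1 hp
  obtain ⟨hpe', -, -⟩ := mem_coord_source.1 hp'
  obtain ⟨g, hg, hgp⟩ := transition_coeff he he' hpe hpe'
  obtain ⟨a, b, c, d, k, hk, hdet, hact, hform⟩ := IsDiscAut.exists_coeff hg
  set ζ := (B.coord e x p).2 with hζ
  set h := B.localSection s e x (chartAt ℂ x (B.proj p)) with hh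
  have eζ : (e p).2 = (ζ : OnePoint ℂ) := coe_coord_snd hp
  have eh : (e (s (B.proj p))).2 = (h : OnePoint ℂ) := coe_localSection hs he hpe hpx
  have eζ' := hgp p rfl
  have eh' := hgp (s (B.proj p)) (hs.1 _)
  rw [eζ, hact, coe_coord_snd hp'] at eζ'
  rw [eh, hact, coe_localSection hs he' hpe' hpx] at eh'
  have hcζ : c * ζ + d ≠ 0 := fun h0 => by rw [if_pos h0] at eζ'; exact OnePoint.coe_ne_infty _ eζ'
  have hch : c * h + d ≠ 0 := fun h0 => by rw [if_pos h0] at eh'; exact OnePoint.coe_ne_infty _ eh'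
  rw [if_neg hcζ] at eζ'
  rw [if_neg hch] at eh'
  have t1 : toComplex (e p).2 = ζ := by rw [eζ]; rfl
  have t2 : toComplex (e (s (B.proj p))).2 = h := by rw [eh]; rfl
  have t3 : toComplex (e' p).2 = (a * ζ + b) / (c * ζ + d) := by
    rw [coe_coord_snd hp', eζ']; rfl
  have t4 : toComplex (e' (s (B.proj p))).2 = (a * h + b) / (c * h + d) := by
    rw [coe_localSection hs he' hpe' hpx, eh']; rfl
  have hm := hasDerivAt_moebius (a := a) (b := b) hcζ
  set F' : ℂ → ℂ := fun w =>
    ((ρ (e'.toOpenPartialHomeomorph.symm (B.proj p, (w : OnePoint ℂ))) : ℝ) : ℂ) with hF'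
  have hF'd : DifferentiableAt ℝ F' ((a * ζ + b) / (c * ζ + d)) := by
    have h1 : F' = fun w => (((ρ ∘ (B.coord e' x).symm) ((B.coord e' x p).1, w) : ℝ) : ℂ) := by
      ext w; rw [hF']; simp only [fibre_eq_coord hp', Function.comp_apply]
    have h2 : (B.coord e' x p).2 = (a * ζ + b) / (c * ζ + d) := by rw [coord_snd hp', t3]
    rw [h1]
    refine Complex.ofRealCLM.differentiableAt.comp _ ?_
    have h3 : DifferentiableAt ℝ (fun w : ℂ => ((B.coord e' x p).1, w))
      ((a * ζ + b) / (c * ζ + d)) := by fun_prop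
    refine DifferentiableAt.comp (g := ρ ∘ (B.coord e' x).symm) _ ?_ h3
    rw [← h2]; exact hρ
  have hcomp : (fun w : ℂ =>
      ((ρ (e.toOpenPartialHomeomorph.symm (B.proj p, (w : OnePoint ℂ))) : ℝ) : ℂ)) =ᶠ[𝓝 ζ]
      fun w => F' ((a * w + b) / (c * w + d)) := by
    have h1 : ∀ᶠ w in 𝓝 ζ, c * w + d ≠ 0 :=
      (Continuous.continuousAt (by fun_prop)).eventually_ne hcζ
    filter_upwards [h1] with w hw
    set p' := e.toOpenPartialHomeomorph.symm (B.proj p, (w : OnePoint ℂ)) with hp'def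
    have k1 : B.proj p' = B.proj p := e.proj_symm_apply' hpe
    have k2 : (e p').2 = (w : OnePoint ℂ) := by rw [hp'def, e.apply_symm_apply' hpe]
    have k3 := hgp p' k1
    rw [k2, hact, if_neg hw] at k3
    have k4 : p' ∈ e'.source := e'.mem_source.2 (by rw [k1]; exact hpe')
    have k5 : e'.toOpenPartialHomeomorph.symm
        (B.proj p, (((a * w + b) / (c * w + d) : ℂ) : OnePoint ℂ)) = p' := by
      rw [← k3]
      have : (B.proj p, (e' p').2) = e' p' := Prod.ext (by rw [e'.coe_fst k4, k1]) rfl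
      rw [this]
      exact e'.toOpenPartialHomeomorph.left_inv k4
    simp only [hF', k5]
  -- Chain rule along the fibre, with `m'(ζ) = (ad - bc)/(cζ + d)²`.
  have hdz : dz 1 (fun w : ℂ =>
      ((ρ (e.toOpenPartialHomeomorph.symm (B.proj p, (w : OnePoint ℂ))) : ℝ) : ℂ)) ζ =
      (a * d - b * c) / (c * ζ + d) ^ 2 * dz 1 F' ((a * ζ + b) / (c * ζ + d)) := by
    rw [dz_congr hcomp, dz_comp hm.differentiableAt hF'd, ← dz_smul, hm.hasFDerivAt.fderiv]
    simp
  rw [fibreWeight, fibreWeight, t1, t2, t3, t4, hdz, poisson_moebius hk hform hch hcζ, norm_mul,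
    norm_div, hdet, norm_pow, ← hF']
  have hn : ‖c * ζ + d‖ ≠ 0 := norm_ne_zero_iff.2 hcζ
  generalize ‖dz 1 F' ((a * ζ + b) / (c * ζ + d))‖ = N
  by_cases h0 : N = 0
  · rw [h0]; simp
  · field_simp

/-- The quotient of the Poisson kernel and the fibre derivative does not depend on the flat
trivialization. -/
lemma exists_weight [IsManifold 𝓘(ℂ) ω C] [IsManifold 𝓘(ℂ, ℂ × ℂ) ω P] (hs : B.IsHarmonicSection s)
    (ρ : P → ℝ) : ∃ w : P → ℝ, ∀ e ∈ B.trivs, ∀ x, ∀ p ∈ (B.coord e x).source,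
      ContMDiffAt 𝓘(ℝ, ℂ × ℂ) 𝓘(ℝ, ℝ) 1 ρ p →
      w p = poisson (B.localSection s e x (B.coord e x p).1) (B.coord e x p).2 /
        ‖dz (0, 1) (fun y => (((ρ ∘ (B.coord e x).symm) y : ℝ) : ℂ)) (B.coord e x p)‖ := by
  classical
  refine ⟨fun p => if h : ∃ e ∈ B.trivs, p ∈ (B.coord e (B.proj p)).source then
    B.fibreWeight s ρ h.choose p else 0, fun e he x p hp hρ => ?_⟩
  have hd {e : Trivialization (OnePoint ℂ) B.proj} {x : C} (he : e ∈ B.trivs)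
      (hp : p ∈ (B.coord e x).source) :
      DifferentiableAt ℝ (ρ ∘ (B.coord e x).symm) (B.coord e x p) := by
    refine (ContMDiffAt.contDiffAt_chart (n := 1) (coord_mem_maximalAtlas he)
      ((B.coord e x).map_source hp) ?_).differentiableAt (by simp)
    rwa [(B.coord e x).left_inv hp]
  obtain ⟨h1, h2, h3⟩ := mem_coord_source.1 hp
  have hp0 : p ∈ (B.coord e (B.proj p)).source := mem_coord_source.2 ⟨h1, mem_chart_source ℂ _, h3⟩
  have h : ∃ e ∈ B.trivs, p ∈ (B.coord e (B.proj p)).source := ⟨e, he, hp0⟩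
  simp only [dif_pos h]
  rw [fibreWeight_eq hs h.choose_spec.1 he h.choose_spec.2 hp0 (hd he hp0),
    fibreWeight_eq_coord hp (hd he hp)]

end DiscBundle

end Weight

lemma tendsto_symm_of_mem_source {X E : Type*} [TopologicalSpace X] [TopologicalSpace E]
    {a : OpenPartialHomeomorph X E} {p : X} (hp : p ∈ a.source) :
    Tendsto a.symm (𝓝 (a p)) (𝓝 p) := by
  have := a.continuousAt_symm (a.map_source hp)
  rwa [ContinuousAt, a.left_inv hp] at this

/-! ### Levi-flat hypersurfaces in arbitrary charts and for arbitrary defining functions. -/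

section LeviFlat

variable {E : Type*} [NormedAddCommGroup E] [NormedSpace ℂ E]
  {X : Type*} [TopologicalSpace X] [ChartedSpace E X] [IsManifold 𝓘(ℂ, E) ω X]

/-- The Levi form of an arbitrary defining function of a Levi-flat hypersurface vanishes on the
complex tangent vectors. -/
lemma IsLeviFlat.eventually_leviE_eq_zero {S : Set X} (hS : IsLeviFlat E S)
    {a : OpenPartialHomeomorph X E} (ha : a ∈ IsManifold.maximalAtlas 𝓘(ℂ, E) ω X) {q : X}
    (hq : q ∈ S) (hqa : q ∈ a.source) {ρ : X → ℝ} (hρ : ContDiffAt ℝ 2 (ρ ∘ a.symm) (a q))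
    (hzero : ∀ᶠ p in 𝓝 q, p ∈ S ↔ ρ p = 0) (hd : fderiv ℝ (ρ ∘ a.symm) (a q) ≠ 0) (e₁ e₂ : E) :
    ∀ᶠ y in 𝓝 (a q), (ρ ∘ a.symm) y = 0 → leviE (ρ ∘ a.symm) y
      (complexTangent e₁ e₂ (ρ ∘ a.symm) y) (complexTangent e₁ e₂ (ρ ∘ a.symm) y) = 0 := by
  obtain ⟨V, r, hVo, hqV, hr, hSV, hlevi⟩ := hS q hq
  have hdc : ∀ᶠ y in 𝓝 (a q), fderiv ℝ (ρ ∘ a.symm) y ≠ 0 :=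
    ((hρ.fderiv_right (m := 0) (by norm_num)).continuousAt).eventually_ne hd
  have ht := tendsto_symm_of_mem_source hqa
  filter_upwards [hdc, hρ.eventually (by simp), a.open_target.mem_nhds (a.map_source hqa),
    ht.eventually (hVo.mem_nhds hqV), ht.eventually hzero.eventually_nhds]
    with y hdy hρy hyt hyV hyz hy0
  set p := a.symm y with hp
  have hay : a p = y := a.right_inv hyt
  have hpa : p ∈ a.source := a.map_target hyt
  have hpS : p ∈ S ∩ V := ⟨hyz.self_of_nhds.2 hy0, hyV⟩
  obtain ⟨hdr, hL⟩ := hlevi p hpS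
  have hrc : ContDiffAt ℝ 2 (r ∘ a.symm) y :=
    ContMDiffAt.contDiffAt_chart ha hyt (hr.contMDiffAt (hVo.mem_nhds hyV))
  obtain ⟨A, -, hA⟩ := exists_leviForm_eq ha hpa
  rw [hay] at hA
  obtain ⟨hA1, hA2⟩ := hA r hrc
  have hvan : ∀ᶠ y' in 𝓝 y, (ρ ∘ a.symm) y' = 0 → (r ∘ a.symm) y' = 0 := by
    have ht' : Tendsto a.symm (𝓝 y) (𝓝 p) := by
      have := tendsto_symm_of_mem_source hpa
      rwa [hay] at this
    filter_upwards [ht'.eventually hyz, ht'.eventually (hVo.mem_nhds hyV)] with y' h1 h2 h3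
    have h4 : a.symm y' ∈ S ∩ V := ⟨h1.2 h3, h2⟩
    rw [hSV] at h4
    exact h4.2
  obtain ⟨k, hk, -⟩ := exists_fderiv_eq_mul_of_vanish (hrc.of_le (by norm_num))
    (hρy.of_le (by norm_num)) hy0 hdy hvan
  refine leviE_eq_zero_of_defining hrc hρy (fun h0 => hdr ?_) hdy hy0 hvan ?_
  · refine ContinuousLinearMap.ext fun v => ?_
    rw [hA1, h0]; rfl
  · set v := complexTangent e₁ e₂ (ρ ∘ a.symm) y with hv
    have htan (c : ℂ) : differential E r p (c • A.symm v) = 0 := by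
      rw [hA1, map_smul, A.apply_symm_apply, hk, hv,
        fderiv_complexTangent (hρy.differentiableAt (by norm_num)), mul_zero]
    have h1 := htan 1
    rw [one_smul] at h1
    have h2 := hL (A.symm v) (A.symm v) h1 (htan Complex.I) h1 (htan Complex.I)
    rwa [hA2, A.apply_symm_apply] at h2

end LeviFlat

/-! ### Persistence of positivity under small displacements. -/

section Adapted

variable {C P : Type*} [TopologicalSpace C] [ChartedSpace ℂ C]
  [TopologicalSpace P] [ChartedSpace (ℂ × ℂ) P]

namespace DiscBundle

variable (B : DiscBundle C P) in
/-- In the coordinates `(z, ζ)`, the weight is smooth at `p` and has a positive Levi form on the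
complex tangent vectors of the level sets of `ρ`. -/
structure IsAdapted (s : C → P) (ψ : C → ℝ) (ρ : P → ℝ) (e : Trivialization (OnePoint ℂ) B.proj)
    (x : C) (p : P) : Prop where
  mem_source : p ∈ (B.coord e x).source
  dz_ne_zero : dz (0, 1) (fun y => (((ρ ∘ (B.coord e x).symm) y : ℝ) : ℂ)) (B.coord e x p) ≠ 0
  contDiffAt : ContDiffAt ℝ 2 (B.logWeight s ψ e x) (B.coord e x p)
  levi_pos : 0 < (leviE (B.logWeight s ψ e x) (B.coord e x p)
    (complexTangent (1, 0) (0, 1) (ρ ∘ (B.coord e x).symm) (B.coord e x p))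
    (complexTangent (1, 0) (0, 1) (ρ ∘ (B.coord e x).symm) (B.coord e x p))).re
  poisson_pos : 0 < poisson (B.localSection s e x (B.coord e x p).1) (B.coord e x p).2

end DiscBundle

/-- The `(1,0)` part of a real covector. -/
noncomputable def covectorDz {E : Type*} [NormedAddCommGroup E] [NormedSpace ℂ E] (u : E)
    (l : E →L[ℝ] ℝ) : ℂ :=
  ((l u : ℂ) - Complex.I * (l (Complex.I • u) : ℂ)) / 2

lemma dz_ofReal_eq {E : Type*} [NormedAddCommGroup E] [NormedSpace ℂ E] {ρ : E → ℝ} {y : E}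
    (hρ : DifferentiableAt ℝ ρ y) (u : E) :
    dz u (fun y => (ρ y : ℂ)) y = covectorDz u (fderiv ℝ ρ y) := by
  rw [dz, fderiv_ofReal hρ, fderiv_ofReal hρ, covectorDz]

lemma continuous_covectorDz {E : Type*} [NormedAddCommGroup E] [NormedSpace ℂ E] (u : E) :
    Continuous (covectorDz u) := by
  unfold covectorDz
  fun_prop

/-- The positivity of a Levi form on complex tangent lines is an open condition. -/
lemma eventually_levi_pos {E : Type*} [NormedAddCommGroup E] [NormedSpace ℂ E] {g : E → ℝ}
    {y₀ e₁ e₂ : E} (hg : ContDiffAt ℝ 2 g y₀) {l₀ : E →L[ℝ] ℝ} (h1 : covectorDz e₁ l₀ = 0)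
    (h2 : covectorDz e₂ l₀ ≠ 0) (hpos : 0 < (leviE g y₀ e₁ e₁).re) :
    ∀ᶠ yl in 𝓝 (y₀, l₀), covectorDz e₂ yl.2 ≠ 0 ∧
      0 < (leviE g yl.1 (covectorDz e₂ yl.2 • e₁ - covectorDz e₁ yl.2 • e₂)
        (covectorDz e₂ yl.2 • e₁ - covectorDz e₁ yl.2 • e₂)).re := by
  have c (u : E) : ContinuousAt (fun yl : E × (E →L[ℝ] ℝ) => covectorDz u yl.2) (y₀, l₀) :=
    ((continuous_covectorDz u).comp continuous_snd).continuousAt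
  have cL : ContinuousAt (fun yl : E × (E →L[ℝ] ℝ) => leviE g yl.1
      (covectorDz e₂ yl.2 • e₁ - covectorDz e₁ yl.2 • e₂)
      (covectorDz e₂ yl.2 • e₁ - covectorDz e₁ yl.2 • e₂)) (y₀, l₀) := by
    have cl (v w : E) : ContinuousAt (fun yl : E × (E →L[ℝ] ℝ) => leviE g yl.1 v w) (y₀, l₀) :=
      ContinuousAt.comp (f := Prod.fst) (g := fun y => leviE g y v w)
        (continuousAt_leviE hg continuousAt_const continuousAt_const) continuousAt_fst
    have cc (u : E) : ContinuousAt
        (fun yl : E × (E →L[ℝ] ℝ) => (starRingEnd ℂ) (covectorDz u yl.2)) (y₀, l₀) :=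
      Complex.continuous_conj.continuousAt.comp (c u)
    simp only [leviE_combo]
    exact (((((cc e₂).mul (c e₂)).mul (cl _ _)).sub (((cc e₂).mul (c e₁)).mul (cl _ _))).sub
      (((cc e₁).mul (c e₂)).mul (cl _ _))).add (((cc e₁).mul (c e₁)).mul (cl _ _))
  refine ((c e₂).eventually_ne h2).and ?_
  refine (Complex.continuous_re.continuousAt.comp cL).eventually (lt_mem_nhds ?_)
  -- At the base point the tangent vector is a nonzero multiple of `e₁`.
  simp only [Function.comp_apply, h1, zero_smul, sub_zero]
  rw [leviE_smul_left, leviE_smul_right, ← mul_assoc, mul_comm ((starRingEnd ℂ) _),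
    Complex.mul_conj, Complex.re_ofReal_mul]
  exact mul_pos (Complex.normSq_pos.2 h2) hpos

namespace DiscBundle

variable [IsManifold 𝓘(ℂ) ω C] [IsManifold 𝓘(ℂ, ℂ × ℂ) ω P]
  {B : DiscBundle C P} (T : TubularNbhd (ℂ × ℂ) (frontier B.disc))
  {e : Trivialization (OnePoint ℂ) B.proj} {x : C} {q : P} {s : C → P} {ψ : C → ℝ}

/-- The leaves `ζ = const` lie in `∂D`, where `height` vanishes, so `d height` kills the
`z`-direction. As it is not zero, its `ζ`-part cannot vanish. -/
lemma covectorDz_height (he : e ∈ B.trivs) (hq : q ∈ frontier B.disc)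
    (hqs : q ∈ (B.coord e x).source) :
    covectorDz (1, 0) (fderiv ℝ (T.height ∘ (B.coord e x).symm) (B.coord e x q)) = 0 ∧
      covectorDz (0, 1) (fderiv ℝ (T.height ∘ (B.coord e x).symm) (B.coord e x q)) ≠ 0 := by
  set κ := B.coord e x with hκ
  obtain ⟨-, hd⟩ := tubular_normal_form T he hq hqs
  have hc := T.contDiffAt_height (coord_mem_maximalAtlas (x := x) he) hqs (T.subset hq)
  set l := fderiv ℝ (T.height ∘ κ.symm) (κ q) with hl
  have h0 (v : ℂ) : l (v, 0) = 0 := by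
    have h1 : HasDerivAt (fun t : ℝ => κ q + t • (v, (0 : ℂ))) (v, 0) 0 := by
      simpa using ((hasDerivAt_id (0 : ℝ)).smul_const (v, (0 : ℂ))).const_add (κ q)
    have h2 : HasFDerivAt (T.height ∘ κ.symm) l (κ q + (0 : ℝ) • (v, (0 : ℂ))) := by
      simpa using (hc.differentiableAt (by simp)).hasFDerivAt
    have h3 := h2.comp_hasDerivAt (0 : ℝ) h1
    have h4 : ((T.height ∘ κ.symm) ∘ fun t : ℝ => κ q + t • (v, (0 : ℂ))) =ᶠ[𝓝 0]
        fun _ => 0 := by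
      have h5 : ∀ᶠ t in 𝓝 (0 : ℝ), κ q + t • (v, (0 : ℂ)) ∈ κ.target :=
        h1.continuousAt.eventually (κ.open_target.mem_nhds (by simpa using κ.map_source hqs))
      filter_upwards [h5] with t ht
      refine (T.zero_section _ ((mem_frontier_iff_coord he (κ.map_target ht)).2 ?_)).2
      rw [κ.right_inv ht]
      simpa using (mem_frontier_iff_coord he hqs).1 hq
    exact h3.unique ((hasDerivAt_const (0 : ℝ) (0 : ℝ)).congr_of_eventuallyEq h4)
  constructor
  · simp [covectorDz, h0]
  · intro h1
    apply hd
    have h2 : (l (0, 1) : ℂ) - Complex.I * (l (Complex.I • ((0 : ℂ), (1 : ℂ))) : ℂ) = 0 := by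
      simpa [covectorDz] using h1
    have h3 := congrArg Complex.re h2
    have h4 := congrArg Complex.im h2
    simp at h3 h4
    refine ContinuousLinearMap.ext fun u => ?_
    have h5 : u = (u.1, (0 : ℂ)) + (u.2.re • ((0 : ℂ), (1 : ℂ)) + u.2.im • ((0 : ℂ), Complex.I)) := by
      ext <;> simp
    rw [h5, map_add, map_add, map_smul, map_smul, h0, h3, h4]
    simp

/-- Positivity of the weight on the complex tangent line depends on `ρ` only through `dρ`. It holds
on `∂D` for `ρ = height`, so it survives if the point moves a little and `σ` is small together with
its first derivatives. -/
lemma eventually_isAdapted [T2Space P] (hs : B.IsHarmonicSection s)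
    (A : ChartCover (ℂ × ℂ) (frontier B.disc)) (hψ : ContMDiff 𝓘(ℝ, ℂ) 𝓘(ℝ, ℝ) ∞ ψ)
    (he : e ∈ B.trivs) (hq : q ∈ frontier B.disc) (hqs : q ∈ (B.coord e x).source)
    (hpos : 0 < (leviE (B.logWeight s ψ e x) (B.coord e x q) (1, 0) (1, 0)).re) :
    ∃ δ > 0, ∀ᶠ p in 𝓝 q, ∀ σ, T.IsAnalyticSection σ → T.C2NormLT A σ δ →
      B.IsAdapted s ψ (fun p => T.height p - σ (T.base p)) e x p := by
  have ha := coord_mem_maximalAtlas (B := B) (x := x) he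
  set κ := B.coord e x with hκ
  have hqT := T.subset hq
  have hg := contDiffAt_logWeight hs he hψ (κ.map_source hqs) ((mem_frontier_iff_coord he hqs).1 hq)
  obtain ⟨h1, h2⟩ := covectorDz_height T he hq hqs
  have hopen := eventually_levi_pos hg h1 h2 hpos
  set l₀ := fderiv ℝ (T.height ∘ κ.symm) (κ q) with hl₀
  rw [nhds_prod_eq] at hopen
  obtain ⟨pa, hpa, pb, hpb, hab⟩ := eventually_prod_iff.1 hopen
  obtain ⟨η, hη, hball⟩ := Metric.eventually_nhds_iff.1 hpb
  obtain ⟨M, hM, hMev⟩ := T.exists_fderiv_section_bound A ha hq hqs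
  have hκc : ContinuousAt κ q := κ.continuousAt hqs
  have hlc : ContinuousAt (fun p => fderiv ℝ (T.height ∘ κ.symm) (κ p)) q :=
    ContinuousAt.comp (f := κ)
      ((T.contDiffAt_height ha hqs hqT).fderiv_right (m := 0) le_top).continuousAt hκc
  have hpois : ContinuousAt (fun p => 1 - (starRingEnd ℂ) (B.localSection s e x (κ p).1) * (κ p).2)
      q ∧ ContinuousAt (fun p => ‖B.localSection s e x (κ p).1‖) q := by
    obtain ⟨hqe, hqx, -⟩ := mem_coord_source.1 hqs
    have k1 : ContinuousAt (fun p => B.localSection s e x (κ p).1) q := by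
      have k2 := (contDiffAt_localSection hs he hqe hqx).continuousAt
      rw [← coord_fst hqs] at k2
      exact ContinuousAt.comp (f := fun p => (κ p).1) k2 hκc.fst
    exact ⟨continuousAt_const.sub ((Complex.continuous_conj.continuousAt.comp k1).mul hκc.snd),
      k1.norm⟩
  have hlt : ‖B.localSection s e x (κ q).1‖ < 1 := by
    obtain ⟨hqe, hqx, -⟩ := mem_coord_source.1 hqs
    rw [coord_fst hqs]
    exact norm_localSection_lt hs he hqe hqx
  have hne := one_sub_conj_mul_ne_zero hlt ((mem_frontier_iff_coord he hqs).1 hq).le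
  -- Half of the tolerance `η` is spent on moving the point, and the other half on `d(σ ∘ base)`,
  -- which is at most `M δ`.
  refine ⟨η / (2 * M), by positivity, ?_⟩
  filter_upwards [hκc.eventually hpa, hκc.eventually (hg.eventually (by simp)),
    hlc.eventually (Metric.ball_mem_nhds _ (half_pos hη)), hMev, κ.open_source.mem_nhds hqs,
    T.isOpen.mem_nhds hqT, hpois.1.eventually_ne hne, hpois.2.eventually (gt_mem_nhds hlt)]
    with p hpy hpg hpl hpM hps hpT hp1 hp2 σ hσ hA
  have hσd : DifferentiableAt ℝ ((σ ∘ T.base) ∘ κ.symm) (κ p) := by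
    refine (ContMDiffAt.contDiffAt_chart (n := ω) ha (κ.map_source hps) ?_).differentiableAt
      (by simp)
    rw [κ.left_inv hps]
    exact hσ.contMDiffAt (T.isOpen.mem_nhds hpT)
  have hhd : DifferentiableAt ℝ (T.height ∘ κ.symm) (κ p) :=
    (T.contDiffAt_height ha hps hpT).differentiableAt (by simp)
  have hρd : DifferentiableAt ℝ ((fun p => T.height p - σ (T.base p)) ∘ κ.symm) (κ p) :=
    hhd.sub hσd
  have hfd : fderiv ℝ ((fun p => T.height p - σ (T.base p)) ∘ κ.symm) (κ p) =
      fderiv ℝ (T.height ∘ κ.symm) (κ p) - fderiv ℝ ((σ ∘ T.base) ∘ κ.symm) (κ p) :=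
    fderiv_sub hhd hσd
  have hclose : dist (fderiv ℝ ((fun p => T.height p - σ (T.base p)) ∘ κ.symm) (κ p)) l₀ < η := by
    have k1 := hpM σ _ (by positivity) hσ hA
    have k2 : M * (η / (2 * M)) = η / 2 := by field_simp
    rw [k2] at k1
    rw [dist_eq_norm] at hpl
    rw [dist_eq_norm, hfd, sub_right_comm]
    exact (norm_sub_le _ _).trans_lt (by linarith)
  obtain ⟨k1, k2⟩ := hab hpy (hball hclose)
  refine ⟨hps, ?_, hpg, ?_, ?_⟩
  · rw [dz_ofReal_eq hρd]
    exact k1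
  · rw [complexTangent, dz_ofReal_eq hρd, dz_ofReal_eq hρd]
    exact k2
  · have k3 : 0 < 1 - ‖B.localSection s e x (κ p).1‖ ^ 2 := by
      nlinarith [norm_nonneg (B.localSection s e x (κ p).1)]
    have k4 : 0 < ‖1 - (starRingEnd ℂ) (B.localSection s e x (κ p).1) * (κ p).2‖ :=
      norm_pos_iff.2 hp1
    exact div_pos k3 (pow_pos k4 2)

end DiscBundle

end Adapted

/-! ### The defining function `F = e^{-g} ρ / |∂_e ρ|`. -/

section Weighted

variable {E : Type*} [NormedAddCommGroup E] [NormedSpace ℂ E] {ρ g F : E → ℝ} {e y₀ : E}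

lemma contDiffAt_of_eventually_weighted (hρ : ContDiffAt ℝ 3 ρ y₀) (hg : ContDiffAt ℝ 2 g y₀)
    (hd : dz e (fun y => (ρ y : ℂ)) y₀ ≠ 0)
    (hF : ∀ᶠ y in 𝓝 y₀, F y = Real.exp (-g y) / ‖dz e (fun y => (ρ y : ℂ)) y‖ * ρ y) :
    ContDiffAt ℝ 2 F y₀ :=
  ((hg.neg.exp.div ((hρ.ofReal.dz (m := 2) (by norm_num) e).norm ℝ hd) (norm_ne_zero_iff.2 hd)).mul
    (hρ.of_le (by norm_num))).congr_of_eventuallyEq hF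

lemma weighted_neg_iff (hd : dz e (fun y => (ρ y : ℂ)) y₀ ≠ 0)
    (hF : ∀ᶠ y in 𝓝 y₀, F y = Real.exp (-g y) / ‖dz e (fun y => (ρ y : ℂ)) y‖ * ρ y) :
    F y₀ < 0 ↔ ρ y₀ < 0 := by
  rw [hF.self_of_nhds]
  have h := div_pos (Real.exp_pos (-g y₀)) (norm_pos_iff.2 hd)
  exact ⟨fun h1 => neg_of_mul_neg_right h1 h.le, mul_neg_of_pos_of_neg h⟩

lemma fderiv_weighted_ne_zero (hρ : ContDiffAt ℝ 3 ρ y₀) (hg : ContDiffAt ℝ 2 g y₀)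
    (hd : dz e (fun y => (ρ y : ℂ)) y₀ ≠ 0) (h0 : ρ y₀ = 0)
    (hF : ∀ᶠ y in 𝓝 y₀, F y = Real.exp (-g y) / ‖dz e (fun y => (ρ y : ℂ)) y‖ * ρ y) :
    fderiv ℝ F y₀ ≠ 0 := by
  have hρd : DifferentiableAt ℝ ρ y₀ := hρ.differentiableAt (by norm_num)
  have h1 : DifferentiableAt ℝ
      (fun y => Real.exp (-g y) / ‖dz e (fun y => (ρ y : ℂ)) y‖) y₀ :=
    (hg.neg.exp.div ((hρ.ofReal.dz (m := 2) (by norm_num) e).norm ℝ hd)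
      (norm_ne_zero_iff.2 hd)).differentiableAt (by norm_num)
  rw [Filter.EventuallyEq.fderiv_eq hF, fderiv_fun_mul h1 hρd, h0, zero_smul, add_zero]
  refine smul_ne_zero (div_pos (Real.exp_pos _) (norm_pos_iff.2 hd)).ne' fun h2 => hd ?_
  rw [dz_ofReal_eq hρd, h2]
  simp [covectorDz]

/-- The positive factor of `ρ` in `F` is chosen so that the logarithm yields precisely the function
estimated in `levi_lower_bound`. -/
lemma leviE_neg_log_weighted (hρ : ContDiffAt ℝ 3 ρ y₀)
    (hd : dz e (fun y => (ρ y : ℂ)) y₀ ≠ 0)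
    (hF : ∀ᶠ y in 𝓝 y₀, F y = Real.exp (-g y) / ‖dz e (fun y => (ρ y : ℂ)) y‖ * ρ y) :
    ∀ᶠ y in 𝓝 y₀, ρ y < 0 → leviE (fun y => -Real.log (-F y)) y =
      leviE (fun y => (g y + Real.log ‖dz e (fun y => (ρ y : ℂ)) y‖) + -Real.log (-ρ y)) y := by
  have hdc := (hρ.ofReal.dz (m := 2) (by norm_num) e).continuousAt.eventually_ne hd
  filter_upwards [hF.eventually_nhds, hdc.eventually_nhds, hρ.eventually (by simp)]
    with y hFy hdy hρy hy0
  refine leviE_congr ?_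
  filter_upwards [hFy, hdy, hρy.continuousAt.eventually (gt_mem_nhds hy0)] with z h1 h2 h3
  have h4 : 0 < ‖dz e (fun y => (ρ y : ℂ)) z‖ := norm_pos_iff.2 h2
  rw [h1, ← mul_neg, Real.log_mul (div_pos (Real.exp_pos _) h4).ne' (neg_pos.2 h3).ne',
    Real.log_div (Real.exp_pos _).ne' h4.ne', Real.log_exp]
  ring

end Weighted

/-! ### Takeuchi convexity of a domain with an adapted defining function. -/

section DefiningFunction

variable {C P : Type*} [TopologicalSpace C] [ChartedSpace ℂ C]
  [TopologicalSpace P] [ChartedSpace (ℂ × ℂ) P]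
  {B : DiscBundle C P} {e : Trivialization (OnePoint ℂ) B.proj} {x : C} {s : C → P} {ψ : C → ℝ}
  {ρ w : P → ℝ} {O : Set P} {q : P}

namespace DiscBundle

/-- The defining function obtained from `ρ` by multiplication with a global weight, in the flat
coordinates. -/
lemma eventually_weighted_eq (hO : IsOpen O) (hq : q ∈ O)
    (hρ : ContMDiffOn 𝓘(ℝ, ℂ × ℂ) 𝓘(ℝ, ℝ) ω ρ O)
    (hw : ∀ p ∈ (B.coord e x).source, ContMDiffAt 𝓘(ℝ, ℂ × ℂ) 𝓘(ℝ, ℝ) 1 ρ p →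
      w p = poisson (B.localSection s e x (B.coord e x p).1) (B.coord e x p).2 /
        ‖dz (0, 1) (fun y => (((ρ ∘ (B.coord e x).symm) y : ℝ) : ℂ)) (B.coord e x p)‖)
    (had : ∀ᶠ p in 𝓝 q, B.IsAdapted s ψ ρ e x p) :
    ∀ᶠ y in 𝓝 (B.coord e x q),
      ((fun p => w p * Real.exp (-ψ (B.proj p)) * ρ p) ∘ (B.coord e x).symm) y =
        Real.exp (-B.logWeight s ψ e x y) /
          ‖dz (0, 1) (fun y => (((ρ ∘ (B.coord e x).symm) y : ℝ) : ℂ)) y‖ *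
            (ρ ∘ (B.coord e x).symm) y := by
  set κ := B.coord e x with hκ
  have hqs : q ∈ κ.source := had.self_of_nhds.mem_source
  have ht := tendsto_symm_of_mem_source hqs
  filter_upwards [ht.eventually had, ht.eventually (hO.mem_nhds hq),
    κ.open_target.mem_nhds (κ.map_source hqs)] with y hy hyO hyt
  have h1 := hw _ hy.mem_source ((hρ.contMDiffAt (hO.mem_nhds hyO)).of_le (by simp))
  have h2 := hy.poisson_pos
  rw [κ.right_inv hyt] at h1
  rw [← hκ, κ.right_inv hyt] at h2
  simp only [Function.comp_apply, h1]
  rw [proj_coord_symm hyt, logWeight, neg_add, neg_neg, Real.exp_add, Real.exp_log h2]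
  ring

/-- A domain with Levi-flat boundary is Takeuchi `1`-convex if it has a defining function that is
adapted to the weight. -/
lemma isTakeuchiConvex_of_isAdapted [IsManifold 𝓘(ℂ) ω C] [IsManifold 𝓘(ℂ, ℂ × ℂ) ω P]
    [T2Space P] [CompactSpace C] (hs : B.IsHarmonicSection s)
    {Ω : Set P} (hΩ : IsOpen Ω) (hΩc : IsConnected Ω) (hflat : IsLeviFlat (ℂ × ℂ) (frontier Ω))
    (hO : IsOpen O) (hfr : frontier Ω ⊆ O) (hρ : ContMDiffOn 𝓘(ℝ, ℂ × ℂ) 𝓘(ℝ, ℝ) ω ρ O)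
    (hneg : ∀ p ∈ O, ρ p < 0 ↔ p ∈ Ω) (hzero : ∀ p ∈ O, ρ p = 0 ↔ p ∈ frontier Ω)
    (had : ∀ q ∈ O, ∃ e ∈ B.trivs, ∃ x, ∀ᶠ p in 𝓝 q, B.IsAdapted s ψ ρ e x p) :
    IsTakeuchiConvex (ℂ × ℂ) 1 Ω := by
  have := compactSpace_total B
  obtain ⟨w, hw⟩ := exists_weight hs ρ
  have hρc {e : Trivialization (OnePoint ℂ) B.proj} {x : C} {q : P} (he : e ∈ B.trivs) (hq : q ∈ O)
      (hqs : q ∈ (B.coord e x).source) :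
      ContDiffAt ℝ 3 (ρ ∘ (B.coord e x).symm) (B.coord e x q) := by
    have h1 : ContDiffAt ℝ ω (ρ ∘ (B.coord e x).symm) (B.coord e x q) := by
      refine ContMDiffAt.contDiffAt_chart (coord_mem_maximalAtlas he)
        ((B.coord e x).map_source hqs) ?_
      rw [(B.coord e x).left_inv hqs]
      exact hρ.contMDiffAt (hO.mem_nhds hq)
    exact h1.of_le le_top
  -- Each factor is a function on `P`, and in flat coordinates the product is `e^{-g} ρ / |ρ_ζ|`
  -- with `g = -log p + ψ`.
  refine isTakeuchiConvex_one_of_local (f := fun p => w p * Real.exp (-ψ (B.proj p)) * ρ p)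
    hΩ hΩc hO hfr (fun q hq => ?_) (fun q hq => ?_) fun q hqΩ => ?_
  · obtain ⟨e, he, x, hev⟩ := had q hq
    have hqa := hev.self_of_nhds
    exact (contMDiffAt_of_contDiffAt_chart (coord_mem_maximalAtlas he) hqa.mem_source
      (contDiffAt_of_eventually_weighted (hρc he hq hqa.mem_source) hqa.contDiffAt hqa.dz_ne_zero
        (eventually_weighted_eq hO hq hρ (hw e he x) hev))).contMDiffWithinAt
  · obtain ⟨e, he, x, hev⟩ := had q hq
    have hqa := hev.self_of_nhds
    have h1 := weighted_neg_iff hqa.dz_ne_zero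
      (eventually_weighted_eq hO hq hρ (hw e he x) hev)
    simp only [Function.comp_apply, (B.coord e x).left_inv hqa.mem_source] at h1
    rw [h1, hneg q hq]
  · have hq := hfr hqΩ
    obtain ⟨e, he, x, hev⟩ := had q hq
    have hqa := hev.self_of_nhds
    have hqs := hqa.mem_source
    have ha := coord_mem_maximalAtlas (B := B) (x := x) he
    have hF := eventually_weighted_eq hO hq hρ (hw e he x) hev
    set κ := B.coord e x with hκ
    have hq0 : (ρ ∘ κ.symm) (κ q) = 0 := by
      rw [Function.comp_apply, κ.left_inv hqs]
      exact (hzero q hq).2 hqΩ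
    have hd : fderiv ℝ (ρ ∘ κ.symm) (κ q) ≠ 0 := fun h0 => hqa.dz_ne_zero <| by
      rw [dz_ofReal_eq ((hρc he hq hqs).differentiableAt (by norm_num)), h0]
      simp [covectorDz]
    have hz : ∀ᶠ p in 𝓝 q, p ∈ frontier Ω ↔ ρ p = 0 := by
      filter_upwards [hO.mem_nhds hq] with p hp using (hzero p hp).symm
    have hL := hflat.eventually_leviE_eq_zero ha hqΩ hqs ((hρc he hq hqs).of_le (by norm_num)) hz hd
      (1, 0) (0, 1)
    obtain ⟨c, hc, hcev⟩ := levi_lower_bound (fun u => ⟨u.1, u.2, by ext <;> simp⟩)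
      (hρc he hq hqs) hqa.contDiffAt hq0 hqa.dz_ne_zero hL hqa.levi_pos
    refine ⟨κ, ha, hqs, fderiv_weighted_ne_zero (hρc he hq hqs) hqa.contDiffAt hqa.dz_ne_zero hq0 hF,
      c, hc, ?_⟩
    have hκc : ContinuousAt κ q := κ.continuousAt hqs
    filter_upwards [hκc.eventually hcev, hO.mem_nhds hq, κ.open_source.mem_nhds hqs,
      hκc.eventually (leviE_neg_log_weighted (hρc he hq hqs) hqa.dz_ne_zero hF)]
      with p h1 hp hps h2 hpΩ u
    have h3 : (ρ ∘ κ.symm) (κ p) < 0 := by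
      rw [Function.comp_apply, κ.left_inv hps]
      exact (hneg p hp).2 hpΩ
    have h4 := h1 h3 u
    rw [← h2 h3] at h4
    exact h4

end DiscBundle

end DefiningFunction

/-! ### Uniformity over all small displacements, and the theorem. -/

section Main

variable {E : Type*} [NormedAddCommGroup E] [NormedSpace ℂ E]
  {X : Type*} [TopologicalSpace X] [ChartedSpace E X]

lemma TubularNbhd.C2NormLT.mono {S : Set X} {T : TubularNbhd E S} {A : ChartCover E S} {σ : X → ℝ}
    {δ δ' : ℝ} (h : T.C2NormLT A σ δ) (hδ : δ ≤ δ') : T.C2NormLT A σ δ' := fun a ha x hx =>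
  let ⟨h1, h2, h3⟩ := h a ha x hx
  ⟨h1.trans_le hδ, h2.trans_le hδ, h3.trans_le hδ⟩

variable {C P : Type*} [TopologicalSpace C] [ChartedSpace ℂ C]
  [TopologicalSpace P] [ChartedSpace (ℂ × ℂ) P] [IsManifold 𝓘(ℂ) ω C] [IsManifold 𝓘(ℂ, ℂ × ℂ) ω P]
  [T2Space C] [CompactSpace C] [T2Space P]
  {B : DiscBundle C P} (T : TubularNbhd (ℂ × ℂ) (frontier B.disc))
  {s : C → P}

namespace DiscBundle

/-- A single weight is adapted to all small displacements. -/
lemma exists_adapted_nbhd (hs : B.IsHarmonicSection s) (hcrit : (B.criticalPoints s).Finite)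
    (A : ChartCover (ℂ × ℂ) (frontier B.disc)) : ∃ (ψ : C → ℝ) (W : Set P) (δ : ℝ), IsOpen W ∧
      frontier B.disc ⊆ W ∧ 0 < δ ∧ ∀ σ, T.IsAnalyticSection σ → T.C2NormLT A σ δ → ∀ q ∈ W,
        ∃ e ∈ B.trivs, ∃ x, ∀ᶠ p in 𝓝 q,
          B.IsAdapted s ψ (fun p => T.height p - σ (T.base p)) e x p := by
  obtain ⟨ψ, hψ, hpos⟩ := exists_logWeight_pos hs hcrit
  have key : ∀ q ∈ frontier B.disc, ∃ δ > 0, ∃ e ∈ B.trivs, ∃ x, ∀ᶠ p in 𝓝 q, ∀ σ,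
      T.IsAnalyticSection σ → T.C2NormLT A σ δ →
      B.IsAdapted s ψ (fun p => T.height p - σ (T.base p)) e x p := by
    intro q hq
    obtain ⟨e, he, x, hqs, hp⟩ := hpos q hq
    obtain ⟨δ, hδ, hev⟩ := eventually_isAdapted T hs A hψ he hq hqs hp
    exact ⟨δ, hδ, e, he, x, hev⟩
  choose δ hδ e he x hev using key
  obtain ⟨t, hcov⟩ := (isCompact_frontier_disc B).elim_nhds_subcover' _
    fun q hq => interior_mem_nhds.2 (hev q hq)
  obtain ⟨δ₀, hδ₀, hδt⟩ : ∃ δ₀ > 0, ∀ q ∈ t, δ₀ ≤ δ q q.2 := by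
    rcases t.eq_empty_or_nonempty with rfl | hne
    · exact ⟨1, one_pos, by simp⟩
    · obtain ⟨q, hq, hmin⟩ := t.exists_min_image (fun q => δ q q.2) hne
      exact ⟨δ q q.2, hδ _ _, hmin⟩
  refine ⟨ψ, _, δ₀, isOpen_biUnion fun _ _ => isOpen_interior, hcov, hδ₀, fun σ hσ hA q hq => ?_⟩
  obtain ⟨q₀, hq₀, hqq₀⟩ := mem_iUnion₂.1 hq
  refine ⟨e _ q₀.2, he _ _, x _ q₀.2, ?_⟩
  filter_upwards [mem_interior_iff_mem_nhds.1 hqq₀] with p hp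
  exact hp σ hσ (hA.mono (hδt _ hq₀))

/-- The case of a tubular neighbourhood whose height is negative in the disc bundle. -/
lemma exists_takeuchi_of_side [ConnectedSpace C] (hs : B.IsHarmonicSection s)
    (hcrit : (B.criticalPoints s).Finite) (A : ChartCover (ℂ × ℂ) (frontier B.disc))
    (hside : ∀ q ∈ frontier B.disc, ∀ᶠ p in 𝓝 q, p ∈ B.disc ↔ T.height p < 0) :
    ∃ δ : ℝ, 0 < δ ∧ ∀ σ : P → ℝ,
      T.IsAnalyticSection σ → T.C2NormLT A σ δ → IsLeviFlat (ℂ × ℂ) (T.displacement σ) →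
      ∃ Ω : Set P, IsTakeuchiConvex (ℂ × ℂ) 1 Ω ∧ frontier Ω = T.displacement σ ∧
        Ω \ T.carrier = B.disc \ T.carrier := by
  have := compactSpace_total B
  obtain ⟨ψ, W, δ₀, hW, hSW, hδ₀, had⟩ := exists_adapted_nbhd T hs hcrit A
  set V : Set P := T.carrier ∩ (W ∩ interior {p | p ∈ B.disc ↔ T.height p < 0}) with hV
  have hVo : IsOpen V := T.isOpen.inter (hW.inter isOpen_interior)
  have hSV : frontier B.disc ⊆ V := fun q hq =>
    ⟨T.subset hq, hSW hq, mem_interior_iff_mem_nhds.2 (hside q hq)⟩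
  -- A smaller neighbourhood with closure in `V` is needed because `height` is controlled only on
  -- the carrier: it makes the closed collar closed in `P`, hence compact.
  obtain ⟨V₀, hV₀, hSV₀, hVV₀⟩ := normal_exists_closure_subset isClosed_frontier hVo hSV
  obtain ⟨a, ha, hsurj, hcol⟩ := exists_collar T hV₀ hSV₀
  have hcolV {p : P} (hp : p ∈ T.carrier) (hpa : |T.height p| ≤ a) : p ∈ V :=
    hVV₀ (subset_closure (hcol p hp hpa))
  have hhc : ContinuousOn T.height T.carrier := T.analytic_height.continuousOn
  have hN : IsCompact {p | p ∈ T.carrier ∧ |T.height p| ≤ a} := by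
    have h1 : {p | p ∈ T.carrier ∧ |T.height p| ≤ a} =
        closure V₀ ∩ T.height ⁻¹' (Icc (-a) a) := by
      ext p
      simp only [mem_ofPred_eq, mem_inter_iff, mem_preimage, mem_Icc, ← abs_le]
      exact ⟨fun h => ⟨subset_closure (hcol p h.1 h.2), h.2⟩, fun h => ⟨(hVV₀ h.1).1, h.2⟩⟩
    rw [h1]
    exact ((hhc.mono fun p hp => (hVV₀ hp).1).preimage_isClosed_of_isClosed isClosed_closure
      isClosed_Icc).isCompact
  have hN_side : ∀ p ∈ T.carrier, |T.height p| ≤ a → (p ∈ B.disc ↔ T.height p < 0) :=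
    fun p hp hpa => (interior_subset (hcolV hp hpa).2.2 : p ∈ {p | p ∈ B.disc ↔ T.height p < 0})
  -- `δ₀` keeps the weight adapted, and `a / 2` keeps the graph of `σ` inside the collar.
  refine ⟨min δ₀ (a / 2), lt_min hδ₀ (half_pos ha), fun σ hσ hA hflat => ?_⟩
  obtain ⟨Ω, hΩ, hΩc, hfr, hΩU, hmem⟩ := exists_displaced_domain ha (isOpen_disc B)
    (isConnected_disc hs) T.isOpen T.analytic_base.continuousOn hhc
    (ContMDiffOn.continuousOn hσ) T.mapsTo (fun p hp => ⟨T.subset hp, (T.zero_section p hp).2⟩)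
    T.injOn hN hsurj hN_side
    (fun b hb => ((T.abs_lt_of_c2NormLT hA hb).le.trans (min_le_right _ _)))
  refine ⟨Ω, ?_, hfr, hΩU⟩
  have hsm {p : P} (hp : p ∈ T.carrier) : |σ (T.base p)| < a :=
    ((T.abs_lt_of_c2NormLT hA (T.mapsTo hp)).trans_le (min_le_right _ _)).trans (half_lt_self ha)
  refine isTakeuchiConvex_of_isAdapted (ψ := ψ) (ρ := fun p => T.height p - σ (T.base p))
    (O := {p | p ∈ T.carrier ∧ |T.height p| < a}) hs hΩ hΩc (hfr ▸ hflat)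
    (hhc.abs.isOpen_inter_preimage T.isOpen (isOpen_Iio (a := a))) (fun p hp => ?_) ?_
    (fun p hp => ?_) (fun p hp => ?_) fun q hq => ?_
  · rw [hfr] at hp
    refine ⟨hp.1, ?_⟩
    rw [hp.2]
    exact hsm hp.1
  · exact (T.analytic_height.sub hσ).mono fun p hp => hp.1
  · rw [hmem p hp.1 hp.2.le, sub_neg]
  · rw [hfr, sub_eq_zero]
    exact ⟨fun h => ⟨hp.1, h⟩, fun h => h.2⟩
  · exact had σ hσ (hA.mono (min_le_left _ _)) q (hcolV hq.1 hq.2.le).2.1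

end DiscBundle

end Main
/-- Let `D → C` be a disc bundle over a compact Riemann surface of genus at least two, with a
harmonic section that has only finitely many critical points, and let `P → C` be the associated
`ℙ¹`-bundle. Then, for every tubular neighbourhood of `∂D`, each real-analytic Levi-flat displacement
of `∂D` that is sufficiently small in the `C²`-norm is the boundary of a Takeuchi `1`-convex domain,
which agrees with `D` off the tubular neighbourhood. -/
theorem mainTheorem5
    {C : Type*} [TopologicalSpace C] [ChartedSpace ℂ C] [IsManifold 𝓘(ℂ) ω C]
    [T2Space C] [CompactSpace C] [ConnectedSpace C] (hgenus : 2 ≤ genus C)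
    {P : Type*} [TopologicalSpace P] [ChartedSpace (ℂ × ℂ) P] [IsManifold 𝓘(ℂ, ℂ × ℂ) ω P]
    [T2Space P] (B : DiscBundle C P)
    (s : C → P) (hs : B.IsHarmonicSection s) (hcrit : (B.criticalPoints s).Finite)
    (T : TubularNbhd (ℂ × ℂ) (frontier B.disc)) (A : ChartCover (ℂ × ℂ) (frontier B.disc)) :
    ∃ δ : ℝ, 0 < δ ∧ ∀ σ : P → ℝ,
      T.IsAnalyticSection σ → T.C2NormLT A σ δ → IsLeviFlat (ℂ × ℂ) (T.displacement σ) →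
      ∃ Ω : Set P, IsTakeuchiConvex (ℂ × ℂ) 1 Ω ∧ frontier Ω = T.displacement σ ∧
        Ω \ T.carrier = B.disc \ T.carrier := by
  -- The normal coordinate may point inwards on some components of `∂D`. Multiplying `height` and
  -- `σ` by the same locally constant sign normalizes this without changing the displacement or the
  -- norm bound.
  obtain ⟨τ, hτ, hev⟩ := DiscBundle.exists_side_sign T
  have hloc : ∀ q ∈ frontier B.disc, ∀ᶠ p in 𝓝 q, p ∈ frontier B.disc → τ p = τ q :=
    fun q hq => (hev q hq).mono fun p hp => hp.1
  have hside : ∀ q ∈ frontier B.disc, ∀ᶠ p in 𝓝 q,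
      p ∈ B.disc ↔ (T.changeSign hτ hloc).height p < 0 := by
    intro q hq
    have h1 := T.eventually_sign_base hloc (T.subset hq)
    rw [(T.zero_section q hq).1] at h1
    filter_upwards [hev q hq, h1] with p hp hp1
    rw [hp.2.2, ← hp1]
    rfl
  obtain ⟨δ, hδ, hmain⟩ :=
    DiscBundle.exists_takeuchi_of_side (T.changeSign hτ hloc) hs hcrit A hside
  refine ⟨δ, hδ, fun σ hσ hA hflat => ?_⟩
  have h2 := T.changeSign_displacement hτ hloc σ
  obtain ⟨Ω, hΩ, hfr, hout⟩ := hmain (fun p => τ p * σ p) (T.changeSign_isAnalyticSection hτ hloc hσ)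
    (T.changeSign_c2NormLT hτ hloc hA) (h2.symm ▸ hflat)
  exact ⟨Ω, hΩ, hfr.trans h2, hout⟩
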